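/- \textbf{Conventions.} A $2$-complex is a graph (loops and parallel edges allowed) with faces attached along nonempty closed walks. The link graph at a vertex $v$ is the incidence multigraph between edges and faces at $v$: its vertices are the edge-ends at $v$ (a loop at $v$ contributes two), and each passage of a face boundary through $v$ gives an edge between the two edge-ends it uses. For a set $S$ of edges of a $2$-complex $C_1$, the contraction $C_1/S$ is obtained by identifying vertices joined by paths of edges in $S$ and erasing the edges of $S$ from the edge set and from all face boundaries (a face whose boundary consists only of edges of $S$ disappears); loops may be contracted as well. \textbf{Setting.} Let $n\ge 20$ and let $C$ be the cuboid complex of size $(2n+1)\times n\times n$: its vertices are the integer points of $[0,2n+1]\times[0,n]\times[0,n]$, its edges join points at distance $1$, and a face is attached to every $4$-cycle. Let $C'$ be obtained from $C$ by subdividing some of its square faces into two triangles by one of their two diagonals; these diagonals are the diagonal edges of $C'$. Let $T'$ be a spanning tree of the $1$-skeleton of $C'$ such that (i) $T'$ contains all diagonal edges, and (ii) every fundamental cycle of $T'$ (the cycle formed by an edge of $C'$ outside $T'$ and edges of $T'$) contains three consecutive diagonal edges in the same direction (collinear in $\mathbb R^3$) whose two common end vertices are interior points of the cuboid. Let $C''=C'/T'$.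 Let $G_{13}$ be the graph with vertices $X_1,X_2,X_3,Y_1,Y_2,Y_3,K,L,M,N,Q,R,S$ and edges $X_1Y_1$, $X_1Y_2$, $X_2Y_1$, $X_2Y_2$, $X_3Y_1$, $X_3Y_2$, $X_1Y_3$, $X_3K$, $KY_3$, $X_2L$, $LM$, $MY_3$, $Y_2K$, $Y_1K$, $X_1X_2$, $X_3S$, $LQ$, $LN$, $MQ$, $MN$, $RY_3$, $RQ$, $RN$, $RS$, $SQ$, $SN$. \textbf{Lemma.} (1) For every fundamental cycle $o$ of $T'$, the link graph of $C'/o$ at the vertex $\underline{o}$ to which exactly the vertices of $o$ are contracted has $G_{13}$ as a minor and is not planar. (2) For every edge $e''$ of $C''$, the $2$-complex $C''/e''$ has exactly one vertex, and its link graph at this vertex is not planar. -/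

import Mathlib

open Set

noncomputable section

/-! ### Multigraphs: planarity and minors -/

namespace Graph

variable {α β : Type*}

/-- A (topological) planar embedding of a multigraph: distinct vertices go to distinct points of
the Euclidean plane, every edge goes to a curve joining the images of its two ends, and these curves
are simple and meet each other and the vertices only at their end points. -/
structure PlaneEmbedding (G : Graph α β) where
  pos : α → EuclideanSpace ℝ (Fin 2)
  arc : β → ℝ → EuclideanSpace ℝ (Fin 2)
  pos_injOn : InjOn pos G.vertexSet
  arc_continuousOn : ∀ e ∈ G.edgeSet, ContinuousOn (arc e) (Icc 0 1)
  arc_ends : ∀ e ∈ G.edgeSet, ∃ x y, G.IsLink e x y ∧ arc e 0 = pos x ∧ arc e 1 = pos y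
  arc_injOn : ∀ e ∈ G.edgeSet, InjOn (arc e) (Ioo 0 1)
  arc_ne_pos : ∀ e ∈ G.edgeSet, ∀ x ∈ G.vertexSet, ∀ t ∈ Ioo (0 : ℝ) 1, arc e t ≠ pos x
  arc_ne_arc : ∀ e ∈ G.edgeSet, ∀ f ∈ G.edgeSet, e ≠ f →
    ∀ s ∈ Ioo (0 : ℝ) 1, ∀ t ∈ Ioo (0 : ℝ) 1, arc e s ≠ arc f t

/-- A multigraph is planar if it can be embedded in the plane. -/
def IsPlanar (G : Graph α β) : Prop := Nonempty G.PlaneEmbedding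

/-- A nonempty set of vertices which induces a connected subgraph. -/
def IsConnectedSet (G : Graph α β) (B : Set α) : Prop :=
  B ⊆ G.vertexSet ∧ B.Nonempty ∧
    ∀ x ∈ B, ∀ y ∈ B, Relation.ReflTransGen (fun a b => a ∈ B ∧ b ∈ B ∧ G.Adj a b) x y

/-- The simple graph `H` is a minor of `G`: there are disjoint connected branch sets in `G`, one for
each vertex of `H`, with an edge of `G` between any two that belong to adjacent vertices. -/
def HasMinor {W : Type*} (G : Graph α β) (H : SimpleGraph W) : Prop :=
  ∃ B : W → Set α, (∀ w, G.IsConnectedSet (B w)) ∧ Pairwise (fun w w' => Disjoint (B w) (B w')) ∧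
    ∀ w w', H.Adj w w' → ∃ x ∈ B w, ∃ y ∈ B w', G.Adj x y

end Graph

/-- The vertices of the graph `G13`. -/
inductive G13Vertex
  | X1 | X2 | X3 | Y1 | Y2 | Y3 | K | L | M | N | Q | R | S

open G13Vertex in
/-- The graph `G13` on 13 vertices. -/
def G13 : SimpleGraph G13Vertex := SimpleGraph.fromEdgeSet
  {s(X1, Y1), s(X1, Y2), s(X2, Y1), s(X2, Y2), s(X3, Y1), s(X3, Y2), s(X1, Y3), s(X3, K), s(K, Y3),
   s(X2, L), s(L, M), s(M, Y3), s(Y2, K), s(Y1, K), s(X1, X2), s(X3, S), s(L, Q), s(L, N), s(M, Q),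
   s(M, N), s(R, Y3), s(R, Q), s(R, N), s(R, S), s(S, Q), s(S, N)}

/-! ### 2-complexes -/

/-- `IsDartWalk src tgt l u v`: the list `l` of oriented edges is a walk from `u` to `v`. -/
def IsDartWalk {V A : Type*} (src tgt : A → V) : List A → V → V → Prop
  | [], u, v => u = v
  | d :: l, u, v => src d = u ∧ IsDartWalk src tgt l (tgt d) v

/-- A (combinatorial) 2-complex: a graph, possibly with loops and parallel edges, together with
faces attached along nonempty closed walks. An oriented edge (dart) is a pair `(e, b)`; it runs from
`tail e` to `head e` if `b = true`, and from `head e` to `tail e` if `b = false`. -/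
structure TwoComplex where
  V : Type
  E : Type
  F : Type
  tail : E → V
  head : E → V
  bdry : F → List (E × Bool)
  bdry_ne_nil : ∀ f, bdry f ≠ []
  bdry_closed : ∀ f, ∃ v, IsDartWalk (fun d : E × Bool => cond d.2 (tail d.1) (head d.1))
    (fun d : E × Bool => cond d.2 (head d.1) (tail d.1)) (bdry f) v v

namespace TwoComplex

variable (C : TwoComplex)

abbrev Dart : Type := C.E × Bool

variable {C} in
/-- The first vertex of a dart. -/
def src (d : C.Dart) : C.V := cond d.2 (C.tail d.1) (C.head d.1)

variable {C} in
/-- The last vertex of a dart. -/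
def tgt (d : C.Dart) : C.V := cond d.2 (C.head d.1) (C.tail d.1)

variable {C} in
/-- The same edge, traversed in the opposite direction. -/
def rev (d : C.Dart) : C.Dart := (d.1, !d.2)

/-- The pair of end vertices of an edge. -/
def ends (e : C.E) : Sym2 C.V := s(C.tail e, C.head e)

/-- A corner of a face: a position in its boundary walk, standing for the passage from the dart at
this position to the cyclically next one. -/
abbrev Corner : Type := Σ f : C.F, Fin (C.bdry f).length

variable {C} in
/-- The dart along which the boundary walk arrives at the corner, turned so that it starts there. -/
def cornerIn (c : C.Corner) : C.Dart := rev ((C.bdry c.1).get c.2)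

variable {C} in
/-- The dart along which the boundary walk leaves the corner. -/
def cornerOut (c : C.Corner) : C.Dart :=
  (C.bdry c.1).get ⟨(c.2 + 1) % (C.bdry c.1).length, Nat.mod_lt _ c.2.pos⟩

/-- The link graph at `v`: its vertices are the edges at `v` (a loop at `v` counts twice, once for
each of its two ends), and each passage of a face through `v` gives an edge between the two ends of
edges that it uses. -/
def link (v : C.V) : Graph C.Dart C.Corner where
  vertexSet := {d | src d = v}
  IsLink c x y := src x = v ∧ src y = v ∧
    ((x = cornerIn c ∧ y = cornerOut c) ∨ (x = cornerOut c ∧ y = cornerIn c))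
  isLink_symm := fun _ _ => ⟨fun _ _ h => ⟨h.2.1, h.1, h.2.2.symm.imp And.symm And.symm⟩⟩
  eq_or_eq_of_isLink_of_isLink := by
    rintro c x y z w ⟨-, -, (⟨rfl, rfl⟩ | ⟨rfl, rfl⟩)⟩ ⟨-, -, (⟨rfl, rfl⟩ | ⟨rfl, rfl⟩)⟩ <;> simp
  left_mem_of_isLink := fun _ _ _ h => h.1

/-- Two vertices are identified by the contraction of the edge set `S` if they are connected by
edges of `S`. -/
def contractSetoid (S : Set C.E) : Setoid C.V :=
  Relation.EqvGen.setoid (fun u v => ∃ e ∈ S, C.tail e = u ∧ C.head e = v)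

open Classical in
/-- Erases the edges in `S` from a list of darts. -/
def eraseEdges (S : Set C.E) (l : List C.Dart) : List ({e : C.E // e ∉ S} × Bool) :=
  l.filterMap (fun d => if h : d.1 ∉ S then some (⟨d.1, h⟩, d.2) else none)

theorem isDartWalk_eraseEdges (S : Set C.E) (l : List C.Dart) (u v : C.V)
    (h : IsDartWalk (fun d : C.Dart => cond d.2 (C.tail d.1) (C.head d.1))
      (fun d : C.Dart => cond d.2 (C.head d.1) (C.tail d.1)) l u v) :
    IsDartWalk
      (fun d : {e : C.E // e ∉ S} × Bool => cond d.2
        (Quotient.mk (C.contractSetoid S) (C.tail d.1.1))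
        (Quotient.mk (C.contractSetoid S) (C.head d.1.1)))
      (fun d : {e : C.E // e ∉ S} × Bool => cond d.2
        (Quotient.mk (C.contractSetoid S) (C.head d.1.1))
        (Quotient.mk (C.contractSetoid S) (C.tail d.1.1)))
      (C.eraseEdges S l)
      (Quotient.mk (C.contractSetoid S) u) (Quotient.mk (C.contractSetoid S) v) := by
  induction l generalizing u with
  | nil => exact congrArg _ h
  | cons d l ih =>
    obtain ⟨h1, h2⟩ := h
    have ih' := ih _ h2
    obtain ⟨e, b⟩ := d
    by_cases he : e ∈ S
    · have key : Quotient.mk (C.contractSetoid S) (C.tail e)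
          = Quotient.mk (C.contractSetoid S) (C.head e) :=
        Quotient.sound (Relation.EqvGen.rel _ _ ⟨e, he, rfl, rfl⟩)
      have hl : C.eraseEdges S ((e, b) :: l) = C.eraseEdges S l := by
        simp [eraseEdges, he]
      rw [hl]
      cases b <;> simp_all
    · have hl : C.eraseEdges S ((e, b) :: l) = (⟨e, he⟩, b) :: C.eraseEdges S l := by
        simp [eraseEdges, he]
      rw [hl]
      refine ⟨?_, ?_⟩
      · cases b <;> simp_all
      · cases b <;> simpa using ih'

/-- The contraction `C/S` of a set `S` of edges: the vertices connected by `S` are identified, and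
the edges in `S` are removed and erased from the boundaries of the faces. A face that has only
edges of `S` on its boundary disappears. -/
def contract (S : Set C.E) : TwoComplex where
  V := Quotient (C.contractSetoid S)
  E := {e : C.E // e ∉ S}
  F := {f : C.F // C.eraseEdges S (C.bdry f) ≠ []}
  tail e := Quotient.mk _ (C.tail e.1)
  head e := Quotient.mk _ (C.head e.1)
  bdry f := C.eraseEdges S (C.bdry f.1)
  bdry_ne_nil f := f.2
  bdry_closed f := by
    obtain ⟨v, hv⟩ := C.bdry_closed f.1
    exact ⟨Quotient.mk _ v, C.isDartWalk_eraseEdges S _ v v hv⟩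

/-- The vertex of `C/S` to which the vertex `v` of `C` is contracted. -/
def toContract (S : Set C.E) (v : C.V) : (C.contract S).V := Quotient.mk (C.contractSetoid S) v

/-- `o` is the edge set of a cycle of the 1-skeleton: it is traversed by a nonempty closed walk that
repeats no vertex and no edge. -/
def IsCycle (o : Set C.E) : Prop :=
  ∃ l : List C.Dart, l ≠ [] ∧ (∃ v, IsDartWalk src tgt l v v) ∧ (l.map src).Nodup ∧
    (l.map Prod.fst).Nodup ∧ o = {e | e ∈ l.map Prod.fst}

/-- `T` is the edge set of a spanning tree of the 1-skeleton: it connects all vertices and contains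
no cycle. -/
def IsSpanningTree (T : Set C.E) : Prop :=
  (∀ u v, (∃ l : List C.Dart, (∀ d ∈ l, d.1 ∈ T) ∧ IsDartWalk src tgt l u v)) ∧
    ∀ o, C.IsCycle o → ¬ o ⊆ T

/-- `o` is a fundamental cycle of the spanning tree `T`: the cycle formed by an edge `e` outside `T`
together with edges of `T`. -/
def IsFundamentalCycle (T : Set C.E) (o : Set C.E) : Prop :=
  C.IsCycle o ∧ ∃ e, e ∉ T ∧ e ∈ o ∧ o ⊆ insert e T

end TwoComplex

/-! ### The cuboid complex and its subdivisions by diagonals -/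

/-- The integer points of the cuboid `[0, N 0] × [0, N 1] × [0, N 2]`. -/
def cuboidPoints (N : Fin 3 → ℕ) : Set (Fin 3 → ℤ) := Icc 0 (fun i => (N i : ℤ))

/-- The unit vector in direction `i`. -/
def unitVec (i : Fin 3) : Fin 3 → ℤ := Pi.single i 1

/-- The edges of the cuboid graph: the edge `(p, i)` joins `p` and `p + unitVec i`. -/
def CuboidEdge (N : Fin 3 → ℕ) : Type :=
  {x : (Fin 3 → ℤ) × Fin 3 // x.1 ∈ cuboidPoints N ∧ x.1 + unitVec x.2 ∈ cuboidPoints N}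

/-- The 4-cycles of the cuboid graph, that is, the faces of the cuboid complex. For `i < j`, the
square `(p, i, j)` has the corners `p`, `p + unitVec i`, `p + unitVec i + unitVec j` and
`p + unitVec j`. -/
def CuboidSquare (N : Fin 3 → ℕ) : Type :=
  {x : (Fin 3 → ℤ) × Fin 3 × Fin 3 // x.2.1 < x.2.2 ∧ x.1 ∈ cuboidPoints N ∧
    x.1 + unitVec x.2.1 + unitVec x.2.2 ∈ cuboidPoints N}

theorem add_unitVec_mem {N : Fin 3 → ℕ} {p : Fin 3 → ℤ} {i j : Fin 3}
    (hp : p ∈ cuboidPoints N) (h : p + unitVec i + unitVec j ∈ cuboidPoints N) :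
    p + unitVec i ∈ cuboidPoints N := by
  have h0 : ∀ k : Fin 3, (0 : Fin 3 → ℤ) ≤ unitVec k := fun k => Pi.single_nonneg.2 zero_le_one
  exact ⟨hp.1.trans (le_add_of_nonneg_right (h0 i)), (le_add_of_nonneg_right (h0 j)).trans h.2⟩

namespace CuboidSquare

variable {N : Fin 3 → ℕ} (s : CuboidSquare N)

/-- The corner `p` of the square `(p, i, j)`. -/
def c00 : cuboidPoints N := ⟨s.1.1, s.2.2.1⟩

/-- The corner `p + unitVec i` of the square `(p, i, j)`. -/
def c10 : cuboidPoints N := ⟨s.1.1 + unitVec s.1.2.1, add_unitVec_mem s.2.2.1 s.2.2.2⟩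

/-- The corner `p + unitVec j` of the square `(p, i, j)`. -/
def c01 : cuboidPoints N :=
  ⟨s.1.1 + unitVec s.1.2.2, add_unitVec_mem s.2.2.1 (by
    have h := s.2.2.2
    rwa [add_right_comm] at h)⟩

/-- The corner `p + unitVec i + unitVec j` of the square `(p, i, j)`. -/
def c11 : cuboidPoints N := ⟨s.1.1 + unitVec s.1.2.1 + unitVec s.1.2.2, s.2.2.2⟩

/-- The side from `c00` to `c10`. -/
def bottom : CuboidEdge N := ⟨(s.1.1, s.1.2.1), s.c00.2, s.c10.2⟩

/-- The side from `c00` to `c01`. -/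
def left : CuboidEdge N := ⟨(s.1.1, s.1.2.2), s.c00.2, s.c01.2⟩

/-- The side from `c10` to `c11`. -/
def right : CuboidEdge N := ⟨(s.1.1 + unitVec s.1.2.1, s.1.2.2), s.c10.2, s.c11.2⟩

/-- The side from `c01` to `c11`. -/
def top : CuboidEdge N := ⟨(s.1.1 + unitVec s.1.2.2, s.1.2.1), s.c01.2, by
  have h := s.2.2.2
  rwa [add_right_comm] at h⟩

end CuboidSquare

/-- The two diagonals of a square: `main` joins `c00` and `c11`, and `anti` joins `c10` and `c01`. -/
inductive Diagonal
  | main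
  | anti

/-- The first end of a diagonal of a square. -/
def Diagonal.start {N : Fin 3 → ℕ} (s : CuboidSquare N) : Diagonal → cuboidPoints N
  | main => s.c00
  | anti => s.c10

/-- The second end of a diagonal of a square. -/
def Diagonal.finish {N : Fin 3 → ℕ} (s : CuboidSquare N) : Diagonal → cuboidPoints N
  | main => s.c11
  | anti => s.c01

/-- The edges of the cuboid complex in which each square `s` with `D s = some δ` is subdivided by
its diagonal `δ`: the edges of the cuboid graph and the diagonal edges. -/
abbrev SubdividedEdge (N : Fin 3 → ℕ) (D : CuboidSquare N → Option Diagonal) : Type :=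
  CuboidEdge N ⊕ {s : CuboidSquare N // (D s).isSome}

/-- The boundary of one of the two triangles into which a diagonal cuts a square; `a` and `d` stand
for the inclusions of the edges of the cuboid graph and for the diagonal edge. -/
def triangleBdry {N : Fin 3 → ℕ} {E : Type} (a : CuboidEdge N → E) (s : CuboidSquare N) (d : E) :
    Diagonal → Bool → List (E × Bool)
  | .main, false => [(a s.bottom, true), (a s.right, true), (d, false)]
  | .main, true => [(d, true), (a s.top, false), (a s.left, false)]
  | .anti, false => [(a s.bottom, true), (d, true), (a s.left, false)]
  | .anti, true => [(a s.right, true), (a s.top, false), (d, false)]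

/-- The cuboid complex of size `N 0 × N 1 × N 2` in which each square `s` with `D s = some δ` is
subdivided by its diagonal `δ` into two triangles; the squares `s` with `D s = none` are kept. -/
def subdividedCuboid (N : Fin 3 → ℕ) (D : CuboidSquare N → Option Diagonal) : TwoComplex where
  V := cuboidPoints N
  E := SubdividedEdge N D
  F := {s : CuboidSquare N // D s = none} ⊕ ({s : CuboidSquare N // (D s).isSome} × Bool)
  tail := Sum.elim (fun e => ⟨e.1.1, e.2.1⟩) (fun s => ((D s.1).get s.2).start s.1)
  head := Sum.elim (fun e => ⟨e.1.1 + unitVec e.1.2, e.2.2⟩)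
    (fun s => ((D s.1).get s.2).finish s.1)
  bdry := Sum.elim
    (fun s => [(Sum.inl s.1.bottom, true), (Sum.inl s.1.right, true), (Sum.inl s.1.top, false),
      (Sum.inl s.1.left, false)])
    (fun x => triangleBdry Sum.inl x.1.1 (Sum.inr x.1) ((D x.1.1).get x.1.2) x.2)
  bdry_ne_nil := by
    rintro (s | ⟨s, b⟩)
    · simp
    · cases h : (D s.1).get s.2 <;> cases b <;> simp [h, triangleBdry]
  bdry_closed := by
    rintro (s | ⟨s, b⟩)
    · refine ⟨s.1.c00, rfl, rfl, ?_, rfl, rfl⟩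
      exact Subtype.ext (add_right_comm _ _ _)
    · have hs : ∀ δ, (D s.1).get s.2 = δ → ((D s.1).get s.2).start s.1 = δ.start s.1 :=
        fun δ h => by rw [h]
      have hf : ∀ δ, (D s.1).get s.2 = δ → ((D s.1).get s.2).finish s.1 = δ.finish s.1 :=
        fun δ h => by rw [h]
      have hc : (⟨s.1.1.1 + unitVec s.1.1.2.2 + unitVec s.1.1.2.1, s.1.top.2.2⟩ : cuboidPoints N)
          = s.1.c11 := Subtype.ext (add_right_comm _ _ _)
      change ∃ v, IsDartWalk _ _ (triangleBdry Sum.inl s.1 (Sum.inr s) ((D s.1).get s.2) b) v v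
      cases h : (D s.1).get s.2 <;> cases b
      · exact ⟨s.1.c00, rfl, rfl, hf _ h, hs _ h⟩
      · exact ⟨s.1.c00, hs _ h, hc.trans (hf _ h).symm, rfl, rfl⟩
      · exact ⟨s.1.c00, rfl, hs _ h, (hf _ h).symm, rfl⟩
      · exact ⟨s.1.c10, rfl, hc, hf _ h, hs _ h⟩

/-- The point `p` lies in the interior of the cuboid. -/
def IsInteriorPoint {N : Fin 3 → ℕ} (p : cuboidPoints N) : Prop :=
  ∀ i, 0 < p.1 i ∧ p.1 i < N i

/-- The edge set `o` contains three consecutive diagonal edges in the same direction, whose two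
common end vertices are interior points of the cuboid. -/
def HasStraightTriple {N : Fin 3 → ℕ} {D : CuboidSquare N → Option Diagonal}
    (o : Set (subdividedCuboid N D).E) : Prop :=
  ∃ (v₀ v₁ v₂ v₃ : cuboidPoints N) (s₁ s₂ s₃ : {s : CuboidSquare N // (D s).isSome}),
    Sum.inr s₁ ∈ o ∧ Sum.inr s₂ ∈ o ∧ Sum.inr s₃ ∈ o ∧
    (subdividedCuboid N D).ends (Sum.inr s₁) = s(v₀, v₁) ∧
    (subdividedCuboid N D).ends (Sum.inr s₂) = s(v₁, v₂) ∧
    (subdividedCuboid N D).ends (Sum.inr s₃) = s(v₂, v₃) ∧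
    v₁.1 - v₀.1 = v₂.1 - v₁.1 ∧ v₂.1 - v₁.1 = v₃.1 - v₂.1 ∧
    IsInteriorPoint v₁ ∧ IsInteriorPoint v₂

end

/-! ### Independent paths in the plane -/

/-! Both parts are handled before contracting. Contract a set `S` with `o ⊆ S ⊆ insert e T`: for (1)
take `S = o`, for (2) take `S = insert e T`. Then `o` is the only cycle in `S`, and `S` without a
diagonal edge of `o` is a forest. Let E₁, E₂, E₃ be the straight triple, v₀, …, v₃ its vertices and
δ = α + β its direction, with α and β signed coordinate directions.

At an interior vertex the link graph of the cuboid is the octahedron on the six coordinate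
directions; a diagonal at the vertex only subdivides an edge of it. At each of v₁ and v₂ the triple
occupies the opposite edges {α, β} and {-α, -β}. The two octahedra without these edges make up all
of `G13` except Y₃ and the edges leaving them. The two triangles at E₂ give two edges between the
octahedra (LX₂ and SX₃). All that is reached from v₀ or v₃ without passing v₁ or v₂ forms one more
branch set, Y₃, because the rest of `o` joins v₀ to v₃; the triangles at E₁ and E₃ join it to X₁, K
and to R, M.

If an edge of `S` outside the triple leaves v₁ or v₂, its place in the octahedron is taken by all
that hangs behind it. These pieces are disjoint because `S` has no second cycle. They are connected
because contracting an edge glues two link graphs at a vertex of each, so that "connected, also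
after deletion of any one vertex" survives the contraction of a forest (`linkConn_of_isForest`).
This property is needed with the triple and its faces removed; away from v₁ and v₂ that removal
destroys at most one edge of the octahedron (`linkConn_of_triple`).

`G13` has a K₃,₃ minor. For K₃,₃ in the plane (`not_exists_independent_paths`): if curves f and g
are disjoint, then f(s) - g(t) has a logarithm on the whole square, and its changes along the four
sides give an integer equation. The 18 equations of the pairs of independent edges contradict each
other modulo 2. -/

theorem exp_lift_sub_eq {L L' : ℝ → ℂ} (hL : Continuous L) (hL' : Continuous L')
    (h : ∀ t, Complex.exp (L t) = Complex.exp (L' t)) : L 1 - L 0 = L' 1 - L' 0 := by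
  have key : L = fun t => L' t + (L 0 - L' 0) := by
    refine Complex.isCoveringMap_exp.eq_of_comp_eq (a := 0) hL (hL'.add continuous_const) ?_ (by simp)
    funext t
    apply Subtype.ext
    have h0 : Complex.exp (L 0 - L' 0) = 1 := by
      rw [Complex.exp_sub, h 0, div_self (Complex.exp_ne_zero _)]
    simp [Complex.exp_add, h0, h t]
  have := congrFun key 1
  rw [this]; ring

open Classical in
/-- The change of a continuous logarithm of `h` between the parameters `0` and `1`. -/
noncomputable def logChange (h : ℝ → ℂ) : ℂ :=
  if H : ∃ L : ℝ → ℂ, Continuous L ∧ ∀ t, Complex.exp (L t) = h t then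
    H.choose 1 - H.choose 0 else 0

theorem logChange_eq {h L : ℝ → ℂ} (hL : Continuous L) (hh : ∀ t, Complex.exp (L t) = h t) :
    logChange h = L 1 - L 0 := by
  have H : ∃ L : ℝ → ℂ, Continuous L ∧ ∀ t, Complex.exp (L t) = h t := ⟨L, hL, hh⟩
  rw [logChange, dif_pos H]
  exact exp_lift_sub_eq H.choose_spec.1 hL fun t => (H.choose_spec.2 t).trans (hh t).symm

/-- The exponential is a covering of the punctured plane, so maps from simply connected, locally
path connected spaces lift through it. The cases needed are ℝ and ℝ × ℝ. -/
theorem exists_log_lift {X : Type} [TopologicalSpace X] [LocallyPathConnectedSpace X]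
    [SimplyConnectedSpace X] {h : X → ℂ} (hc : Continuous h) (h0 : ∀ t, h t ≠ 0) :
    ∃ L : X → ℂ, Continuous L ∧ ∀ t, Complex.exp (L t) = h t := by
  obtain ⟨x⟩ := (inferInstance : Nonempty X)
  obtain ⟨F, ⟨-, hF⟩, -⟩ := Complex.isCoveringMapOn_exp.existsUnique_continuousMap_lifts
    ⟨h, hc⟩ (a₀ := x) (Complex.exp_log (h0 x)) h0
  exact ⟨F, F.continuous, congrFun hF⟩

theorem exp_logChange {h : ℝ → ℂ} (hc : Continuous h) (h0 : ∀ t, h t ≠ 0) :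
    Complex.exp (logChange h) = h 1 / h 0 := by
  obtain ⟨L, hL, hh⟩ := exists_log_lift hc h0
  rw [logChange_eq hL hh, Complex.exp_sub, hh, hh]

theorem exists_logChange_eq {h : ℝ → ℂ} (hc : Continuous h) (h0 : ∀ t, h t ≠ 0) :
    ∃ k : ℤ, logChange h = Complex.log (h 1) - Complex.log (h 0) + k * (2 * Real.pi * Complex.I) := by
  rw [← Complex.exp_eq_exp_iff_exists_int, exp_logChange hc h0, Complex.exp_sub,
    Complex.exp_log (h0 _), Complex.exp_log (h0 _)]

theorem exists_log_neg_eq {z : ℂ} (hz : z ≠ 0) :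
    ∃ m : ℤ, Complex.log z = Complex.log (-z) + Real.pi * Complex.I + m * (2 * Real.pi * Complex.I) := by
  rw [← Complex.exp_eq_exp_iff_exists_int, Complex.exp_log hz, Complex.exp_add,
    Complex.exp_log (neg_ne_zero.2 hz), Complex.exp_pi_mul_I]
  ring

/-- The function `f s - g t` has a logarithm on the whole parameter plane, and both ways along the
sides of the unit square from (0, 0) to (1, 1) change it by the same amount. Writing two of the
sides with `g t - f s` only shifts the logarithm by the constant πi. -/
theorem logChange_square {f g : ℝ → ℂ} (hf : Continuous f) (hg : Continuous g)
    (h : ∀ s t, f s ≠ g t) :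
    logChange (fun s => f s - g 0) + logChange (fun t => g t - f 1) =
      logChange (fun s => f s - g 1) + logChange (fun t => g t - f 0) := by
  obtain ⟨L, hL, hh⟩ := exists_log_lift (X := ℝ × ℝ) (h := fun x => f x.1 - g x.2) (by fun_prop)
    fun x => sub_ne_zero.2 (h _ _)
  have h1 : ∀ t, logChange (fun s => f s - g t) = L (1, t) - L (0, t) := fun t =>
    logChange_eq (L := fun s => L (s, t)) (by fun_prop) fun s => hh (s, t)
  have h2 : ∀ s, logChange (fun t => g t - f s) = L (s, 1) - L (s, 0) := fun s => by
    rw [logChange_eq (L := fun t => L (s, t) + Real.pi * Complex.I) (by fun_prop)]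
    · ring
    · intro t
      rw [Complex.exp_add, Complex.exp_pi_mul_I, hh]
      ring
  rw [h1, h1, h2, h2]; ring

/-- There is no drawing of `K_{3,3}` in the plane in which independent edges are disjoint. -/
theorem not_exists_independent_paths (p q : Fin 3 → ℂ) (γ : Fin 3 → Fin 3 → ℝ → ℂ)
    (hc : ∀ i j, Continuous (γ i j)) (h0 : ∀ i j, γ i j 0 = p i) (h1 : ∀ i j, γ i j 1 = q j)
    (hd : ∀ i j k l, i ≠ k → j ≠ l → ∀ s t, γ i j s ≠ γ k l t) : False := by
  have hI : (2 * Real.pi * Complex.I : ℂ) ≠ 0 := Complex.two_pi_I_ne_zero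
  have other : ∀ i : Fin 3, ∃ j, j ≠ i := by decide
  -- The point `p i` lies on a curve `γ i j` with `j ≠ l`, which is independent of `γ k l`; so
  -- disjointness of independent curves already keeps a curve off the end points that are not its
  -- own.
  have hpe : ∀ i k l, i ≠ k → ∀ t, γ k l t - p i ≠ 0 := fun i k l hik t => by
    obtain ⟨j, hj⟩ := other l
    rw [sub_ne_zero, ← h0 i j]
    exact hd _ _ _ _ hik.symm hj.symm _ _
  have hqe : ∀ j k l, j ≠ l → ∀ t, γ k l t - q j ≠ 0 := fun j k l hjl t => by
    obtain ⟨i, hi⟩ := other k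
    rw [sub_ne_zero, ← h1 i j]
    exact hd _ _ _ _ hi.symm hjl.symm _ _
  -- The inequality is placed inside the existential so that `choose` yields integers for all
  -- indices; the value 0 at `i = k` carries no information.
  have hkp : ∀ i k l, ∃ n : ℤ, i ≠ k → logChange (fun t => γ k l t - p i) =
      Complex.log (q l - p i) - Complex.log (p k - p i) + n * (2 * Real.pi * Complex.I) := by
    intro i k l
    by_cases hik : i = k
    · exact ⟨0, fun h => (h hik).elim⟩
    · obtain ⟨n, hn⟩ := exists_logChange_eq (h := fun t => γ k l t - p i)
        ((hc k l).sub continuous_const) (hpe i k l hik)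
      simp only [h0, h1] at hn
      exact ⟨n, fun _ => hn⟩
  have hkq : ∀ j k l, ∃ n : ℤ, j ≠ l → logChange (fun t => γ k l t - q j) =
      Complex.log (q l - q j) - Complex.log (p k - q j) + n * (2 * Real.pi * Complex.I) := by
    intro j k l
    by_cases hjl : j = l
    · exact ⟨0, fun h => (h hjl).elim⟩
    · obtain ⟨n, hn⟩ := exists_logChange_eq (h := fun t => γ k l t - q j)
        ((hc k l).sub continuous_const) (hqe j k l hjl)
      simp only [h0, h1] at hn
      exact ⟨n, fun _ => hn⟩
  have neg : ∀ x y : ℂ, ∃ m : ℤ, x ≠ y → Complex.log (y - x) =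
      Complex.log (x - y) + Real.pi * Complex.I + m * (2 * Real.pi * Complex.I) := fun x y => by
    by_cases hxy : x = y
    · exact ⟨0, fun h => (h hxy).elim⟩
    · obtain ⟨m, hm⟩ := exists_log_neg_eq (sub_ne_zero.2 (Ne.symm hxy))
      rw [neg_sub] at hm
      exact ⟨m, fun _ => hm⟩
  choose kp hkp using hkp
  choose kq hkq using hkq
  choose m hm using neg
  have hp : ∀ i k, i ≠ k → p i ≠ p k := fun i k hik => by
    have := hpe k i 0 hik.symm 0
    rwa [h0, sub_ne_zero] at this
  have hq : ∀ j l, j ≠ l → q j ≠ q l := fun j l hjl => by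
    have := hqe l 0 j hjl.symm 1
    rwa [h1, sub_ne_zero] at this
  have hpq : ∀ i j, p i ≠ q j := fun i j => by
    obtain ⟨k, hk⟩ := other i
    have := hpe i k j hk.symm 1
    rw [h1, sub_ne_zero] at this
    exact this.symm
  -- In `logChange_square` the principal logarithms cancel after four reversals of sign. Each
  -- reversal costs πi and an integer `m`; three of them count positively and one negatively, which
  -- leaves 2πi, the summand 1.
  have eqn : ∀ i j k l, i ≠ k → j ≠ l →
      m (p k) (q j) + m (p i) (p k) + m (q j) (q l) - m (p i) (q l) + 1
        + kp k i j + kq j k l - kq l i j - kp i k l = 0 := by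
    intro i j k l hik hjl
    have h := logChange_square (hc i j) (hc k l) (hd i j k l hik hjl)
    simp only [h0, h1] at h
    rw [hkp k i j hik.symm, hkq j k l hjl, hkq l i j hjl.symm, hkp i k l hik] at h
    have e1 := hm (p k) (q j) (hpq _ _)
    have e2 := hm (p i) (p k) (hp _ _ hik)
    have e3 := hm (q j) (q l) (hq _ _ hjl)
    have e4 := hm (p i) (q l) (hpq _ _)
    have : ((m (p k) (q j) + m (p i) (p k) + m (q j) (q l) - m (p i) (q l) + 1
        + kp k i j + kq j k l - kq l i j - kp i k l : ℤ) : ℂ) * (2 * Real.pi * Complex.I) = 0 := by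
      push_cast
      linear_combination h - e1 - e2 - e3 + e4
    exact_mod_cast (mul_eq_zero.1 this).resolve_right hI
  -- Reversing the sign twice returns to the same logarithm at the price of 2πi.
  have anti : ∀ j l, j ≠ l → m (q j) (q l) + m (q l) (q j) + 1 = 0 := by
    intro j l hjl
    have e1 := hm _ _ (hq j l hjl)
    have e2 := hm _ _ (hq l j hjl.symm)
    have : ((m (q j) (q l) + m (q l) (q j) + 1 : ℤ) : ℂ) * (2 * Real.pi * Complex.I) = 0 := by
      push_cast
      linear_combination - e1 - e2
    exact_mod_cast (mul_eq_zero.1 this).resolve_right hI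
  have a01 := anti 0 1 (by decide)
  have a02 := anti 0 2 (by decide)
  have a12 := anti 1 2 (by decide)
  -- Sum over the six ordered pairs `j ≠ l`: the six ones together with the three relations `anti`
  -- leave the odd constant 3, and all other terms are even except those in `kq`.
  have E : ∀ i k, i ≠ k → 
      2 * (m (p k) (q 0) + m (p k) (q 1) + m (p k) (q 2))
        + 6 * m (p i) (p k) + 3 - 2 * (m (p i) (q 0) + m (p i) (q 1) + m (p i) (q 2))
        + 2 * (kp k i 0 + kp k i 1 + kp k i 2) - 2 * (kp i k 0 + kp i k 1 + kp i k 2)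
        + (kq 0 k 1 + kq 0 k 2 + kq 1 k 0 + kq 1 k 2 + kq 2 k 0 + kq 2 k 1)
        - (kq 0 i 1 + kq 0 i 2 + kq 1 i 0 + kq 1 i 2 + kq 2 i 0 + kq 2 i 1) = 0 := by
    intro i k hik
    linarith [eqn i 0 k 1 hik (by decide), eqn i 0 k 2 hik (by decide), eqn i 1 k 0 hik (by decide),
      eqn i 1 k 2 hik (by decide), eqn i 2 k 0 hik (by decide), eqn i 2 k 1 hik (by decide)]
  have E01 := E 0 1 (by decide)
  have E02 := E 0 2 (by decide)
  have E12 := E 1 2 (by decide)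
  -- Modulo 2 the three equations say that any two of `z0`, `z1`, `z2` differ, which is impossible.
  generalize (kq 0 0 1 + kq 0 0 2 + kq 1 0 0 + kq 1 0 2 + kq 2 0 0 + kq 2 0 1) = z0 at *
  generalize (kq 0 1 1 + kq 0 1 2 + kq 1 1 0 + kq 1 1 2 + kq 2 1 0 + kq 2 1 1) = z1 at *
  generalize (kq 0 2 1 + kq 0 2 2 + kq 1 2 0 + kq 1 2 2 + kq 2 2 0 + kq 2 2 1) = z2 at *
  omega

/-! ### Planar embeddings and branch sets -/

namespace Graph

variable {α β : Type*}

/-- The part of the plane occupied by the subgraph induced on `W`. -/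
def PlaneEmbedding.image {G : Graph α β} (P : G.PlaneEmbedding) (W : Set α) :
    Set (EuclideanSpace ℝ (Fin 2)) :=
  {z | (∃ x ∈ W ∩ G.vertexSet, z = P.pos x) ∨
    ∃ e x y, G.IsLink e x y ∧ x ∈ W ∧ y ∈ W ∧ ∃ t ∈ Ioo (0 : ℝ) 1, z = P.arc e t}

namespace PlaneEmbedding

variable {G : Graph α β} (P : G.PlaneEmbedding)

theorem image_mono {W W' : Set α} (h : W ⊆ W') : P.image W ⊆ P.image W' := by
  rintro z (⟨x, hx, rfl⟩ | ⟨e, x, y, he, hx, hy, t, ht, rfl⟩)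
  · exact Or.inl ⟨x, ⟨h hx.1, hx.2⟩, rfl⟩
  · exact Or.inr ⟨e, x, y, he, h hx, h hy, t, ht, rfl⟩

theorem disjoint_image {W W' : Set α} (h : Disjoint W W') :
    Disjoint (P.image W) (P.image W') := by
  rw [Set.disjoint_left] at h ⊢
  rintro z (⟨x, hx, rfl⟩ | ⟨e, x, y, he, hx, hy, t, ht, rfl⟩)
    (⟨x', hx', h'⟩ | ⟨e', x', y', he', hx', hy', t', ht', h'⟩)
  · exact h hx.1 (P.pos_injOn hx.2 hx'.2 h' ▸ hx'.1)
  · exact P.arc_ne_pos e' he'.edge_mem x hx.2 t' ht' h'.symm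
  · exact P.arc_ne_pos e he.edge_mem x' hx'.2 t ht h'
  · by_cases hee : e = e'
    · subst hee
      rcases he.left_eq_or_eq he' with rfl | rfl
      · exact h hx hx'
      · exact h hx hy'
    · exact P.arc_ne_arc e he.edge_mem e' he'.edge_mem hee t ht t' ht' h'

theorem joinedIn_of_isLink {W : Set α} {e : β} {x y : α} (he : G.IsLink e x y) (hx : x ∈ W)
    (hy : y ∈ W) : JoinedIn (P.image W) (P.pos x) (P.pos y) := by
  -- The arc may run from `y` to `x`.
  obtain ⟨a, b, hab, h0, h1⟩ := P.arc_ends e he.edge_mem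
  have haW : a ∈ W := by rcases hab.left_eq_or_eq he with rfl | rfl <;> assumption
  have hbW : b ∈ W := by rcases hab.symm.left_eq_or_eq he with rfl | rfl <;> assumption
  have key : JoinedIn (P.image W) (P.pos a) (P.pos b) := by
    have hc := P.arc_continuousOn e he.edge_mem
    refine ⟨⟨⟨fun t => P.arc e t, ?_⟩, by simpa using h0, by simpa using h1⟩, fun t => ?_⟩
    · exact hc.comp_continuous continuous_subtype_val fun t => t.2
    · change P.arc e t ∈ _
      rcases eq_or_lt_of_le t.2.1 with ht | ht
      · rw [← ht, h0]; exact Or.inl ⟨a, ⟨haW, hab.left_mem⟩, rfl⟩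
      rcases eq_or_lt_of_le t.2.2 with ht' | ht'
      · rw [ht', h1]; exact Or.inl ⟨b, ⟨hbW, hab.right_mem⟩, rfl⟩
      · exact Or.inr ⟨e, a, b, hab, haW, hbW, t, ⟨ht, ht'⟩, rfl⟩
  rcases hab.eq_and_eq_or_eq_and_eq he with ⟨rfl, rfl⟩ | ⟨rfl, rfl⟩
  exacts [key, key.symm]

theorem joinedIn_of_isConnectedSet {B : Set α} (hB : G.IsConnectedSet B) {x y : α} (hx : x ∈ B)
    (hy : y ∈ B) : JoinedIn (P.image B) (P.pos x) (P.pos y) := by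
  have h := hB.2.2 x hx y hy
  clear hy
  induction h with
  | refl => exact JoinedIn.refl (Or.inl ⟨x, ⟨hx, hB.1 hx⟩, rfl⟩)
  | tail _ h ih =>
    obtain ⟨ha, hb, e, he⟩ := h
    exact ih.trans (P.joinedIn_of_isLink he ha hb)

end PlaneEmbedding

/-- A multigraph with a `K_{3,3}` minor is not planar. -/
theorem not_isPlanar_of_branchSets {G : Graph α β} (A B : Fin 3 → Set α)
    (hA : ∀ i, G.IsConnectedSet (A i)) (hB : ∀ j, G.IsConnectedSet (B j))
    (hAA : Pairwise fun i k => Disjoint (A i) (A k)) (hBB : Pairwise fun j l => Disjoint (B j) (B l))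
    (hAB : ∀ i j, Disjoint (A i) (B j)) (hadj : ∀ i j, ∃ x ∈ A i, ∃ y ∈ B j, G.Adj x y) :
    ¬ G.IsPlanar := by
  rintro ⟨P⟩
  -- Any vertex of a branch set represents it. The path for `i`, `j` stays in the part of the plane
  -- occupied by `A i ∪ B j`, so paths of independent edges are disjoint; paths sharing a branch set
  -- may meet, which `not_exists_independent_paths` allows.
  choose a ha using fun i => (hA i).2.1
  choose b hb using fun j => (hB j).2.1
  have hj : ∀ i j, JoinedIn (P.image (A i ∪ B j)) (P.pos (a i)) (P.pos (b j)) := by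
    intro i j
    obtain ⟨x, hx, y, hy, e, he⟩ := hadj i j
    have h1 := (P.joinedIn_of_isConnectedSet (hA i) (ha i) hx).mono
      (P.image_mono (subset_union_left (t := B j)))
    have h2 := (P.joinedIn_of_isConnectedSet (hB j) hy (hb j)).mono
      (P.image_mono (subset_union_right (s := A i)))
    exact (h1.trans (P.joinedIn_of_isLink he (Or.inl hx) (Or.inr hy))).trans h2
  choose γ hγ using hj
  have hext : ∀ i j t, (γ i j).extend t ∈ P.image (A i ∪ B j) := fun i j t => by
    have : (γ i j).extend t ∈ range (γ i j).extend := ⟨t, rfl⟩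
    rw [Path.extend_range] at this
    obtain ⟨s, hs⟩ := this
    exact hs ▸ hγ i j s
  let φ : EuclideanSpace ℝ (Fin 2) → ℂ := fun z => ⟨z 0, z 1⟩
  have hφ : Continuous φ := by
    have : φ = fun z => ((z 0 : ℝ) : ℂ) + (z 1 : ℝ) * Complex.I := by
      funext z; apply Complex.ext <;> simp [φ]
    rw [this]; fun_prop
  have hφi : ∀ z w, φ z = φ w → z = w := fun z w h => by
    have h0 := congrArg Complex.re h
    have h1 := congrArg Complex.im h
    ext i; fin_cases i
    exacts [h0, h1]
  refine not_exists_independent_paths (fun i => φ (P.pos (a i))) (fun j => φ (P.pos (b j)))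
    (fun i j t => φ ((γ i j).extend t)) (fun i j => hφ.comp (γ i j).continuous_extend)
    (fun i j => by simp) (fun i j => by simp) ?_
  intro i j k l hik hjl s t h
  refine Set.disjoint_left.1 (P.disjoint_image ?_) (hext i j s) (hφi _ _ h ▸ hext k l t)
  rw [disjoint_union_left, disjoint_union_right, disjoint_union_right]
  exact ⟨⟨hAA hik, hAB _ _⟩, (hAB _ _).symm, hBB hjl⟩

theorem IsConnectedSet.union {G : Graph α β} {A B : Set α} (hA : G.IsConnectedSet A)
    (hB : G.IsConnectedSet B) (h : ∃ x ∈ A, ∃ y ∈ B, G.Adj x y) : G.IsConnectedSet (A ∪ B) := by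
  obtain ⟨x, hx, y, hy, hxy⟩ := h
  refine ⟨union_subset hA.1 hB.1, ⟨x, Or.inl hx⟩, ?_⟩
  have h1 : ∀ u ∈ A, ∀ v ∈ A, Relation.ReflTransGen
      (fun a b => a ∈ A ∪ B ∧ b ∈ A ∪ B ∧ G.Adj a b) u v := fun u hu v hv =>
    Relation.ReflTransGen.mono (fun _ _ h => ⟨Or.inl h.1, Or.inl h.2.1, h.2.2⟩) _ _ (hA.2.2 u hu v hv)
  have h2 : ∀ u ∈ B, ∀ v ∈ B, Relation.ReflTransGen
      (fun a b => a ∈ A ∪ B ∧ b ∈ A ∪ B ∧ G.Adj a b) u v := fun u hu v hv =>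
    Relation.ReflTransGen.mono (fun _ _ h => ⟨Or.inr h.1, Or.inr h.2.1, h.2.2⟩) _ _ (hB.2.2 u hu v hv)
  rintro u (hu | hu) v (hv | hv)
  · exact h1 u hu v hv
  · exact ((h1 u hu x hx).tail ⟨Or.inl hx, Or.inr hy, hxy⟩).trans (h2 y hy v hv)
  · exact ((h2 u hu y hy).tail ⟨Or.inr hy, Or.inl hx, hxy.symm⟩).trans (h1 x hx v hv)
  · exact h2 u hu v hv

open G13Vertex in
/-- A multigraph with a `G13` minor is not planar. -/
theorem HasMinor.not_isPlanar_of_G13 {G : Graph α β} (h : G.HasMinor G13) : ¬ G.IsPlanar := by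
  obtain ⟨B, hB, hd, hadj⟩ := h
  have dis : ∀ {v w}, v ≠ w → Disjoint (B v) (B w) := fun hvw => hd hvw
  -- The K₃,₃ minor has the classes X₁, X₂L, X₃K and Y₁, Y₂, Y₃M. Only the adjacencies of the last
  -- class to X₂L and X₃K need the added vertices, through the edges LM and KY₃.
  have hX2 := (hB X2).union (hB L) (hadj _ _ (by simp [G13]))
  have hX3 := (hB X3).union (hB K) (hadj _ _ (by simp [G13]))
  have hY3 := (hB Y3).union (hB M) (hadj _ _ (by simp [G13]))
  refine not_isPlanar_of_branchSets ![B X1, B X2 ∪ B L, B X3 ∪ B K] ![B Y1, B Y2, B Y3 ∪ B M]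
    ?_ ?_ ?_ ?_ ?_ ?_
  · intro i; fin_cases i
    exacts [hB X1, hX2, hX3]
  · intro i; fin_cases i
    exacts [hB Y1, hB Y2, hY3]
  · intro i k hik
    fin_cases i <;> fin_cases k <;> first | exact (hik rfl).elim | simp [dis]
  · intro i k hik
    fin_cases i <;> fin_cases k <;> first | exact (hik rfl).elim | simp [dis]
  · intro i k
    fin_cases i <;> fin_cases k <;> simp [dis]
  · have adj : ∀ v w, G13.Adj v w → ∀ A A', B v ⊆ A → B w ⊆ A' →
        ∃ x ∈ A, ∃ y ∈ A', G.Adj x y := by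
      intro v w hvw A A' hA hA'
      obtain ⟨x, hx, y, hy, hxy⟩ := hadj v w hvw
      exact ⟨x, hA hx, y, hA' hy, hxy⟩
    intro i k
    fin_cases i <;> fin_cases k
    · exact adj X1 Y1 (by simp [G13]) _ _ subset_rfl subset_rfl
    · exact adj X1 Y2 (by simp [G13]) _ _ subset_rfl subset_rfl
    · exact adj X1 Y3 (by simp [G13]) _ _ subset_rfl subset_union_left
    · exact adj X2 Y1 (by simp [G13]) _ _ subset_union_left subset_rfl
    · exact adj X2 Y2 (by simp [G13]) _ _ subset_union_left subset_rfl
    · exact adj L M (by simp [G13]) _ _ subset_union_right subset_union_right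
    · exact adj X3 Y1 (by simp [G13]) _ _ subset_union_left subset_rfl
    · exact adj X3 Y2 (by simp [G13]) _ _ subset_union_left subset_rfl
    · exact adj K Y3 (by simp [G13]) _ _ subset_union_right subset_union_left

end Graph

/-! ### Dart walks -/

section IsDartWalk

variable {V A : Type*} {src tgt : A → V}

theorem isDartWalk_append {l l' : List A} {u v : V} :
    IsDartWalk src tgt (l ++ l') u v ↔ ∃ w, IsDartWalk src tgt l u w ∧ IsDartWalk src tgt l' w v := by
  induction l generalizing u with
  | nil => exact ⟨fun h => ⟨u, rfl, h⟩, fun ⟨w, hw, h⟩ => by cases hw; exact h⟩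
  | cons d l ih => simp [IsDartWalk, ih, and_assoc]

theorem IsDartWalk.map_src_append {l : List A} {u v : V} (h : IsDartWalk src tgt l u v) :
    l.map src ++ [v] = u :: l.map tgt := by
  induction l generalizing u with
  | nil => cases h; rfl
  | cons d l ih => rw [List.map_cons, List.cons_append, ih h.2, h.1, List.map_cons]

theorem IsDartWalk.isRotated {l l' : List A} {u : V} (h : IsDartWalk src tgt l u u)
    (hl : l ~r l') : ∃ v, IsDartWalk src tgt l' v v := by
  obtain ⟨n, rfl⟩ := hl
  rw [← List.rotate_mod, List.rotate_eq_drop_append_take_mod, Nat.mod_mod]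
  rw [← List.take_append_drop (n % l.length) l, isDartWalk_append] at h
  obtain ⟨w, h1, h2⟩ := h
  exact ⟨w, isDartWalk_append.2 ⟨u, h2, h1⟩⟩

end IsDartWalk

namespace TwoComplex

variable {C : TwoComplex}

@[simp] theorem rev_rev (d : C.Dart) : rev (rev d) = d := by simp [rev]

@[simp] theorem rev_fst (d : C.Dart) : (rev d).1 = d.1 := rfl

@[simp] theorem src_rev (d : C.Dart) : src (rev d) = tgt d := by
  obtain ⟨e, b⟩ := d; cases b <;> rfl

@[simp] theorem tgt_rev (d : C.Dart) : tgt (rev d) = src d := by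
  obtain ⟨e, b⟩ := d; cases b <;> rfl

theorem rev_inj {d d' : C.Dart} : rev d = rev d' ↔ d = d' :=
  ⟨fun h => by rw [← rev_rev d, h, rev_rev], fun h => h ▸ rfl⟩

theorem eq_or_eq_rev {d d' : C.Dart} (h : d.1 = d'.1) : d = d' ∨ d = rev d' := by
  obtain ⟨e, b⟩ := d
  obtain ⟨e', b'⟩ := d'
  cases h
  cases b <;> cases b' <;> simp [rev]

/-! ### Connectivity by a set of edges -/

/-- The vertices `u` and `v` are connected by edges in `S`. -/
def Conn (S : Set C.E) (u v : C.V) : Prop :=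
  Relation.EqvGen (fun u v => ∃ e ∈ S, C.tail e = u ∧ C.head e = v) u v

theorem toContract_eq_iff {S : Set C.E} {u v : C.V} :
    C.toContract S u = C.toContract S v ↔ Conn S u v := Quotient.eq

namespace Conn

variable {S S' : Set C.E} {u v w : C.V}

theorem refl (u : C.V) : Conn S u u := Relation.EqvGen.refl u

theorem symm (h : Conn S u v) : Conn S v u := Relation.EqvGen.symm _ _ h

theorem trans (h : Conn S u v) (h' : Conn S v w) : Conn S u w := Relation.EqvGen.trans _ _ _ h h'

/-- `Conn S` is the smallest equivalence relation containing the edges of `S`, so an invariant need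
only be checked edge by edge. -/
theorem lift {r : C.V → C.V → Prop} (hr : Equivalence r)
    (h : ∀ e ∈ S, r (C.tail e) (C.head e)) (huv : Conn S u v) : r u v := by
  induction huv with
  | rel a b h' => obtain ⟨e, he, rfl, rfl⟩ := h'; exact h e he
  | refl a => exact hr.refl a
  | symm a b _ ih => exact hr.symm ih
  | trans a b c _ _ ih ih' => exact hr.trans ih ih'

theorem equivalence (S : Set C.E) : Equivalence (Conn S) := ⟨refl, symm, trans⟩

theorem of_mem {e : C.E} (he : e ∈ S) : Conn S (C.tail e) (C.head e) :=
  Relation.EqvGen.rel _ _ ⟨e, he, rfl, rfl⟩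

theorem of_dart {d : C.Dart} (hd : d.1 ∈ S) : Conn S (src d) (tgt d) := by
  obtain ⟨e, b⟩ := d
  cases b
  exacts [(of_mem hd).symm, of_mem hd]

theorem of_conn (h : ∀ e ∈ S, Conn S' (C.tail e) (C.head e)) (huv : Conn S u v) : Conn S' u v :=
  huv.lift (equivalence S') h

theorem mono (h : S ⊆ S') (huv : Conn S u v) : Conn S' u v :=
  huv.of_conn fun _ he => of_mem (h he)

theorem of_walk {l : List C.Dart} (h : IsDartWalk src tgt l u v) (hS : ∀ d ∈ l, d.1 ∈ S) :
    Conn S u v := by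
  induction l generalizing u with
  | nil => cases h; exact refl _
  | cons d l ih =>
    obtain ⟨rfl, h⟩ := h
    exact (of_dart (hS d (by simp))).trans (ih h fun d' hd' => hS d' (by simp [hd']))

/-- A connection that needs `f` joins two vertices that are each connected in `S` to an end of `f`.
Being connected in `S`, or being both attached to `f` in this way, is an equivalence relation. -/
theorem of_insert {f : C.E} (h : Conn (insert f S) u v) : Conn S u v ∨
    (Conn S u (C.tail f) ∧ Conn S (C.head f) v) ∨ (Conn S u (C.head f) ∧ Conn S (C.tail f) v) := by
  let N : C.V → Prop := fun w => Conn S w (C.tail f) ∨ Conn S w (C.head f)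
  have hN : ∀ {a b}, Conn S a b → N b → N a := fun hab hb => hb.imp hab.trans hab.trans
  have key : Conn S u v ∨ (N u ∧ N v) := by
    refine h.lift (r := fun a b => Conn S a b ∨ (N a ∧ N b)) ⟨?_, ?_, ?_⟩ ?_
    · exact fun a => Or.inl (refl a)
    · rintro a b (h | ⟨h, h'⟩)
      exacts [Or.inl h.symm, Or.inr ⟨h', h⟩]
    · rintro a b c (h | ⟨h, h'⟩) (k | ⟨k, k'⟩)
      exacts [Or.inl (h.trans k), Or.inr ⟨hN h k, k'⟩, Or.inr ⟨h, hN k.symm h'⟩, Or.inr ⟨h, k'⟩]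
    · rintro e (rfl | he)
      exacts [Or.inr ⟨Or.inl (refl _), Or.inr (refl _)⟩, Or.inl (of_mem he)]
  rcases key with h | ⟨h | h, h' | h'⟩
  exacts [Or.inl h, Or.inl (h.trans h'.symm), Or.inr (Or.inl ⟨h, h'.symm⟩),
    Or.inr (Or.inr ⟨h, h'.symm⟩), Or.inl (h.trans h'.symm)]

/-- If all edges of `S` at `a` lead to `b`, then these edges can be skipped on the way from `a`. -/
theorem of_unique_neighbor {a b : C.V} (hab : a ≠ v) (hb : b ≠ a)
    (hf : ∀ d : C.Dart, d.1 ∈ S → src d = a → tgt d = b) (h : Conn S a v) :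
    Conn {e ∈ S | C.tail e ≠ a ∧ C.head e ≠ a} b v := by
  classical
  -- Retract `a` onto its only neighbour `b`: the edges at `a` collapse and all others stay in
  -- place.
  let φ : C.V → C.V := fun w => if w = a then b else w
  have key : Conn {e ∈ S | C.tail e ≠ a ∧ C.head e ≠ a} (φ a) (φ v) := by
    refine h.lift (r := fun x y => Conn {e ∈ S | C.tail e ≠ a ∧ C.head e ≠ a} (φ x) (φ y))
      ⟨fun _ => refl _, symm, trans⟩ fun e he => ?_
    by_cases h1 : C.tail e = a
    · have h2 : C.head e = b := hf (e, true) he h1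
      simp only [φ, h1, h2, if_true, if_neg hb]
      exact refl _
    by_cases h2 : C.head e = a
    · have h3 : C.tail e = b := hf (e, false) he h2
      simp only [φ, h2, h3, if_true, if_neg hb]
      exact refl _
    · simp only [φ, h1, h2, if_false]
      exact of_mem ⟨he, h1, h2⟩
  simpa [φ, hab.symm] using key

end Conn

/-! ### Paths, cycles and forests -/

theorem exists_path_suffix {l : List C.Dart} {u v w : C.V} (h : IsDartWalk src tgt l u v)
    (hn : (l.map src ++ [v]).Nodup) (hw : w ∈ l.map src ++ [v]) :
    ∃ l', IsDartWalk src tgt l' w v ∧ l' ⊆ l ∧ (l'.map src ++ [v]).Nodup := by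
  induction l generalizing u with
  | nil =>
    have : w = v := by simpa using hw
    exact ⟨[], this, by simp, by simp⟩
  | cons d l ih =>
    by_cases hd : w = src d
    · subst hd
      exact ⟨d :: l, ⟨rfl, h.2⟩, List.Subset.refl _, hn⟩
    · obtain ⟨l', h1, h2, h3⟩ := ih h.2 (List.nodup_cons.1 hn).2 (by simpa [hd] using hw)
      exact ⟨l', h1, List.subset_cons_of_subset _ h2, h3⟩

/-- Having a path to `v` is inherited across an edge of `S`: put the edge in front, or, if its other
end already lies on the path, take the part of the path from there. -/
theorem Conn.exists_path {S : Set C.E} {u v : C.V} (h : Conn S u v) :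
    ∃ l : List C.Dart, IsDartWalk src tgt l u v ∧ (∀ d ∈ l, d.1 ∈ S) ∧
      (l.map src ++ [v]).Nodup := by
  let P : C.V → Prop := fun u => ∃ l : List C.Dart, IsDartWalk src tgt l u v ∧
    (∀ d ∈ l, d.1 ∈ S) ∧ (l.map src ++ [v]).Nodup
  have step : ∀ d : C.Dart, d.1 ∈ S → P (tgt d) → P (src d) := by
    rintro d hd ⟨l, h1, h2, h3⟩
    by_cases hm : src d ∈ l.map src ++ [v]
    · obtain ⟨l', h1', h2', h3'⟩ := exists_path_suffix h1 h3 hm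
      exact ⟨l', h1', fun d' hd' => h2 d' (h2' hd'), h3'⟩
    · refine ⟨d :: l, ⟨rfl, h1⟩, ?_, List.nodup_cons.2 ⟨hm, h3⟩⟩
      simpa [hd] using h2
  refine (h.lift (r := fun a b => P a ↔ P b)
    ⟨fun _ => Iff.rfl, Iff.symm, Iff.trans⟩ fun e he => ?_).2 ⟨[], rfl, by simp, by simp⟩
  exact ⟨step (e, false) he, step (e, true) he⟩

/-- If the edge of the first dart came back, in either orientation, the first vertex would be
visited again. -/
theorem nodup_map_fst_of_path {l : List C.Dart} {u v : C.V} (h : IsDartWalk src tgt l u v)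
    (hn : (l.map src ++ [v]).Nodup) : (l.map Prod.fst).Nodup := by
  induction l generalizing u with
  | nil => simp
  | cons d l ih =>
    have hn' := List.nodup_cons.1 hn
    refine List.nodup_cons.2 ⟨fun hd => ?_, ih h.2 hn'.2⟩
    obtain ⟨d', hd', he⟩ := List.mem_map.1 hd
    apply hn'.1
    rcases eq_or_eq_rev he with rfl | rfl
    · exact List.mem_append_left _ (List.mem_map_of_mem hd')
    · change _ ∈ l.map src ++ [v]
      rw [h.2.map_src_append]
      refine List.mem_cons_of_mem _ (List.mem_map.2 ⟨_, hd', by simp⟩)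

theorem Conn.exists_isCycle {S : Set C.E} {e : C.E} (he : e ∉ S)
    (h : Conn S (C.head e) (C.tail e)) : ∃ o, C.IsCycle o ∧ e ∈ o ∧ o ⊆ insert e S := by
  obtain ⟨l, h1, h2, h3⟩ := h.exists_path
  refine ⟨_, ⟨(e, true) :: l, by simp, ⟨C.tail e, rfl, h1⟩, ?_, ?_, rfl⟩, by simp, ?_⟩
  · exact (List.perm_append_singleton _ _).nodup_iff.1 h3
  · refine List.nodup_cons.2 ⟨fun hd => ?_, nodup_map_fst_of_path h1 h3⟩
    obtain ⟨d', hd', rfl⟩ := List.mem_map.1 hd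
    exact he (h2 d' hd')
  · intro f hf
    rcases List.mem_cons.1 hf with rfl | hf
    · exact Or.inl rfl
    · obtain ⟨d', hd', rfl⟩ := List.mem_map.1 hf
      exact Or.inr (h2 d' hd')

namespace IsCycle

variable {o : Set C.E}

theorem conn_diff (ho : C.IsCycle o) {e : C.E} (he : e ∈ o) :
    Conn (o \ {e}) (C.tail e) (C.head e) := by
  obtain ⟨l, -, ⟨v, hv⟩, -, hn, rfl⟩ := ho
  obtain ⟨d, hd, rfl⟩ := List.mem_map.1 he
  obtain ⟨a, b, rfl⟩ := List.append_of_mem hd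
  obtain ⟨w, h1, rfl, h2⟩ := isDartWalk_append.1 hv
  simp only [List.map_append, List.map_cons] at hn
  have hn' := (List.perm_middle.nodup_iff.1 hn)
  rw [List.nodup_cons, List.mem_append, not_or] at hn'
  have hab : ∀ d' ∈ a ++ b, d'.1 ∈ {e | e ∈ List.map Prod.fst (a ++ d :: b)} \ {d.1} := by
    intro d' hd'
    have hd'' : d' ∈ a ∨ d' ∈ b := List.mem_append.1 hd'
    refine ⟨List.mem_map_of_mem (by simp; tauto), fun hdd => ?_⟩
    have hdd : d'.1 = d.1 := hdd
    rcases hd'' with h | h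
    · exact hn'.1.1 (hdd ▸ List.mem_map_of_mem h)
    · exact hn'.1.2 (hdd ▸ List.mem_map_of_mem h)
  have key := (Conn.of_walk h2 fun d' h => hab d' (by simp [h])).trans
    (Conn.of_walk h1 fun d' h => hab d' (by simp [h]))
  obtain ⟨e, b⟩ := d
  cases b
  exacts [key, key.symm]

theorem conn (ho : C.IsCycle o) {d d' : C.Dart} (hd : d.1 ∈ o) (hd' : d'.1 ∈ o) :
    Conn o (src d) (src d') := by
  obtain ⟨l, -, ⟨v, hv⟩, -, -, rfl⟩ := ho
  have key : ∀ d : C.Dart, d ∈ l → Conn {e | e ∈ l.map Prod.fst} v (src d) := by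
    intro d hd
    obtain ⟨a, b, rfl⟩ := List.append_of_mem hd
    obtain ⟨w, h1, rfl, h2⟩ := isDartWalk_append.1 hv
    exact Conn.of_walk h1 fun d' h => List.mem_map_of_mem (by simp [h])
  have key' : ∀ d : C.Dart, d.1 ∈ l.map Prod.fst → Conn {e | e ∈ l.map Prod.fst} v (src d) := by
    intro d hd
    obtain ⟨d', hd', he⟩ := List.mem_map.1 hd
    rcases eq_or_eq_rev he with rfl | rfl
    · exact key _ hd'
    · exact ((key _ hd').trans (Conn.of_dart (d := rev d) hd)).trans (by simpa using Conn.refl _)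
  exact (key' d hd).symm.trans (key' d' hd')

/-- At most two edges of a cycle meet in a vertex. -/
theorem eq_or_eq_of_src_eq (ho : C.IsCycle o) {d d₁ d₂ : C.Dart} (hd : d.1 ∈ o) (hd₁ : d₁.1 ∈ o)
    (hd₂ : d₂.1 ∈ o) (h₁ : src d = src d₁) (h₂ : src d = src d₂) (h₁₂ : d₁.1 ≠ d₂.1) :
    d.1 = d₁.1 ∨ d.1 = d₂.1 := by
  obtain ⟨l, -, ⟨v, hv⟩, hn, -, rfl⟩ := ho
  -- The targets of a closed walk are its sources shifted by one place; hence at each vertex at most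
  -- one dart of `l` leaves and at most one arrives.
  have hn' : (l.map tgt).Nodup := by
    have h := hv.map_src_append
    have : (l.map src).Perm (l.map tgt) := by
      have hp := (List.perm_append_singleton v (l.map src)).symm
      rw [h] at hp
      exact (List.perm_cons v).1 hp
    exact this.nodup_iff.1 hn
  have hs : ∀ {d d' : C.Dart}, d ∈ l → d' ∈ l → src d = src d' → d.1 = d'.1 := fun hd hd' h => by
    rw [List.inj_on_of_nodup_map hn hd hd' h]
  have ht : ∀ {d d' : C.Dart}, rev d ∈ l → rev d' ∈ l → src d = src d' → d.1 = d'.1 :=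
    fun hd hd' h => congrArg Prod.fst (rev_inj.1 <| List.inj_on_of_nodup_map hn' hd hd'
      (by simpa using h))
  have or : ∀ d : C.Dart, d.1 ∈ l.map Prod.fst → d ∈ l ∨ rev d ∈ l := by
    intro d hd
    obtain ⟨d', hd', he⟩ := List.mem_map.1 hd
    rcases eq_or_eq_rev he with rfl | rfl
    exacts [Or.inl hd', Or.inr hd']
  rcases or d hd with h | h <;> rcases or d₁ hd₁ with k | k <;> rcases or d₂ hd₂ with m | m
  · exact Or.inl (hs h k h₁)
  · exact Or.inl (hs h k h₁)
  · exact Or.inr (hs h m h₂)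
  · exact (h₁₂ (ht k m (h₁.symm.trans h₂))).elim
  · exact (h₁₂ (hs k m (h₁.symm.trans h₂))).elim
  · exact Or.inr (ht h m h₂)
  · exact Or.inl (ht h k h₁)
  · exact Or.inl (ht h k h₁)

end IsCycle

/-- A set of edges that contains no cycle: each edge is a bridge. -/
def IsForest (F : Set C.E) : Prop := ∀ f ∈ F, ¬ Conn (F \ {f}) (C.tail f) (C.head f)

namespace IsForest

variable {F F' : Set C.E}

theorem mono (hF : IsForest F) (h : F' ⊆ F) : IsForest F' := fun f hf hc =>
  hF f (h hf) (hc.mono (sdiff_subset_sdiff_left h))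

theorem not_conn (hF : IsForest F) {d : C.Dart} (hd : d.1 ∈ F) :
    ¬ Conn (F \ {d.1}) (src d) (tgt d) := by
  obtain ⟨e, b⟩ := d
  cases b
  exacts [fun h => hF e hd h.symm, hF e hd]

/-- If an old edge `f` were no longer a bridge, the connection of its ends would use `e`; with `f`
in place of `e`, that closed route would connect the ends of `e` in `F`. -/
theorem insert (hF : IsForest F) {e : C.E} (he : ¬ Conn F (C.tail e) (C.head e)) :
    IsForest (insert e F) := by
  rintro f (rfl | hf) hc
  · exact he (hc.mono fun x hx => hx.1.resolve_left hx.2)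
  · have hfF := hF f hf
    have hef : Conn F (C.tail f) (C.head f) := Conn.of_mem hf
    have hc' : Conn (Insert.insert e (F \ {f})) (C.tail f) (C.head f) :=
      hc.mono fun x hx => hx.1.imp id fun h => ⟨h, hx.2⟩
    have hm : ∀ {a b}, Conn (F \ {f}) a b → Conn F a b := fun h => h.mono sdiff_subset
    rcases hc'.of_insert with h | ⟨h, h'⟩ | ⟨h, h'⟩
    · exact hfF h
    · exact he (((hm h).symm.trans hef).trans (hm h').symm)
    · exact he (((hm h').trans hef.symm).trans (hm h))

/-- Exchanging an edge of a forest for the edge that closes a cycle through it gives a forest. -/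
theorem exchange (hF : IsForest F) {o : Set C.E} (ho : C.IsCycle o) {e e' : C.E} (he : e ∉ F)
    (hoF : o ⊆ Insert.insert e F) (he' : e' ∈ o) (hee : e' ≠ e) :
    IsForest (Insert.insert e F \ {e'}) := by
  have he'F : e' ∈ F := (hoF he').resolve_left hee
  have hsub : Insert.insert e F \ {e'} = Insert.insert e (F \ {e'}) := by
    rw [insert_sdiff_of_notMem]
    exact fun h => hee h.symm
  rw [hsub]
  -- If the ends of `e` were connected in `F` without `e'`, then the rest of `o` would connect the
  -- ends of `e'` there too.
  refine (hF.mono sdiff_subset).insert fun hc => hF e' he'F ?_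
  have h1 : Conn (Insert.insert e (F \ {e'})) (C.tail e') (C.head e') :=
    (ho.conn_diff he').mono (hsub ▸ sdiff_subset_sdiff_left hoF)
  refine h1.of_conn ?_
  rintro f (rfl | hf)
  exacts [hc, Conn.of_mem hf]

end IsForest

namespace IsSpanningTree

variable {T : Set C.E}

theorem conn (hT : C.IsSpanningTree T) (u v : C.V) : Conn T u v := by
  obtain ⟨l, h1, h2⟩ := hT.1 u v
  exact Conn.of_walk h2 h1

theorem isForest (hT : C.IsSpanningTree T) : IsForest T := by
  intro f hf hc
  obtain ⟨o, ho, -, hoT⟩ := hc.symm.exists_isCycle (fun h => h.2 rfl)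
  exact hT.2 o ho (hoT.trans (insert_subset hf sdiff_subset))

theorem exists_isFundamentalCycle (hT : C.IsSpanningTree T) {e : C.E} (he : e ∉ T) :
    ∃ o, C.IsFundamentalCycle T o ∧ e ∈ o ∧ o ⊆ insert e T := by
  obtain ⟨o, ho, heo, hoT⟩ := (hT.conn (C.head e) (C.tail e)).exists_isCycle he
  exact ⟨o, ⟨ho, e, he, heo, hoT⟩, heo, hoT⟩

end IsSpanningTree

end TwoComplex

/-! ### Passages of faces under contraction -/

namespace TwoComplex

variable {C : TwoComplex}

/-- Some face without edges in `B` passes from the reverse of `x` to `y`, up to edges of `S`. -/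
def CornerAdj (S B : Set C.E) (x y : C.Dart) : Prop :=
  ∃ f, (∀ d ∈ C.bdry f, d.1 ∉ B) ∧ ∃ p q r s : List C.Dart, C.bdry f ~r p ++ s ∧
    (∀ d ∈ s, d.1 ∈ S) ∧ p = y :: q ∧ p = r ++ [rev x]

theorem isRotated_filterMap {α β : Type*} {l l' : List α} (h : l ~r l') (g : α → Option β) :
    l.filterMap g ~r l'.filterMap g := by
  obtain ⟨n, rfl⟩ := h
  rw [List.rotate_eq_drop_append_take_mod, List.filterMap_append]
  conv_lhs => rw [← List.take_append_drop (n % l.length) l, List.filterMap_append]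
  exact List.isRotated_append

/-- A dart of `C` outside `S`, as a dart of `C/S`. -/
def Dart.toContract {S : Set C.E} (x : C.Dart) (hx : x.1 ∉ S) : (C.contract S).Dart :=
  (⟨x.1, hx⟩, x.2)

theorem src_toContract {S : Set C.E} (x : C.Dart) (hx : x.1 ∉ S) :
    src (Dart.toContract x hx) = C.toContract S (src x) := by
  obtain ⟨e, b⟩ := x
  cases b <;> rfl

theorem mem_eraseEdges {S : Set C.E} {l : List C.Dart} {d : {e : C.E // e ∉ S} × Bool} :
    d ∈ C.eraseEdges S l ↔ (d.1.1, d.2) ∈ l := by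
  unfold eraseEdges
  rw [List.mem_filterMap]
  constructor
  · rintro ⟨a, ha, h⟩
    split_ifs at h with h'
    cases h
    exact ha
  · intro h
    exact ⟨_, h, by rw [dif_pos d.1.2]⟩

theorem eraseEdges_singleton {S : Set C.E} {x : C.Dart} (hx : x.1 ∉ S) :
    C.eraseEdges S [x] = [Dart.toContract x hx] := by
  simp [eraseEdges, hx, Dart.toContract]
  rfl

/-- Erasing `S'` commutes with cutting the boundary word, and `x` and `y` survive, so the word still
begins with `y` and ends with `rev x`, while the stretch in `S` loses its edges of `S'`. Contraction
in two stages applies this twice. -/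
theorem CornerAdj.contract {S S' : Set C.E} {x y : C.Dart} (h : CornerAdj S ∅ x y)
    (hx : x.1 ∉ S') (hy : y.1 ∉ S') :
    CornerAdj (C := C.contract S') {e | e.1 ∈ S} ∅ (Dart.toContract x hx) (Dart.toContract y hy) := by
  obtain ⟨f, -, p, q, r, s, h1, h2, h3, h4⟩ := h
  have app : ∀ l l', C.eraseEdges S' (l ++ l') = C.eraseEdges S' l ++ C.eraseEdges S' l' :=
    fun l l' => List.filterMap_append
  have hrot : C.eraseEdges S' (C.bdry f) ~r C.eraseEdges S' p ++ C.eraseEdges S' s := by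
    rw [← app]; exact isRotated_filterMap h1 _
  have hp : C.eraseEdges S' p = Dart.toContract y hy :: C.eraseEdges S' q := by
    rw [h3, ← List.singleton_append, app, eraseEdges_singleton hy]; rfl
  let r' : List (C.contract S').Dart := C.eraseEdges S' r
  have hp' : C.eraseEdges S' p = r' ++ [rev (Dart.toContract x hx)] := by
    rw [h4, app, eraseEdges_singleton (x := rev x) hx]; rfl
  have hne : C.eraseEdges S' (C.bdry f) ≠ [] := by
    intro h
    rw [h, List.isRotated_nil_iff', hp] at hrot
    cases hrot
  refine ⟨⟨f, hne⟩, fun d _ h => h, _, _, _, _, hrot, ?_, hp, hp'⟩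
  intro d hd
  exact h2 _ (mem_eraseEdges.1 hd)

theorem CornerAdj.link_adj {x y : C.Dart} {v : C.V} (h : CornerAdj ∅ ∅ x y) (hx : src x = v)
    (hy : src y = v) : (C.link v).Adj x y := by
  obtain ⟨f, -, p, q, r, s, h1, h2, h3, h4⟩ := h
  obtain rfl : s = [] := List.eq_nil_iff_forall_not_mem.2 fun d hd => h2 d hd
  rw [List.append_nil] at h1
  obtain ⟨n, hn⟩ := h1
  have hlen : p.length = (C.bdry f).length := by rw [← hn, List.length_rotate]
  have hpos : 0 < (C.bdry f).length := List.length_pos_iff.2 (C.bdry_ne_nil f)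
  have hfirst : (C.bdry f)[n % (C.bdry f).length]'(Nat.mod_lt _ hpos) = y := by
    have h := List.getElem_rotate (C.bdry f) n 0 (by simpa using hpos)
    simp only [hn, h3, List.getElem_cons_zero, zero_add] at h
    exact h.symm
  have hlast : (C.bdry f)[((C.bdry f).length - 1 + n) % (C.bdry f).length]'(Nat.mod_lt _ hpos)
      = rev x := by
    have h := List.getElem_rotate (C.bdry f) n ((C.bdry f).length - 1)
      (by rw [List.length_rotate]; omega)
    rw [← h]
    have : (C.bdry f).length - 1 = r.length := by
      rw [← hlen, h4]; simp
    simp [hn, h4, this]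
  -- After rotation by `n` the word begins with `y` and ends with `rev x`; the corner sits at the
  -- original position of its last letter.
  refine ⟨⟨f, ⟨((C.bdry f).length - 1 + n) % (C.bdry f).length, Nat.mod_lt _ hpos⟩⟩, hx, hy,
    Or.inl ⟨?_, ?_⟩⟩
  · simp only [cornerIn, List.get_eq_getElem]
    rw [hlast, rev_rev]
  · simp only [cornerOut, List.get_eq_getElem]
    have : (((C.bdry f).length - 1 + n) % (C.bdry f).length + 1) % (C.bdry f).length
        = n % (C.bdry f).length := by
      rw [Nat.mod_add_mod]
      have : (C.bdry f).length - 1 + n + 1 = n + (C.bdry f).length := by omega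
      rw [this, Nat.add_mod_right]
    simp only [this, hfirst]

end TwoComplex

theorem List.exists_first_not {α : Type*} {P : α → Prop} {l : List α} (h : ∃ a ∈ l, ¬ P a) :
    ∃ s y t, l = s ++ y :: t ∧ (∀ a ∈ s, P a) ∧ ¬ P y := by
  induction l with
  | nil => simp at h
  | cons a l ih =>
    by_cases ha : P a
    · obtain ⟨s, y, t, rfl, h1, h2⟩ := ih (by simpa [ha] using h)
      exact ⟨a :: s, y, t, rfl, by simpa [ha] using h1, h2⟩
    · exact ⟨[], a, l, rfl, by simp, ha⟩

theorem List.eq_append_of_append_cons_eq {α : Type*} {s r q : List α} {y z : α}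
    (h : s ++ y :: q = r ++ [z]) : ∃ r', y :: q = r' ++ [z] := by
  have h' := congrArg List.getLast? h
  simp only [List.getLast?_append, List.getLast?_singleton] at h'
  refine ⟨(y :: q).dropLast, ?_⟩
  rw [List.getLast?_eq_getLast_of_ne_nil (by simp)] at h'
  simp only [Option.some_or, Option.some.injEq] at h'
  rw [← h', List.dropLast_append_getLast]

/-! ### Faces read in both directions, and robust connectivity of link graphs -/

namespace TwoComplex

variable {C : TwoComplex}

/-- The walk `w`, traversed backwards. -/
def revWalk (w : List C.Dart) : List C.Dart := (w.map rev).reverse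

theorem revWalk_append (w w' : List C.Dart) : revWalk (w ++ w') = revWalk w' ++ revWalk w := by
  simp [revWalk]

@[simp] theorem revWalk_revWalk (w : List C.Dart) : revWalk (revWalk w) = w := by
  simp [revWalk, Function.comp_def]

@[simp] theorem revWalk_singleton (d : C.Dart) : revWalk [d] = [rev d] := rfl

theorem mem_revWalk {w : List C.Dart} {d : C.Dart} : d ∈ revWalk w ↔ rev d ∈ w := by
  simp only [revWalk, List.mem_reverse, List.mem_map]
  exact ⟨by rintro ⟨a, ha, rfl⟩; simpa, fun h => ⟨_, h, rev_rev d⟩⟩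

theorem isDartWalk_revWalk {w : List C.Dart} {u v : C.V} (h : IsDartWalk src tgt w u v) :
    IsDartWalk src tgt (revWalk w) v u := by
  induction w generalizing u with
  | nil => exact Eq.symm h
  | cons d w ih =>
    rw [← List.singleton_append, revWalk_append, isDartWalk_append]
    exact ⟨tgt d, ih h.2, src_rev d, (tgt_rev d).trans h.1⟩

/-- The cyclic word `w` is the boundary of a face that has no edges in `B`, in one of its two
orientations. -/
def IsFaceWord (B : Set C.E) (w : List C.Dart) : Prop :=
  ∃ f, (∀ d ∈ C.bdry f, d.1 ∉ B) ∧ (C.bdry f ~r w ∨ C.bdry f ~r revWalk w)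

namespace IsFaceWord

variable {B : Set C.E} {w w' : List C.Dart}

theorem rotate (h : IsFaceWord B w) (hw : w ~r w') : IsFaceWord B w' := by
  obtain ⟨f, hf, h | h⟩ := h
  · exact ⟨f, hf, Or.inl (h.trans hw)⟩
  · exact ⟨f, hf, Or.inr (h.trans (hw.map rev).reverse)⟩

theorem reverse (h : IsFaceWord B w) : IsFaceWord B (revWalk w) := by
  obtain ⟨f, hf, h⟩ := h
  exact ⟨f, hf, by rw [revWalk_revWalk]; exact h.symm⟩

theorem notMem (h : IsFaceWord B w) {d : C.Dart} (hd : d ∈ w) : d.1 ∉ B := by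
  obtain ⟨f, hf, h | h⟩ := h
  · exact hf d (h.mem_iff.2 hd)
  · exact hf (rev d) (h.mem_iff.2 (mem_revWalk.2 (by simpa)))

theorem nodup (h : IsFaceWord B w) (hC : ∀ f, ((C.bdry f).map Prod.fst).Nodup) :
    (w.map Prod.fst).Nodup := by
  obtain ⟨f, hf, h | h⟩ := h
  · exact (h.map Prod.fst).nodup_iff.1 (hC f)
  · have := (h.map Prod.fst).nodup_iff.1 (hC f)
    simpa [revWalk, Function.comp_def] using this

theorem exists_isDartWalk (h : IsFaceWord B w) : ∃ v, IsDartWalk src tgt w v v := by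
  obtain ⟨f, hf, h | h⟩ := h
  · obtain ⟨v, hv⟩ := C.bdry_closed f
    exact hv.isRotated h
  · obtain ⟨v, hv⟩ := C.bdry_closed f
    obtain ⟨u, hu⟩ := hv.isRotated h
    exact ⟨u, by simpa using isDartWalk_revWalk hu⟩

theorem mono {B' : Set C.E} (h : IsFaceWord B w) (hB : B' ⊆ B) : IsFaceWord B' w := by
  obtain ⟨f, hf, h⟩ := h
  exact ⟨f, fun d hd h' => hf d hd (hB h'), h⟩

end IsFaceWord

/-- Some face without edges in `B` passes between `x` and `y`, up to edges of `S`. -/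
def PassAdj (S B : Set C.E) (x y : C.Dart) : Prop :=
  ∃ p q r s : List C.Dart, IsFaceWord B (p ++ s) ∧ (∀ d ∈ s, d.1 ∈ S) ∧
    p = y :: q ∧ p = r ++ [rev x]

namespace PassAdj

variable {S S' B B' : Set C.E} {x y : C.Dart}

theorem mono (hS : S ⊆ S') (hB : B' ⊆ B) (h : PassAdj S B x y) : PassAdj S' B' x y := by
  obtain ⟨p, q, r, s, h1, h2, h3⟩ := h
  exact ⟨p, q, r, s, h1.mono hB, fun d hd => hS (h2 d hd), h3⟩

theorem symm (h : PassAdj S B x y) : PassAdj S B y x := by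
  obtain ⟨p, q, r, s, h1, h2, h3, h4⟩ := h
  refine ⟨revWalk p, revWalk r, revWalk q, revWalk s, ?_, ?_, ?_, ?_⟩
  · refine h1.reverse.rotate ?_
    rw [revWalk_append]
    exact List.isRotated_append
  · intro d hd
    exact h2 (rev d) (mem_revWalk.1 hd)
  · rw [h4, revWalk_append, revWalk_singleton, rev_rev]; rfl
  · rw [h3, ← List.singleton_append, revWalk_append, revWalk_singleton]

theorem cornerAdj (h : PassAdj S B x y) : CornerAdj S B x y ∨ CornerAdj S B y x := by
  have aux : ∀ {x y : C.Dart} {f} {p q r s : List C.Dart}, (∀ d ∈ C.bdry f, d.1 ∉ B) →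
      C.bdry f ~r p ++ s → (∀ d ∈ s, d.1 ∈ S) → p = y :: q → p = r ++ [rev x] →
      CornerAdj S B x y := fun hf h1 h2 h3 h4 => ⟨_, hf, _, _, _, _, h1, h2, h3, h4⟩
  obtain ⟨p, q, r, s, ⟨f, hf, h1 | h1⟩, h2, h3, h4⟩ := h
  · exact Or.inl (aux hf h1 h2 h3 h4)
  · refine Or.inr (aux (p := revWalk p) (s := revWalk s) (q := revWalk r) (r := revWalk q) hf ?_
      ?_ ?_ ?_)
    · refine h1.trans ?_
      rw [revWalk_append]
      exact List.isRotated_append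
    · intro d hd
      exact h2 (rev d) (mem_revWalk.1 hd)
    · rw [h4, revWalk_append, revWalk_singleton, rev_rev]; rfl
    · rw [h3, ← List.singleton_append, revWalk_append, revWalk_singleton]

theorem notMem_right (h : PassAdj S B x y) : y.1 ∉ B := by
  obtain ⟨p, q, r, s, h1, h2, rfl, h4⟩ := h
  exact h1.notMem (by simp)

/-- A face that enters the edge `f` leaves it, up to edges of `S`, at an edge outside of `S`. -/
theorem cross (hC : ∀ f, ((C.bdry f).map Prod.fst).Nodup) {f : C.Dart} {K : Set C.V}
    (h : PassAdj S B x f) (hx : x.1 ∉ S) (hxf : x.1 ≠ f.1)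
    (hK : ∀ d : C.Dart, d.1 ∈ S → src d ∈ K → tgt d ∈ K) (hfK : tgt f ∈ K) :
    ∃ y, y.1 ∉ S ∧ y.1 ≠ f.1 ∧ src y ∈ K ∧ PassAdj (insert f.1 S) B x y := by
  obtain ⟨p, q, r, s, h1, h2, rfl, h4⟩ := h
  have hxq : rev x ∈ q := by
    have : rev x ∈ f :: q := by rw [h4]; simp
    exact (List.mem_cons.1 this).resolve_left fun h => hxf (by rw [← h]; rfl)
  -- Follow the face beyond `f` to its first dart outside `S`, which exists because `rev x` is still
  -- ahead. The darts skipped lie in `S` and so do not leave `K`.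
  obtain ⟨s', y, q', rfl, hs', hy⟩ := List.exists_first_not (P := fun d : C.Dart => d.1 ∈ S)
    ⟨_, hxq, hx⟩
  obtain ⟨r', hr'⟩ := List.eq_append_of_append_cons_eq (s := f :: s') h4
  refine ⟨y, hy, ?_, ?_, y :: q', q', r', s ++ f :: s', h1.rotate ?_, ?_, rfl, hr'⟩
  -- No face runs through the edge of `f` twice.
  · have hn := h1.nodup hC
    intro hyf
    simp [hyf] at hn
  · obtain ⟨v, hv⟩ := h1.exists_isDartWalk
    rw [List.cons_append, List.append_assoc] at hv
    obtain ⟨w, hw, hw'⟩ := isDartWalk_append.1 hv.2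
    have hyw : src y = w := hw'.1
    rw [hyw]
    clear h1 h4 hv hw' hxq hr'
    have : ∀ (l : List C.Dart) (u w : C.V), IsDartWalk src tgt l u w → (∀ d ∈ l, d.1 ∈ S) →
        u ∈ K → w ∈ K := by
      intro l
      induction l with
      | nil => rintro u w rfl - hu; exact hu
      | cons d l ih =>
        rintro u w ⟨rfl, h⟩ hl hu
        exact ih _ _ h (fun d' hd' => hl d' (by simp [hd'])) (hK d (hl d (by simp)) hu)
    exact this s' _ _ hw hs' hfK
  · have : (f :: (s' ++ y :: q')) ++ s = (f :: s') ++ ((y :: q') ++ s) := by simp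
    rw [this, ← List.append_assoc (y :: q')]
    exact List.isRotated_append
  · intro d hd
    rcases List.mem_append.1 hd with h | h
    · exact Or.inr (h2 d h)
    · rcases List.mem_cons.1 h with rfl | h
      exacts [Or.inl rfl, Or.inr (hs' d h)]

end PassAdj

/-- The darts outside of `S` and `B` that start in `K`, except for `g`. -/
def dartsAt (S B : Set C.E) (K : Set C.V) (g : C.Dart) : Set C.Dart :=
  {x | src x ∈ K ∧ x.1 ∉ S ∧ x.1 ∉ B ∧ x ≠ g}

/-- The link graph that arises at `K` when `S` is contracted and the edges and faces at `B` are
deleted is connected, and remains so when any vertex is deleted. -/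
def LinkConn (S B : Set C.E) (K : Set C.V) : Prop :=
  ∀ g, ∀ x ∈ dartsAt S B K g, ∀ y ∈ dartsAt S B K g,
    Relation.EqvGen (fun a b => a ∈ dartsAt S B K g ∧ b ∈ dartsAt S B K g ∧ PassAdj S B a b) x y

theorem eqvGen_lift {α : Type*} {r p : α → α → Prop} (hp : Equivalence p) (h : ∀ a b, r a b → p a b)
    {x y : α} (hxy : Relation.EqvGen r x y) : p x y := by
  induction hxy with
  | rel a b h' => exact h a b h'
  | refl a => exact hp.refl a
  | symm a b _ ih => exact hp.symm ih
  | trans a b c _ _ ih ih' => exact hp.trans ih ih'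

theorem LinkConn.mono {S S' B : Set C.E} {K : Set C.V} (h : LinkConn S B K) (hS : S ⊆ S')
    (hK : ∀ d : C.Dart, d.1 ∈ S' → src d ∈ K → d.1 ∈ S) : LinkConn S' B K := by
  have key : ∀ g, dartsAt S' B K g = dartsAt S B K g := by
    intro g
    ext x
    exact ⟨fun h => ⟨h.1, fun hx => h.2.1 (hS hx), h.2.2⟩,
      fun h => ⟨h.1, fun hx => h.2.1 (hK x hx h.1), h.2.2⟩⟩
  intro g
  rw [key]
  exact fun x hx y hy => Relation.EqvGen.mono
    (fun a b h => ⟨h.1, h.2.1, h.2.2.mono hS subset_rfl⟩) _ _ (h g x hx y hy)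

/-- Contracting `f` glues the two link graphs: the vertices `f` and `rev f` vanish and the face
passages at them are joined up. As `g` is not at `K'`, the side of `K'` stays connected, having lost
only `rev f`. A dart at `K` reaches `f` in its own link graph without `g`, and the last face on that
way to `f` leads across to `K'`. -/
theorem LinkConn.insert_aux {S B : Set C.E} {K K' : Set C.V}
    (hC : ∀ f, ((C.bdry f).map Prod.fst).Nodup) (h : LinkConn S B K) (h' : LinkConn S B K')
    (hK' : ∀ d : C.Dart, d.1 ∈ S → src d ∈ K' → tgt d ∈ K') (hKK : Disjoint K K') {f : C.Dart}
    (hf : src f ∈ K) (hf' : tgt f ∈ K') (hfS : f.1 ∉ S) (hfB : f.1 ∉ B) (g : C.Dart)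
    (hg : src g ∉ K') :
    ∀ x ∈ dartsAt (insert f.1 S) B (K ∪ K') g, ∀ y ∈ dartsAt (insert f.1 S) B (K ∪ K') g,
      Relation.EqvGen (fun a b => a ∈ dartsAt (insert f.1 S) B (K ∪ K') g ∧
        b ∈ dartsAt (insert f.1 S) B (K ∪ K') g ∧ PassAdj (insert f.1 S) B a b) x y := by
  set E := dartsAt (insert f.1 S) B (K ∪ K') g with hE
  set R := Relation.EqvGen (fun a b => a ∈ E ∧ b ∈ E ∧ PassAdj (insert f.1 S) B a b) with hR
  have hReq : Equivalence R := ⟨.refl, .symm _ _, .trans _ _ _⟩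
  have disj : ∀ {u}, u ∈ K → u ∉ K' := fun hu hu' => Set.disjoint_left.1 hKK hu hu'
  have memE : ∀ {x : C.Dart}, src x ∈ K' → x.1 ∉ S → x.1 ≠ f.1 → x.1 ∉ B → x ∈ E :=
    fun h1 h2 h3 h4 => ⟨Or.inr h1, fun h => h.elim h3 h2, h4, fun h => hg (h ▸ h1)⟩
  have conn' : ∀ x ∈ E, ∀ y ∈ E, src x ∈ K' → src y ∈ K' → R x y := by
    have sub : ∀ x ∈ dartsAt S B K' (rev f), x ∈ E := by
      rintro x ⟨h1, h2, h3, h4⟩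
      refine memE h1 h2 (fun h => ?_) h3
      rcases eq_or_eq_rev h with rfl | rfl
      exacts [disj hf h1, h4 rfl]
    have sup : ∀ x ∈ E, src x ∈ K' → x ∈ dartsAt S B K' (rev f) := by
      rintro x ⟨h1, h2, h3, h4⟩ hx
      exact ⟨hx, fun h => h2 (Or.inr h), h3, fun h => h2 (Or.inl (by rw [h]; rfl))⟩
    intro x hx y hy hxK hyK
    exact Relation.EqvGen.mono (fun a b h => ⟨sub a h.1, sub b h.2.1,
      h.2.2.mono (subset_insert _ _) subset_rfl⟩) _ _ (h' (rev f) x (sup x hx hxK) y (sup y hy hyK))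
  have out : ∀ x ∈ E, src x ∈ K → ∃ z ∈ E, src z ∈ K' ∧ R x z := by
    -- If `g` is `f`, which vanishes anyway, then nothing else is deleted at `K`; `rev f`, which
    -- does not start in `K`, then stands in for `g`.
    obtain ⟨g', hg'f, hg'⟩ : ∃ g', g' ≠ f ∧ ∀ x, src x ∈ K → x ≠ f → (x = g ↔ x = g') := by
      by_cases hgf : g = f
      · refine ⟨rev f, fun h => disj hf (by rw [← src_rev f, h] at hf'; exact hf'), fun x hx hxf => ?_⟩
        refine ⟨fun h => (hxf (h.trans hgf)).elim, ?_⟩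
        rintro rfl
        exact (disj hx (by simpa)).elim
      · exact ⟨g, hgf, fun _ _ _ => Iff.rfl⟩
    intro x hx hxK
    -- `Q` spreads along adjacency from `f`; at a neighbour of `f` itself it is `PassAdj.cross` that
    -- provides the dart on the other side.
    let Q : C.Dart → Prop := fun a => a = f ∨ ∃ z ∈ E, src z ∈ K' ∧ R a z
    have sub : ∀ a ∈ dartsAt S B K g', a ≠ f → a.1 ≠ f.1 ∧ a ∈ E := by
      rintro a ⟨h1, h2, h3, h4⟩ haf
      have : a.1 ≠ f.1 := by
        intro h
        rcases eq_or_eq_rev h with rfl | rfl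
        exacts [haf rfl, disj h1 (by simpa)]
      exact ⟨this, Or.inl h1, fun h => h.elim this h2, h3, fun h => h4 ((hg' a h1 haf).1 h)⟩
    have step : ∀ a b, a ∈ dartsAt S B K g' → b ∈ dartsAt S B K g' → PassAdj S B a b →
        Q a → Q b := by
      intro a b ha hb hab hQ
      by_cases hbf : b = f
      · exact Or.inl hbf
      right
      obtain ⟨hbf1, hbE⟩ := sub b hb hbf
      by_cases haf : a = f
      · subst haf
        obtain ⟨y, hy1, hy2, hy3, hy4⟩ := hab.symm.cross hC hb.2.1 hbf1 hK' hf'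
        have hyE := memE hy3 hy1 hy2 hy4.notMem_right
        exact ⟨y, hyE, hy3, .rel _ _ ⟨hbE, hyE, hy4⟩⟩
      · obtain ⟨z, hz, hzK, haz⟩ := hQ.resolve_left haf
        exact ⟨z, hz, hzK, .trans _ _ _ (.rel _ _ ⟨hbE, (sub a ha haf).2,
          hab.symm.mono (subset_insert _ _) subset_rfl⟩) haz⟩
    have hxf : x ≠ f := fun h => hx.2.1 (Or.inl (by rw [h]))
    have hxD : x ∈ dartsAt S B K g' := ⟨hxK, fun h => hx.2.1 (Or.inr h), hx.2.2.1,
      fun h => hx.2.2.2 ((hg' x hxK hxf).2 h)⟩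
    have hQ : Q f ↔ Q x := eqvGen_lift (p := fun a b => Q a ↔ Q b)
      ⟨fun _ => Iff.rfl, Iff.symm, Iff.trans⟩
      (fun a b h => ⟨step a b h.1 h.2.1 h.2.2, step b a h.2.1 h.1 h.2.2.symm⟩)
      (h g' f ⟨hf, hfS, hfB, hg'f.symm⟩ x hxD)
    exact (hQ.1 (Or.inl rfl)).resolve_left hxf
  have out' : ∀ x ∈ E, ∃ z ∈ E, src z ∈ K' ∧ R x z := fun x hx =>
    hx.1.elim (out x hx) fun h => ⟨x, hx, h, .refl x⟩
  intro x hx y hy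
  obtain ⟨z, hz, hzK, hxz⟩ := out' x hx
  obtain ⟨w, hw, hwK, hyw⟩ := out' y hy
  exact hReq.trans hxz (hReq.trans (conn' z hz w hw hzK hwK) (hReq.symm hyw))

theorem LinkConn.insert {S B : Set C.E} {K K' : Set C.V}
    (hC : ∀ f, ((C.bdry f).map Prod.fst).Nodup) (h : LinkConn S B K) (h' : LinkConn S B K')
    (hK : ∀ d : C.Dart, d.1 ∈ S → src d ∈ K → tgt d ∈ K)
    (hK' : ∀ d : C.Dart, d.1 ∈ S → src d ∈ K' → tgt d ∈ K') (hKK : Disjoint K K') {f : C.Dart}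
    (hf : src f ∈ K) (hf' : tgt f ∈ K') (hfS : f.1 ∉ S) (hfB : f.1 ∉ B) :
    LinkConn (insert f.1 S) B (K ∪ K') := by
  intro g
  by_cases hg : src g ∈ K'
  · have hg' : src g ∉ K := fun h => Set.disjoint_left.1 hKK h hg
    have := LinkConn.insert_aux hC h' h hK hKK.symm (f := rev f) (by simpa) (by simpa) hfS hfB g hg'
    rwa [union_comm] at this
  · exact LinkConn.insert_aux hC h h' hK' hKK hf hf' hfS hfB g hg

/-- In the contraction of a forest, the link graphs are connected and remain so when any vertex is
deleted, if this holds before the contraction. -/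
theorem linkConn_of_isForest {B : Set C.E} (hC : ∀ f, ((C.bdry f).map Prod.fst).Nodup)
    {S : Set C.E} (hfin : S.Finite) (hS : IsForest S) (hSB : Disjoint S B) (v : C.V)
    (hv : ∀ u, Conn S v u → LinkConn ∅ B {u}) : LinkConn S B {u | Conn S v u} := by
  -- An added edge that meets the component of `v` joins it to a different component, as `S` is a
  -- forest; any other added edge leaves this component and its darts alone.
  induction S, hfin using Set.Finite.induction_on generalizing v with
  | empty =>
    have : {u | Conn ∅ v u} = {v} := by
      ext u
      refine ⟨fun h => ?_, fun h => by rw [mem_singleton_iff.1 h]; exact Conn.refl _⟩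
      exact (Conn.lift (r := Eq) ⟨fun _ => rfl, Eq.symm, Eq.trans⟩ (fun e he => he.elim) h).symm
    rw [this]
    exact hv v (Conn.refl v)
  | @insert e S heS _ ih =>
    have hS' := hS.mono (subset_insert e S)
    have hSB' := hSB.mono_left (subset_insert e S)
    have he : ¬ Conn S (C.tail e) (C.head e) := fun h => hS e (mem_insert _ _)
      (h.mono fun x hx => ⟨Or.inr hx, fun hxe => heS (hxe ▸ hx)⟩)
    have closed : ∀ u, ∀ d : C.Dart, d.1 ∈ S → src d ∈ {w | Conn S u w} → tgt d ∈ {w | Conn S u w} :=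
      fun u d hd h => Conn.trans h (Conn.of_dart hd)
    have main : ∀ d : C.Dart, d.1 = e → Conn S v (src d) →
        LinkConn (insert e S) B {u | Conn (insert e S) v u} := by
      rintro d rfl hd
      have hdn : ¬ Conn S (src d) (tgt d) := by
        obtain ⟨e, b⟩ := d
        cases b
        exacts [fun h => he h.symm, he]
      have hvt : Conn (insert d.1 S) v (tgt d) :=
        (hd.mono (subset_insert _ _)).trans (Conn.of_dart (mem_insert _ _))
      have h1 := ih hS' hSB' v fun u hu => hv u (hu.mono (subset_insert _ _))
      have h2 := ih hS' hSB' (tgt d) fun u hu => hv u (hvt.trans (hu.mono (subset_insert _ _)))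
      have hdis : Disjoint {u | Conn S v u} {u | Conn S (tgt d) u} := by
        rw [Set.disjoint_left]
        intro u hu hu'
        exact hdn (hd.symm.trans (Conn.trans hu (Conn.symm hu')))
      have key := h1.insert hC h2 (closed v) (closed (tgt d)) hdis (f := d) hd (Conn.refl _) heS
        (Set.disjoint_left.1 hSB (mem_insert _ _))
      convert! key using 1
      ext u
      refine ⟨fun hu => ?_, ?_⟩
      · have hends : (C.tail d.1 = src d ∧ C.head d.1 = tgt d) ∨
            (C.tail d.1 = tgt d ∧ C.head d.1 = src d) := by
          obtain ⟨e, b⟩ := d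
          cases b
          exacts [Or.inr ⟨rfl, rfl⟩, Or.inl ⟨rfl, rfl⟩]
        rcases hends with ⟨ht, hh⟩ | ⟨ht, hh⟩ <;>
        · rcases Conn.of_insert hu with h | ⟨h, h'⟩ | ⟨h, h'⟩
          · exact Or.inl h
          · rw [ht] at h; rw [hh] at h'
            first | exact Or.inr h' | exact Or.inl (hd.trans h')
          · rw [hh] at h; rw [ht] at h'
            first | exact Or.inr h' | exact Or.inl (hd.trans h')
      · rintro (h | h)
        exacts [h.mono (subset_insert _ _), hvt.trans (h.mono (subset_insert _ _))]
    by_cases ht : Conn S v (C.tail e)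
    · exact main (e, true) rfl ht
    by_cases hh : Conn S v (C.head e)
    · exact main (e, false) rfl hh
    have hsame : {u | Conn (insert e S) v u} = {u | Conn S v u} := by
      ext u
      refine ⟨fun hu => ?_, fun hu => hu.mono (subset_insert _ _)⟩
      rcases Conn.of_insert hu with h | ⟨h, -⟩ | ⟨h, -⟩
      exacts [h, (ht h).elim, (hh h).elim]
    rw [hsame]
    refine (ih hS' hSB' v fun u hu => hv u (hu.mono (subset_insert _ _))).mono (subset_insert _ _) ?_
    rintro ⟨f, b⟩ hd hdv
    refine (mem_insert_iff.1 hd).resolve_left ?_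
    rintro rfl
    cases b
    exacts [hh hdv, ht hdv]

end TwoComplex

/-! ### Minors of link graphs, expressed before contraction -/

namespace TwoComplex

variable {C : TwoComplex}

/-- The simple graph `H` is a minor of the link graph of `C/S` at the image of `v`, expressed by
branch sets of darts of `C`. -/
def HasLinkMinor {W : Type*} (S : Set C.E) (v : C.V) (H : SimpleGraph W) : Prop :=
  ∃ B : W → Set C.Dart, (∀ w, (B w).Nonempty) ∧ (∀ w, ∀ x ∈ B w, x.1 ∉ S ∧ Conn S v (src x)) ∧
    (∀ w, ∀ x ∈ B w, ∀ y ∈ B w,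
      Relation.EqvGen (fun a b => a ∈ B w ∧ b ∈ B w ∧ PassAdj S ∅ a b) x y) ∧
    Pairwise (fun w w' => Disjoint (B w) (B w')) ∧
    ∀ w w', H.Adj w w' → ∃ x ∈ B w, ∃ y ∈ B w', PassAdj S ∅ x y

/-- The injection `ι` of the surviving darts is kept general so that the same argument serves a
single and an iterated contraction. -/
theorem HasLinkMinor.hasMinor {W α β : Type*} {S : Set C.E} {v : C.V} {H : SimpleGraph W}
    (h : HasLinkMinor S v H) (G : Graph α β) (ι : ∀ x : C.Dart, x.1 ∉ S → α)
    (hι : ∀ x y hx hy, ι x hx = ι y hy → x = y)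
    (hV : ∀ x hx, Conn S v (src x) → ι x hx ∈ G.vertexSet)
    (hG : ∀ x y hx hy, Conn S v (src x) → Conn S v (src y) → PassAdj S ∅ x y →
      G.Adj (ι x hx) (ι y hy)) : G.HasMinor H := by
  obtain ⟨B, h1, h2, h3, h4, h5⟩ := h
  refine ⟨fun w => {z | ∃ x ∈ B w, ∃ hx, ι x hx = z}, fun w => ⟨?_, ?_, ?_⟩, ?_, ?_⟩
  · rintro _ ⟨x, hx, hxS, rfl⟩
    exact hV x hxS (h2 w x hx).2
  · obtain ⟨x, hx⟩ := h1 w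
    exact ⟨_, x, hx, (h2 w x hx).1, rfl⟩
  · rintro _ ⟨x, hx, hxS, rfl⟩ _ ⟨y, hy, hyS, rfl⟩
    let R := Relation.ReflTransGen fun a b => a ∈ {z | ∃ x ∈ B w, ∃ hx, ι x hx = z} ∧
      b ∈ {z | ∃ x ∈ B w, ∃ hx, ι x hx = z} ∧ G.Adj a b
    have hRs : ∀ {a b}, R a b → R b a := by
      intro a b hab
      induction hab with
      | refl => exact .refl
      | tail _ h ih => exact .head ⟨h.2.1, h.1, h.2.2.symm⟩ ih
    -- Membership in `B w` is carried along because transitivity has to know that the intermediate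
    -- dart avoids `S`.
    have key' : (x ∈ B w ↔ y ∈ B w) ∧ (x ∈ B w → ∀ (ha : x.1 ∉ S) (hb : y.1 ∉ S),
        R (ι x ha) (ι y hb)) := by
      refine eqvGen_lift (p := fun a b => (a ∈ B w ↔ b ∈ B w) ∧ (a ∈ B w →
        ∀ (ha : a.1 ∉ S) (hb : b.1 ∉ S), R (ι a ha) (ι b hb))) ⟨?_, ?_, ?_⟩ ?_
        (h3 w x hx y hy)
      · exact fun a => ⟨Iff.rfl, fun _ _ _ => .refl⟩
      · exact fun {a b} h => ⟨h.1.symm, fun hb ha' hb' => hRs (h.2 (h.1.2 hb) hb' ha')⟩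
      · exact fun {a b c} h k => ⟨h.1.trans k.1, fun ha ha' hc' =>
          (h.2 ha ha' (h2 w b (h.1.1 ha)).1).trans (k.2 (h.1.1 ha) _ hc')⟩
      · exact fun a b h => ⟨⟨fun _ => h.2.1, fun _ => h.1⟩, fun _ ha hb => .single
          ⟨⟨a, h.1, ha, rfl⟩, ⟨b, h.2.1, hb, rfl⟩,
            hG a b ha hb (h2 w a h.1).2 (h2 w b h.2.1).2 h.2.2⟩⟩
    exact key'.2 hx hxS hyS
  · intro w w' hww
    rw [Set.disjoint_left]
    rintro _ ⟨x, hx, hxS, rfl⟩ ⟨y, hy, hyS, hxy⟩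
    have := hι _ _ _ _ hxy
    exact Set.disjoint_left.1 (h4 hww) hx (this ▸ hy)
  · intro w w' hww
    obtain ⟨x, hx, y, hy, hxy⟩ := h5 w w' hww
    exact ⟨_, ⟨x, hx, (h2 w x hx).1, rfl⟩, _, ⟨y, hy, (h2 w' y hy).1, rfl⟩,
      hG x y _ _ (h2 w x hx).2 (h2 w' y hy).2 hxy⟩

theorem HasLinkMinor.contract {W : Type*} {S : Set C.E} {v : C.V} {H : SimpleGraph W}
    (h : HasLinkMinor S v H) : ((C.contract S).link (C.toContract S v)).HasMinor H := by
  have hsrc : ∀ (x : C.Dart) (hx : x.1 ∉ S), Conn S v (src x) →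
      src (Dart.toContract x hx) = C.toContract S v := fun x hx h => by
    rw [src_toContract, toContract_eq_iff]; exact h.symm
  have hempty : {e : (C.contract S).E | e.1 ∈ S} = ∅ := by
    ext e
    exact ⟨fun h => e.2 h, fun h => h.elim⟩
  refine h.hasMinor _ (fun x hx => Dart.toContract x hx) ?_ hsrc ?_
  · intro x y hx hy hxy
    have h1 := congrArg (fun z : (C.contract S).Dart => z.1.1) hxy
    have h2 := congrArg Prod.snd hxy
    exact Prod.ext h1 h2
  · intro x y hx hy hxv hyv hxy
    rcases hxy.cornerAdj with h | h
    · have := h.contract hx hy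
      rw [hempty] at this
      exact this.link_adj (hsrc x hx hxv) (hsrc y hy hyv)
    · have := h.contract hy hx
      rw [hempty] at this
      exact (this.link_adj (hsrc y hy hyv) (hsrc x hx hxv)).symm

/-- A stretch of a face in `insert e T` is reduced to copies of `e` by the first contraction and to
nothing by the second. -/
theorem HasLinkMinor.contract_contract {W : Type*} {T : Set C.E} {e : (C.contract T).E} {v : C.V}
    {H : SimpleGraph W} (h : HasLinkMinor (insert e.1 T) v H) :
    (((C.contract T).contract {e}).link
      ((C.contract T).toContract {e} (C.toContract T v))).HasMinor H := by
  have hne : ∀ {x : C.Dart}, x.1 ∉ insert e.1 T → x.1 ∉ T := fun hx h => hx (Or.inr h)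
  have hne' : ∀ {x : C.Dart} (hx : x.1 ∉ insert e.1 T),
      (Dart.toContract x (hne hx)).1 ∉ ({e} : Set (C.contract T).E) := fun hx h =>
    hx (Or.inl (congrArg Subtype.val h))
  have hconn : ∀ {u w : C.V}, Conn (insert e.1 T) u w →
      (C.contract T).toContract {e} (C.toContract T u) =
        (C.contract T).toContract {e} (C.toContract T w) := by
    intro u w huw
    refine Conn.lift (r := fun u w => (C.contract T).toContract {e} (C.toContract T u) =
        (C.contract T).toContract {e} (C.toContract T w)) ⟨fun _ => rfl, Eq.symm, Eq.trans⟩ ?_ huw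
    rintro f (rfl | hf)
    · exact toContract_eq_iff.2 (Conn.of_mem (C := C.contract T) (mem_singleton e))
    · exact congrArg _ (toContract_eq_iff.2 (Conn.of_mem hf))
  have hsrc : ∀ (x : C.Dart) (hx : x.1 ∉ insert e.1 T), Conn (insert e.1 T) v (src x) →
      src (Dart.toContract (Dart.toContract x (hne hx)) (hne' hx)) =
        (C.contract T).toContract {e} (C.toContract T v) := fun x hx h => by
    rw [src_toContract, src_toContract, hconn h]
  have hsing : {f : (C.contract T).E | f.1 ∈ insert e.1 T} = {e} := by
    ext f
    refine ⟨fun h => Subtype.ext (h.resolve_right f.2), ?_⟩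
    rintro rfl
    exact mem_insert _ _
  have hempty : {f : ((C.contract T).contract {e}).E | f.1 ∈ ({e} : Set (C.contract T).E)} = ∅ := by
    ext f
    exact ⟨fun h => f.2 h, fun h => h.elim⟩
  have hadj : ∀ x y hx hy, CornerAdj (insert e.1 T) ∅ x y → CornerAdj ∅ ∅
      (Dart.toContract (Dart.toContract x (hne hx)) (hne' hx))
      (Dart.toContract (Dart.toContract y (hne hy)) (hne' hy)) := by
    intro x y hx hy hxy
    have h1 := hxy.contract (hne hx) (hne hy)
    rw [hsing] at h1
    have h2 := h1.contract (hne' hx) (hne' hy)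
    rwa [hempty] at h2
  refine h.hasMinor _ (fun x hx => Dart.toContract (Dart.toContract x (hne hx)) (hne' hx)) ?_
    hsrc ?_
  · intro x y hx hy hxy
    have h1 := congrArg (fun z : ((C.contract T).contract {e}).Dart => z.1.1.1) hxy
    have h2 := congrArg Prod.snd hxy
    exact Prod.ext h1 h2
  · intro x y hx hy hxv hyv hxy
    rcases hxy.cornerAdj with h | h
    · exact (hadj x y hx hy h).link_adj (hsrc x hx hxv) (hsrc y hy hyv)
    · exact ((hadj y x hy hx h).link_adj (hsrc y hy hyv) (hsrc x hx hxv)).symm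

end TwoComplex

/-! ### The contraction around three consecutive edges of the only cycle -/

namespace TwoComplex

variable {C : TwoComplex}

/-- Three consecutive edges, from `v₀` via `v₁` and `v₂` to `v₃`, of the unique cycle in the edge
set `S` of a 2-complex all of whose other link graphs are robustly connected. -/
structure TripleConfig (C : TwoComplex) (S : Set C.E) where
  v₀ : C.V
  v₁ : C.V
  v₂ : C.V
  v₃ : C.V
  E₁ : C.Dart
  E₂ : C.Dart
  E₃ : C.Dart
  src₁ : src E₁ = v₀
  tgt₁ : tgt E₁ = v₁
  src₂ : src E₂ = v₁
  tgt₂ : tgt E₂ = v₂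
  src₃ : src E₃ = v₂
  tgt₃ : tgt E₃ = v₃
  v₀_ne_v₁ : v₀ ≠ v₁
  v₀_ne_v₂ : v₀ ≠ v₂
  ne₁₂ : E₁.1 ≠ E₂.1
  ne₂₃ : E₂.1 ≠ E₃.1
  mem₁ : E₁.1 ∈ S
  mem₂ : E₂.1 ∈ S
  mem₃ : E₃.1 ∈ S
  finite : S.Finite
  nodup : ∀ f, ((C.bdry f).map Prod.fst).Nodup
  forest₁ : IsForest (S \ {E₁.1})
  forest₂ : IsForest (S \ {E₂.1})
  conn : Conn {e ∈ S | (C.tail e ≠ v₁ ∧ C.head e ≠ v₁) ∧ C.tail e ≠ v₂ ∧ C.head e ≠ v₂} v₀ v₃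
  link : ∀ u, u ≠ v₁ → u ≠ v₂ → LinkConn ∅ {E₁.1, E₂.1, E₃.1} {u}

namespace TripleConfig

variable {S : Set C.E} (X : TripleConfig C S)

/-- The three edges of the configuration. -/
def edges : Set C.E := {X.E₁.1, X.E₂.1, X.E₃.1}

/-- The edges of `S` that avoid the two inner vertices. -/
def outer : Set C.E :=
  {e ∈ S | (C.tail e ≠ X.v₁ ∧ C.head e ≠ X.v₁) ∧ C.tail e ≠ X.v₂ ∧ C.head e ≠ X.v₂}

/-- The vertex is one of the two inner vertices. -/
def Inner (v : C.V) : Prop := v = X.v₁ ∨ v = X.v₂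

theorem edges_subset : X.edges ⊆ S := by
  rintro e (rfl | rfl | rfl)
  exacts [X.mem₁, X.mem₂, X.mem₃]

theorem mem_outer_iff {d : C.Dart} :
    d.1 ∈ X.outer ↔ d.1 ∈ S ∧ ¬ X.Inner (src d) ∧ ¬ X.Inner (tgt d) := by
  obtain ⟨e, b⟩ := d
  have key : e ∈ X.outer ↔ e ∈ S ∧ ¬ X.Inner (C.tail e) ∧ ¬ X.Inner (C.head e) := by
    simp only [outer, Inner, mem_ofPred_eq, not_or]
    tauto
  cases b
  · exact key.trans (and_congr_right' and_comm)
  · exact key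

theorem not_mem_outer (d : C.Dart) (h : X.Inner (src d)) : d.1 ∉ X.outer :=
  fun hd => (X.mem_outer_iff.1 hd).2.1 h

theorem edges_disjoint_outer : Disjoint X.outer X.edges := by
  rw [Set.disjoint_right]
  rintro e (rfl | rfl | rfl)
  · exact X.not_mem_outer (rev X.E₁) (Or.inl (by rw [src_rev, X.tgt₁]))
  · exact X.not_mem_outer X.E₂ (Or.inl X.src₂)
  · exact X.not_mem_outer X.E₃ (Or.inr X.src₃)

theorem outer_subset : X.outer ⊆ S := fun _ h => h.1

theorem outer_subset_diff : X.outer ⊆ S \ X.edges := fun _ h =>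
  ⟨h.1, Set.disjoint_left.1 X.edges_disjoint_outer h⟩

/-- The inner vertices are isolated in `outer`. -/
theorem eq_of_conn_inner {u w : C.V} (h : Conn X.outer u w) (hw : X.Inner w) : u = w := by
  have : (u = w ∨ (¬ X.Inner u ∧ ¬ X.Inner w)) := by
    refine h.lift (r := fun u w => u = w ∨ (¬ X.Inner u ∧ ¬ X.Inner w)) ⟨fun _ => Or.inl rfl, ?_, ?_⟩
      fun e he => Or.inr (X.mem_outer_iff (d := (e, true)).1 he).2
    · rintro x y (rfl | h)
      exacts [Or.inl rfl, Or.inr h.symm]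
    · rintro x y z (rfl | h) (rfl | k)
      exacts [Or.inl rfl, Or.inr k, Or.inr h, Or.inr ⟨h.1, k.2⟩]
  exact this.resolve_right fun h => h.2 hw

/-- A dart at an inner vertex, other than those of the triple. -/
def IsNode (d : C.Dart) : Prop := X.Inner (src d) ∧ d.1 ∉ X.edges

variable {X}

theorem outer_subset_diff_pair {e e' : C.E} (he : e ∈ X.edges) (he' : e' ∈ X.edges) :
    X.outer ⊆ (S \ {e}) \ {e'} := fun _ h => ⟨⟨h.1, fun h' => (X.outer_subset_diff h).2 (h' ▸ he)⟩,
  fun h' => (X.outer_subset_diff h).2 (h' ▸ he')⟩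

theorem mem₁' : X.E₁.1 ∈ X.edges := Or.inl rfl
theorem mem₂' : X.E₂.1 ∈ X.edges := Or.inr (Or.inl rfl)
theorem mem₃' : X.E₃.1 ∈ X.edges := Or.inr (Or.inr rfl)

theorem IsNode.mem_diff {d : C.Dart} (hd : X.IsNode d) (hdS : d.1 ∈ S) {e e' : C.E}
    (he : e ∈ X.edges) (he' : e' ∈ X.edges) : d.1 ∈ (S \ {e}) \ {e'} :=
  ⟨⟨hdS, fun h' => hd.2 (h' ▸ he)⟩, fun h' => hd.2 (h' ▸ he')⟩

/-- Otherwise `E₂` would lie on a cycle that avoids `E₁`. -/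
theorem not_conn_inner {F : Set C.E} (hF : F ⊆ (S \ {X.E₁.1}) \ {X.E₂.1}) :
    ¬ Conn F X.v₁ X.v₂ := fun h => by
  have := X.forest₁.not_conn (d := X.E₂) ⟨X.mem₂, X.ne₁₂.symm⟩
  rw [X.src₂, X.tgt₂] at this
  exact this (h.mono hF)

/-- Otherwise `d` would close a cycle avoiding `E₂`: through `E₁` if `d` starts at `v₁`, and through
`v₃` and `E₃` if it starts at `v₂`. -/
theorem not_conn_base (d : C.Dart) (hd : X.IsNode d) (hdS : d.1 ∈ S) :
    ¬ Conn X.outer X.v₀ (tgt d) := by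
  intro h
  rcases hd.1 with hs | hs
  · have := X.forest₂.not_conn (d := X.E₁) ⟨X.mem₁, X.ne₁₂⟩
    rw [X.src₁, X.tgt₁] at this
    exact this ((h.mono (outer_subset_diff_pair mem₂' mem₁')).trans
      (hs ▸ (Conn.of_dart (hd.mem_diff hdS mem₂' mem₁')).symm))
  · have := X.forest₂.not_conn (d := X.E₃) ⟨X.mem₃, X.ne₂₃.symm⟩
    rw [X.src₃, X.tgt₃] at this
    refine this (Conn.symm ?_)
    exact (((X.conn.symm.trans h).mono (outer_subset_diff_pair mem₂' mem₃')).trans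
      (hs ▸ (Conn.of_dart (hd.mem_diff hdS mem₂' mem₃')).symm))

/-- Starting at the same inner vertex, `d` and `d'` would close a cycle without `E₂` (or `d` would
be a loop). Starting at different ones, they would connect `v₁` to `v₂` without `E₁` and `E₂`. -/
theorem not_conn_node {d d' : C.Dart} (hd : X.IsNode d) (hdS : d.1 ∈ S) (hd' : X.IsNode d')
    (hdS' : d'.1 ∈ S) (hdd : d ≠ d') : ¬ Conn X.outer (tgt d) (tgt d') := by
  intro h
  by_cases hs : src d = src d'
  · have hF : d.1 ∈ S \ {X.E₂.1} := ⟨hdS, fun h' => hd.2 (h' ▸ mem₂')⟩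
    have hdd' : d'.1 ≠ d.1 := by
      intro he
      rcases eq_or_eq_rev he with h' | h'
      · exact hdd h'.symm
      · apply X.forest₂.not_conn hF
        have : src d = tgt d := by rw [hs, h', src_rev]
        rw [this]; exact Conn.refl _
    refine X.forest₂.not_conn hF ?_
    have hF' : d'.1 ∈ (S \ {X.E₂.1}) \ {d.1} := ⟨⟨hdS', fun h' => hd'.2 (h' ▸ mem₂')⟩, hdd'⟩
    have hsub : X.outer ⊆ (S \ {X.E₂.1}) \ {d.1} := fun e he =>
      ⟨⟨he.1, fun h' => (X.outer_subset_diff he).2 (h' ▸ mem₂')⟩,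
        fun h' => X.not_mem_outer d hd.1 (by have h' : e = d.1 := h'; exact h' ▸ he)⟩
    exact (hs ▸ Conn.of_dart hF').trans (h.mono hsub).symm
  · have key : Conn ((S \ {X.E₁.1}) \ {X.E₂.1}) (src d) (src d') :=
      ((Conn.of_dart (hd.mem_diff hdS mem₁' mem₂')).trans
        (h.mono (outer_subset_diff_pair mem₁' mem₂'))).trans
        (Conn.of_dart (hd'.mem_diff hdS' mem₁' mem₂')).symm
    rcases hd.1 with h1 | h1 <;> rcases hd'.1 with h2 | h2
    · exact hs (h1.trans h2.symm)
    · exact not_conn_inner subset_rfl (h1 ▸ h2 ▸ key)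
    · exact not_conn_inner subset_rfl (h1 ▸ h2 ▸ key).symm
    · exact hs (h1.trans h2.symm)

theorem tgt_not_inner {d : C.Dart} (hd : X.IsNode d) (hdS : d.1 ∈ S) : ¬ X.Inner (tgt d) := by
  intro ht
  by_cases hs : src d = tgt d
  · have hF : d.1 ∈ S \ {X.E₂.1} := ⟨hdS, fun h' => hd.2 (h' ▸ mem₂')⟩
    refine X.forest₂.not_conn hF ?_
    rw [hs]; exact Conn.refl _
  · have key := Conn.of_dart (hd.mem_diff hdS mem₁' mem₂')
    rcases hd.1 with h1 | h1 <;> rcases ht with h2 | h2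
    · exact hs (h1.trans h2.symm)
    · exact not_conn_inner subset_rfl (h1 ▸ h2 ▸ key)
    · exact not_conn_inner subset_rfl (h1 ▸ h2 ▸ key).symm
    · exact hs (h1.trans h2.symm)

theorem v₀_not_inner : ¬ X.Inner X.v₀ := fun h => h.elim X.v₀_ne_v₁ X.v₀_ne_v₂

variable (X)

/-- The part of the link graph that replaces a dart at an inner vertex (or, for `none`, the part
behind the two ends of the triple) when `S` is contracted. -/
def piece : Option C.Dart → Set C.Dart
  | none => {x | x.1 ∉ S ∧ Conn X.outer X.v₀ (src x)}
  | some d => {x | x.1 ∉ S ∧ (x = d ∨ (d.1 ∈ S ∧ Conn X.outer (tgt d) (src x)))}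

/-- The darts at the inner vertices and `none`. -/
def nodes : Set (Option C.Dart) := {h | ∀ d ∈ h, X.IsNode d}

variable {X}

theorem linkConn_outer {u : C.V} (hu : ¬ X.Inner u) : LinkConn X.outer X.edges {w | Conn X.outer u w} := by
  have hS : X.outer ⊆ S \ {X.E₁.1} := fun e he =>
    ⟨he.1, fun h' => (X.outer_subset_diff he).2 (h' ▸ mem₁')⟩
  refine linkConn_of_isForest X.nodup (X.finite.subset X.outer_subset) (X.forest₁.mono hS)
    X.edges_disjoint_outer u fun w hw => ?_
  have hw' : ¬ X.Inner w := fun h => hu (X.eq_of_conn_inner hw h ▸ h)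
  exact X.link w (fun h => hw' (Or.inl h)) fun h => hw' (Or.inr h)

/-- An edge of `S` leaving the outer component of `u` ends at an inner vertex, so apart from the
triple it can only be `g`. The darts outside `S` at this component are therefore its contracted link
graph with the triple and the single vertex `g` deleted. -/
theorem piece_conn_of_root {u : C.V} {g : C.Dart} (hu : ¬ X.Inner u) (hg : g.1 ∈ S)
    (hr : ∀ d, X.IsNode d → d.1 ∈ S → Conn X.outer u (tgt d) → rev d = g) {P : Set C.Dart}
    (hP : ∀ x, x ∈ P ↔ x.1 ∉ S ∧ Conn X.outer u (src x)) :
    ∀ x ∈ P, ∀ y ∈ P, Relation.EqvGen (fun a b => a ∈ P ∧ b ∈ P ∧ PassAdj S ∅ a b) x y := by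
  have key : dartsAt X.outer X.edges {w | Conn X.outer u w} g = P := by
    ext x
    rw [hP]
    constructor
    · rintro ⟨h1, h2, h3, h4⟩
      refine ⟨fun hx => ?_, h1⟩
      have hin : X.Inner (tgt x) := by
        by_contra h
        exact h2 (X.mem_outer_iff.2 ⟨hx, fun hi => hu (X.eq_of_conn_inner h1 hi ▸ hi), h⟩)
      exact h4 (by simpa using hr (rev x) ⟨by simpa, h3⟩ hx (by simpa using h1))
    · rintro ⟨h1, h2⟩
      exact ⟨h2, fun h => h1 h.1, fun h => h1 (X.edges_subset h), fun h => h1 (h ▸ hg)⟩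
  intro x hx y hy
  have := linkConn_outer hu g x (key ▸ hx) y (key ▸ hy)
  rw [key] at this
  exact Relation.EqvGen.mono (fun a b h => ⟨h.1, h.2.1, h.2.2.mono X.outer_subset (empty_subset _)⟩)
    _ _ this

theorem piece_conn {h : Option C.Dart} (hh : h ∈ X.nodes) : ∀ x ∈ X.piece h, ∀ y ∈ X.piece h,
    Relation.EqvGen (fun a b => a ∈ X.piece h ∧ b ∈ X.piece h ∧ PassAdj S ∅ a b) x y := by
  match h, hh with
  | none, _ =>
    -- Only the triple leads from this component to the inner vertices. The dart `E₁` is a harmless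
    -- choice, since its edge is already deleted.
    exact piece_conn_of_root (u := X.v₀) (g := X.E₁) v₀_not_inner X.mem₁
      (fun d hd hdS hc => (not_conn_base d hd hdS hc).elim) fun x => Iff.rfl
  | some d, hd =>
    have hd : X.IsNode d := hd d rfl
    by_cases hdS : d.1 ∈ S
    · refine piece_conn_of_root (u := tgt d) (g := rev d) (tgt_not_inner hd hdS) hdS ?_ fun x => ?_
      · intro d' hd' hdS' hc
        by_contra hne
        exact not_conn_node hd hdS hd' hdS' (fun h => hne (by rw [h])) hc
      · refine and_congr_right fun hx => ⟨?_, fun h => Or.inr ⟨hdS, h⟩⟩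
        rintro (rfl | h)
        exacts [(hx hdS).elim, h.2]
    · have : ∀ x ∈ X.piece (some d), x = d := fun x hx => hx.2.resolve_right fun h => hdS h.1
      intro x hx y hy
      rw [this x hx, this y hy]
      exact .refl _

theorem piece_disjoint {h h' : Option C.Dart} (hh : h ∈ X.nodes) (hh' : h' ∈ X.nodes)
    (hne : h ≠ h') : Disjoint (X.piece h) (X.piece h') := by
  have aux : ∀ {u x d}, ¬ X.Inner u → Conn X.outer u (src x) → X.IsNode d → x ≠ d :=
    fun hu hc hd hxd => hu (X.eq_of_conn_inner hc (hxd ▸ hd.1) ▸ hxd ▸ hd.1)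
  rw [Set.disjoint_left]
  match h, hh, h', hh' with
  | none, _, none, _ => exact (hne rfl).elim
  | none, _, some d, hd =>
    have hd : X.IsNode d := hd d rfl
    rintro x ⟨-, hx⟩ ⟨-, rfl | ⟨hdS, hx'⟩⟩
    · exact aux v₀_not_inner hx hd rfl
    · exact not_conn_base d hd hdS (hx.trans hx'.symm)
  | some d, hd, none, _ =>
    have hd : X.IsNode d := hd d rfl
    rintro x ⟨-, rfl | ⟨hdS, hx'⟩⟩ ⟨-, hx⟩
    · exact aux v₀_not_inner hx hd rfl
    · exact not_conn_base d hd hdS (hx.trans hx'.symm)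
  | some d, hd, some d', hd' =>
    have hd : X.IsNode d := hd d rfl
    have hd' : X.IsNode d' := hd' d' rfl
    have hdd : d ≠ d' := fun h => hne (by rw [h])
    rintro x ⟨-, h1 | ⟨hdS, h1⟩⟩ ⟨-, h2 | ⟨hdS', h2⟩⟩
    · exact hdd (h1.symm.trans h2)
    · exact aux (tgt_not_inner hd' hdS') h2 hd h1
    · exact aux (tgt_not_inner hd hdS) h1 hd' h2
    · exact not_conn_node hd hdS hd' hdS' hdd (h1.trans h2.symm)

theorem conn_v₁_of_mem_piece {h : Option C.Dart} (hh : h ∈ X.nodes) {x : C.Dart}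
    (hx : x ∈ X.piece h) : x.1 ∉ S ∧ Conn S X.v₁ (src x) := by
  refine ⟨by cases h <;> exact hx.1, ?_⟩
  have h12 : Conn S X.v₁ X.v₂ := X.src₂ ▸ X.tgt₂ ▸ Conn.of_dart X.mem₂
  have h10 : Conn S X.v₁ X.v₀ := X.src₁ ▸ X.tgt₁ ▸ (Conn.of_dart X.mem₁).symm
  match h, hh with
  | none, _ => exact h10.trans (hx.2.mono X.outer_subset)
  | some d, hd =>
    have hs : Conn S X.v₁ (src d) := by
      rcases (hd d rfl).1 with h | h
      exacts [h ▸ Conn.refl _, h ▸ h12]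
    rcases hx.2 with rfl | ⟨hdS, h⟩
    · exact hs
    · exact (hs.trans (Conn.of_dart hdS)).trans (h.mono X.outer_subset)

variable (X)

/-- The pieces of two nodes are joined by an edge of the link graph. -/
def Touch (h h' : Option C.Dart) : Prop := ∃ x ∈ X.piece h, ∃ y ∈ X.piece h', PassAdj S ∅ x y

/-- A walk whose first dart outside `S` belongs to the piece of `h`. -/
def Enters (h : Option C.Dart) (p : List C.Dart) : Prop :=
  ∀ s y q, p = s ++ y :: q → (∀ d ∈ s, d.1 ∈ S) → y.1 ∉ S → y ∈ X.piece h

variable {X}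

theorem Touch.symm {h h' : Option C.Dart} (H : X.Touch h h') : X.Touch h' h := by
  obtain ⟨x, hx, y, hy, hxy⟩ := H
  exact ⟨y, hy, x, hx, hxy.symm⟩

/-- The last dart is exempt from `hp`: in the applications it is the reverse of a node, which may
lie in `S` but not in `outer`. It never precedes the first dart outside `S`. -/
theorem enters_none {p : List C.Dart} {u v : C.V} (hu : Conn X.outer X.v₀ u)
    (hp : ∀ d ∈ p.dropLast, d.1 ∈ S → d.1 ∈ X.outer) (hw : IsDartWalk src tgt p u v) :
    X.Enters none p := by
  rintro s y q rfl hs hy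
  obtain ⟨w, h1, h2⟩ := isDartWalk_append.1 hw
  refine ⟨hy, hu.trans (h2.1 ▸ Conn.of_walk h1 fun d hd => hp d ?_ (hs d hd))⟩
  rw [List.dropLast_append_cons]
  exact List.mem_append_left _ hd

theorem enters_some {p : List C.Dart} {d : C.Dart} {u v : C.V}
    (hp : ∀ d ∈ p.dropLast, d.1 ∈ S → d.1 ∈ X.outer) (hw : IsDartWalk src tgt (d :: p) u v) :
    X.Enters (some d) (d :: p) := by
  intro s y q hpq hs hy
  match s with
  | [] =>
    simp only [List.nil_append, List.cons.injEq] at hpq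
    exact ⟨hy, Or.inl hpq.1.symm⟩
  | d' :: s =>
    simp only [List.cons_append, List.cons.injEq] at hpq
    obtain ⟨rfl, rfl⟩ := hpq
    obtain ⟨w, h1, h2⟩ := isDartWalk_append.1 hw.2
    refine ⟨hy, Or.inr ⟨hs d (by simp), h2.1 ▸ Conn.of_walk h1 fun x hx =>
      hp x ?_ (hs x (by simp [hx]))⟩⟩
    rw [List.dropLast_append_cons]
    exact List.mem_append_left _ hx

/-- From the last dart of `p` outside `S` cyclically on to the first one, the face runs through `S`
only, so after contraction it passes directly between the two pieces. -/
theorem touch_of_enters {h h' : Option C.Dart} {p s : List C.Dart} (hw : IsFaceWord ∅ (p ++ s))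
    (hs : ∀ d ∈ s, d.1 ∈ S) (h1 : X.Enters h p) (h2 : X.Enters h' (revWalk p))
    (hp : ∃ d ∈ p, d.1 ∉ S) : X.Touch h' h := by
  obtain ⟨s1, y, t1, e1, hs1, hy⟩ := List.exists_first_not (P := fun d : C.Dart => d.1 ∈ S) hp
  obtain ⟨s2, x, t2, e2, hs2, hx⟩ := List.exists_first_not (l := revWalk p)
    (P := fun d : C.Dart => d.1 ∈ S) (by
      obtain ⟨d, hd, hdS⟩ := hp
      exact ⟨rev d, mem_revWalk.2 (by simpa), hdS⟩)
  refine ⟨x, h2 _ _ _ e2 hs2 hx, y, h1 _ _ _ e1 hs1 hy, ?_⟩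
  have e3 : p = revWalk t2 ++ rev x :: revWalk s2 := by
    rw [← revWalk_revWalk p, e2, ← List.singleton_append, ← List.append_assoc, revWalk_append,
      revWalk_append]
    simp [revWalk]
  have hs2' : ∀ d ∈ revWalk s2, d.1 ∈ S := fun d hd => hs2 (rev d) (mem_revWalk.1 hd)
  -- As `rev x` is not in `S`, it cannot occur in `s1`, before `y`.
  obtain ⟨a, ha⟩ : ∃ a, y :: t1 = a ++ rev x :: revWalk s2 := by
    rw [e1] at e3
    rcases List.append_eq_append_iff.1 e3 with ⟨a, ha1, ha2⟩ | ⟨a, ha1, ha2⟩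
    · exact ⟨a, ha2⟩
    · match a with
      | [] => exact ⟨[], by simpa using ha2.symm⟩
      | b :: a =>
        simp only [List.cons_append, List.cons.injEq] at ha2
        exact (hx (hs1 (rev x) (by rw [ha1, ha2.1]; simp))).elim
  obtain ⟨q, hq⟩ : ∃ q, a ++ [rev x] = y :: q := by
    match a with
    | [] => exact ⟨[], by simp only [List.nil_append, List.cons.injEq] at ha; simp [ha.1]⟩
    | b :: a =>
      simp only [List.cons_append, List.cons.injEq] at ha
      exact ⟨a ++ [rev x], by simp [ha.1]⟩
  refine ⟨a ++ [rev x], q, a, revWalk s2 ++ s ++ s1, hw.rotate ?_, ?_, hq, rfl⟩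
  · rw [e1, ha]
    have h1 : s1 ++ (a ++ rev x :: revWalk s2) ++ s =
        s1 ++ (a ++ [rev x] ++ (revWalk s2 ++ s)) := by simp
    have h2 : a ++ [rev x] ++ (revWalk s2 ++ s ++ s1) =
        a ++ [rev x] ++ (revWalk s2 ++ s) ++ s1 := by simp
    rw [h1, h2]
    exact List.isRotated_append
  · intro d hd
    simp only [List.mem_append] at hd
    rcases hd with (hd | hd) | hd
    exacts [hs2' d hd, hs d hd, hs1 d hd]

/-- The stretch `s` leaves room for an edge of the triple. The remaining darts cannot all lie in
`S`, since they would then connect the targets of `d` and `d'` in `outer`. -/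
theorem touch_corner {d d' : C.Dart} (hd : X.IsNode d) (hd' : X.IsNode d') (hdd : d ≠ d')
    {m s : List C.Dart} (hm : ∀ x ∈ m, x.1 ∈ S → x.1 ∈ X.outer) (hs : ∀ x ∈ s, x.1 ∈ S)
    (hw : IsFaceWord ∅ (d' :: m ++ [rev d] ++ s)) : X.Touch (some d) (some d') := by
  obtain ⟨v, hv⟩ := hw.exists_isDartWalk
  obtain ⟨w, hv, -⟩ := isDartWalk_append.1 hv
  have hrev : revWalk (d' :: m ++ [rev d]) = d :: revWalk m ++ [rev d'] := by
    simp [revWalk]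
  have hm' : ∀ x ∈ revWalk m, x.1 ∈ S → x.1 ∈ X.outer := fun x hx =>
    hm (rev x) (mem_revWalk.1 hx)
  refine touch_of_enters hw hs (enters_some (by simpa using hm) hv) ?_ ?_
  · have := isDartWalk_revWalk hv
    rw [hrev] at this ⊢
    exact enters_some (by simpa using hm') this
  · by_contra! hall
    have hdS : d.1 ∈ S := hall (rev d) (by simp)
    have hdS' : d'.1 ∈ S := hall d' (by simp)
    refine not_conn_node hd hdS hd' hdS' hdd (Conn.symm ?_)
    obtain ⟨u, h1, h2⟩ := isDartWalk_append.1 hv.2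
    have : tgt d = u := by rw [← src_rev]; exact h2.1
    rw [this]
    exact Conn.of_walk h1 fun x hx => hm x hx (hall x (by simp [hx]))

theorem touch_base {d : C.Dart} (hd : X.IsNode d) {m s : List C.Dart} {u v : C.V}
    (hu : Conn X.outer X.v₀ u) (hv : IsDartWalk src tgt (m ++ [rev d]) u v)
    (hm : ∀ x ∈ m, x.1 ∈ S → x.1 ∈ X.outer) (hs : ∀ x ∈ s, x.1 ∈ S)
    (hw : IsFaceWord ∅ (m ++ [rev d] ++ s)) : X.Touch (some d) none := by
  have hm' : ∀ x ∈ revWalk m, x.1 ∈ S → x.1 ∈ X.outer := fun x hx =>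
    hm (rev x) (mem_revWalk.1 hx)
  refine touch_of_enters hw hs (enters_none hu (by simpa using hm) hv) ?_ ?_
  · have := isDartWalk_revWalk hv
    rw [revWalk_append, revWalk_singleton, rev_rev] at this ⊢
    exact enters_some (fun x hx => hm' x (List.dropLast_subset _ hx)) this
  · by_contra! hall
    have hdS : d.1 ∈ S := hall (rev d) (by simp)
    refine not_conn_base d hd hdS (hu.trans ?_)
    obtain ⟨w, h1, h2⟩ := isDartWalk_append.1 hv
    have : tgt d = w := by rw [← src_rev]; exact h2.1
    rw [this]
    exact Conn.of_walk h1 fun x hx => hm x hx (hall x (by simp [hx]))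

/-- A minor of the graph on the nodes whose branch sets are stars is a minor of the link graph. -/
theorem hasLinkMinor {W : Type*} {H : SimpleGraph W} (lab : Option C.Dart → W)
    (c : W → Option C.Dart) (hc : ∀ w, c w ∈ X.nodes) (hlab : ∀ w, lab (c w) = w)
    (hstar : ∀ h ∈ X.nodes, h ≠ c (lab h) → X.Touch h (c (lab h)))
    (hadj : ∀ w w', H.Adj w w' → ∃ h ∈ X.nodes, ∃ h' ∈ X.nodes, lab h = w ∧ lab h' = w' ∧
      X.Touch h h') (hne : ∀ w, ∃ w', H.Adj w w') : HasLinkMinor S X.v₁ H := by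
  have hadj' : ∀ w w', H.Adj w w' → ∃ x ∈ {x | ∃ h ∈ X.nodes, lab h = w ∧ x ∈ X.piece h},
      ∃ y ∈ {x | ∃ h ∈ X.nodes, lab h = w' ∧ x ∈ X.piece h}, PassAdj S ∅ x y := by
    intro w w' hww
    obtain ⟨h, hh, h', hh', rfl, rfl, x, hx, y, hy, hxy⟩ := hadj w w' hww
    exact ⟨x, ⟨h, hh, rfl, hx⟩, y, ⟨h', hh', rfl, hy⟩, hxy⟩
  refine ⟨fun w => {x | ∃ h ∈ X.nodes, lab h = w ∧ x ∈ X.piece h}, ?_, ?_, ?_, ?_, hadj'⟩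
  · intro w
    obtain ⟨w', hw⟩ := hne w
    obtain ⟨x, hx, -⟩ := hadj' w w' hw
    exact ⟨x, hx⟩
  · rintro w x ⟨h, hh, -, hx⟩
    exact conn_v₁_of_mem_piece hh hx
  · intro w
    set P := {x | ∃ h ∈ X.nodes, lab h = w ∧ x ∈ X.piece h} with hP
    set R := Relation.EqvGen (fun a b => a ∈ P ∧ b ∈ P ∧ PassAdj S ∅ a b) with hR
    have inner : ∀ h ∈ X.nodes, lab h = w → ∀ x ∈ X.piece h, ∀ y ∈ X.piece h, R x y :=
      fun h hh hw x hx y hy => Relation.EqvGen.mono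
        (fun a b k => ⟨⟨h, hh, hw, k.1⟩, ⟨h, hh, hw, k.2.1⟩, k.2.2⟩) _ _ (piece_conn hh x hx y hy)
    have toCenter : ∀ x ∈ P, ∃ y ∈ X.piece (c w), R x y := by
      rintro x ⟨h, hh, hw, hx⟩
      by_cases hcw : h = c w
      · exact ⟨x, hcw ▸ hx, .refl _⟩
      · obtain ⟨z, hz, y, hy, hzy⟩ := hstar h hh (hw ▸ hcw)
        rw [hw] at hy
        exact ⟨y, hy, .trans _ _ _ (inner h hh hw x hx z hz)
          (.rel _ _ ⟨⟨h, hh, hw, hz⟩, ⟨c w, hc w, hlab w, hy⟩, hzy⟩)⟩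
    intro x hx y hy
    obtain ⟨x', hx', hxx⟩ := toCenter x hx
    obtain ⟨y', hy', hyy⟩ := toCenter y hy
    exact .trans _ _ _ hxx (.trans _ _ _ (inner _ (hc w) (hlab w) x' hx' y' hy') (.symm _ _ hyy))
  · intro w w' hww
    rw [Set.disjoint_left]
    rintro x ⟨h, hh, hw, hx⟩ ⟨h', hh', hw', hx'⟩
    have hne : h ≠ h' := fun e => hww (by rw [← hw, ← hw', e])
    exact Set.disjoint_left.1 (piece_disjoint hh hh' hne) hx hx'

end TripleConfig

end TwoComplex

/-! ### Signed coordinate directions -/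

/-- A coordinate direction with a sign. -/
abbrev Direction : Type := Fin 3 × Bool

namespace Direction

/-- The signed unit vector of a direction. -/
def vec (α : Direction) : Fin 3 → ℤ := Pi.single α.1 (cond α.2 1 (-1))

/-- The opposite direction. -/
def neg (α : Direction) : Direction := (α.1, !α.2)

@[simp] theorem neg_fst (α : Direction) : α.neg.1 = α.1 := rfl

@[simp] theorem vec_neg (α : Direction) : α.neg.vec = -α.vec := by
  obtain ⟨i, b⟩ := α
  cases b <;> simp [vec, neg, Pi.single_neg]

theorem vec_self (α : Direction) : α.vec α.1 = 1 ∨ α.vec α.1 = -1 := by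
  obtain ⟨i, b⟩ := α
  cases b <;> simp [vec]

theorem vec_self_ne (α : Direction) : α.vec α.1 ≠ 0 := by
  rcases α.vec_self with h | h <;> rw [h] <;> decide

theorem vec_of_ne {α : Direction} {i : Fin 3} (h : i ≠ α.1) : α.vec i = 0 := by
  simp [vec, h]

theorem vec_true (i : Fin 3) : vec (i, true) = unitVec i := rfl

theorem vec_false (i : Fin 3) : vec (i, false) = -unitVec i := by
  simp [vec, unitVec, Pi.single_neg]

theorem vec_injective : Function.Injective vec := by
  intro α β h
  have h1 : α.1 = β.1 := by
    by_contra hne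
    have := congrFun h α.1
    rw [vec_of_ne hne] at this
    exact α.vec_self_ne this
  obtain ⟨i, b⟩ := α
  obtain ⟨j, c⟩ := β
  obtain rfl : i = j := h1
  have := congrFun h i
  cases b <;> cases c <;> simp [vec] at this ⊢

theorem eq_or_eq_neg {α β : Direction} (h : α.1 = β.1) : α = β ∨ α = β.neg := by
  obtain ⟨i, b⟩ := α
  obtain ⟨j, c⟩ := β
  obtain rfl : i = j := h
  cases b <;> cases c <;> simp [neg]

theorem neg_ne (α : Direction) : α.neg ≠ α := by
  obtain ⟨i, b⟩ := α
  cases b <;> simp [neg]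

theorem vec_bound (α : Direction) (i : Fin 3) : -1 ≤ α.vec i ∧ α.vec i ≤ 1 := by
  by_cases h : i = α.1
  · subst h
    rcases α.vec_self with h | h <;> rw [h] <;> decide
  · rw [vec_of_ne h]; decide

theorem vec_add_bound {α β : Direction} (h : α.1 ≠ β.1) (i : Fin 3) :
    -1 ≤ (α.vec + β.vec) i ∧ (α.vec + β.vec) i ≤ 1 := by
  rw [Pi.add_apply]
  by_cases hi : i = α.1
  · rw [vec_of_ne (α := β) (by rw [hi]; exact h), add_zero]
    exact α.vec_bound i
  · rw [vec_of_ne hi, zero_add]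
    exact β.vec_bound i

theorem vec_add_self {α β : Direction} (h : α.1 ≠ β.1) :
    (α.vec + β.vec) α.1 = α.vec α.1 := by
  rw [Pi.add_apply, vec_of_ne (α := β) h, add_zero]

theorem vec_add_ne_vec {α β γ : Direction} (h : α.1 ≠ β.1) : α.vec + β.vec ≠ γ.vec := by
  intro he
  have h1 := congrFun he α.1
  rw [vec_add_self h] at h1
  have h2 := congrFun he β.1
  rw [add_comm, vec_add_self h.symm] at h2
  by_cases hγ : α.1 = γ.1
  · exact β.vec_self_ne (h2.trans (vec_of_ne (by rw [← hγ]; exact h.symm)))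
  · exact α.vec_self_ne (h1.trans (vec_of_ne hγ))

theorem vec_ne_zero (α : Direction) : α.vec ≠ 0 := fun h => α.vec_self_ne (congrFun h _)

theorem vec_add_ne_zero {α β : Direction} (h : α.1 ≠ β.1) : α.vec + β.vec ≠ 0 := fun he => by
  have h1 := congrFun he α.1
  rw [vec_add_self h] at h1
  exact α.vec_self_ne h1

theorem vec_add_left_inj {α β γ : Direction} : α.vec + β.vec = α.vec + γ.vec ↔ β = γ := by
  rw [add_right_inj, vec_injective.eq_iff]

theorem exists_third (i j : Fin 3) : ∃ k, k ≠ i ∧ k ≠ j := by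
  revert i j; decide

/-- The graph of directions with a direction or a pair of directions `τ` deleted, and with a
further pair of directions `κ` disconnected, is connected. -/
theorem eqvGen_of_deleted {A : Set Direction} (hA : ∀ i, ∃ α ∈ A, α.1 = i) (τ κ : Fin 3 → ℤ)
    (hκ : ∀ α β : Direction, α.1 ≠ β.1 → α.vec + β.vec = κ → ∀ γ : Direction, γ.1 ≠ α.1 →
      γ.1 ≠ β.1 → γ ∈ A) {α β : Direction} (hα : α ∈ A) (hβ : β ∈ A) (hατ : α.vec ≠ τ)
    (hβτ : β.vec ≠ τ) :
    Relation.EqvGen (fun α β => α ∈ A ∧ β ∈ A ∧ α.vec ≠ τ ∧ β.vec ≠ τ ∧ α.1 ≠ β.1 ∧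
      α.vec + β.vec ≠ κ ∧ α.vec + β.vec ≠ τ) α β := by
  set R := Relation.EqvGen (fun α β : Direction => α ∈ A ∧ β ∈ A ∧ α.vec ≠ τ ∧ β.vec ≠ τ ∧
    α.1 ≠ β.1 ∧ α.vec + β.vec ≠ κ ∧ α.vec + β.vec ≠ τ) with hR
  have tr : ∀ {a b c}, R a b → R b c → R a c := fun h h' => .trans _ _ _ h h'
  have single : ∀ {a b : Direction}, a ∈ A → b ∈ A → a.vec ≠ τ → b.vec ≠ τ → a.1 ≠ b.1 →
      a.vec + b.vec ≠ κ → a.vec + b.vec ≠ τ → R a b :=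
    fun h1 h2 h3 h4 h5 h6 h7 => .rel _ _ ⟨h1, h2, h3, h4, h5, h6, h7⟩
  -- Here the pair `a`, `b` is deleted and the pair `a`, `c` is disconnected; the detour is `a`,
  -- `-b`, `c`, `b`, where `-b` is available by `hκ`.
  have viaThird : ∀ {a b c : Direction}, a ∈ A → b ∈ A → c ∈ A → a.vec ≠ τ → b.vec ≠ τ →
      a.1 ≠ b.1 → c.1 ≠ a.1 → c.1 ≠ b.1 → a.vec + b.vec = τ → a.vec + c.vec = κ → R a b := by
    intro a b c ha hb hc haτ hbτ hab hca hcb hτ hk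
    have hb' : b.neg ∈ A := hκ a c hca.symm hk _ hab.symm hcb.symm
    have hb'τ : b.neg.vec ≠ τ := fun h => vec_add_ne_vec hab (hτ.trans h.symm)
    have hcτ : c.vec ≠ τ := fun h => vec_add_ne_vec hab (hτ.trans h.symm)
    have e1 : R a b.neg := single ha hb' haτ hb'τ hab
      (fun h => hcb (by rw [vec_add_left_inj.1 (hk.trans h.symm)]; rfl))
      (fun h => b.neg_ne (vec_add_left_inj.1 (h.trans hτ.symm)))
    have e2 : R b.neg c := by
      refine single hb' hc hb'τ hcτ hcb.symm (fun h => ?_) fun h => ?_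
      · rw [add_comm] at h hk
        exact hab (congrArg Prod.fst (vec_add_left_inj.1 (h.trans hk.symm))).symm
      · have := congrFun (h.trans hτ.symm) a.1
        rw [vec_add_self hab, Pi.add_apply, vec_of_ne (α := b.neg) hab, vec_of_ne hca.symm] at this
        exact a.vec_self_ne (by simpa using this.symm)
    have e3 : R c b := by
      refine single hc hb hcτ hbτ hcb (fun h => ?_) fun h => ?_
      · rw [add_comm] at hk
        exact hab (congrArg Prod.fst (vec_add_left_inj.1 (h.trans hk.symm))).symm
      · rw [add_comm] at h hτ
        exact hca (congrArg Prod.fst (vec_add_left_inj.1 (h.trans hτ.symm)))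
    exact tr e1 (tr e2 e3)
  have diff : ∀ {a b : Direction}, a ∈ A → b ∈ A → a.vec ≠ τ → b.vec ≠ τ → a.1 ≠ b.1 → R a b := by
    intro a b ha hb haτ hbτ hab
    obtain ⟨k, hka, hkb⟩ := exists_third a.1 b.1
    by_cases hk : a.vec + b.vec = κ
    -- Both directions of the third axis are available. One whose sign differs from `τ k` is neither
    -- `τ` nor part of a pair with sum `τ`.
    · have key : ∀ c : Direction, c.1 = k → c.vec k ≠ τ k → R a b := by
        rintro c rfl hc
        have hcA : c ∈ A := hκ a b hab hk c hka hkb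
        have hcτ : c.vec ≠ τ := fun h => hc (congrFun h _)
        have e1 : R a c := by
          refine single ha hcA haτ hcτ hka.symm (fun h => ?_) fun h => hc ?_
          · exact hkb (congrArg Prod.fst (vec_add_left_inj.1 (h.trans hk.symm)))
          · rw [← h, Pi.add_apply, vec_of_ne hka, zero_add]
        have e2 : R c b := by
          refine single hcA hb hcτ hbτ hkb (fun h => ?_) fun h => hc ?_
          · rw [add_comm] at h hk
            exact hka (congrArg Prod.fst (vec_add_left_inj.1 (h.trans hk.symm)))
          · rw [← h, vec_add_self hkb]
        exact tr e1 e2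
      by_cases h1 : vec (k, true) k = τ k
      · refine key (k, false) rfl ?_
        rw [← h1]
        simp [vec]
      · exact key (k, true) rfl h1
    by_cases hτ : a.vec + b.vec = τ
    · obtain ⟨c, hc, rfl⟩ := hA k
      by_cases h1 : a.vec + c.vec = κ
      · exact viaThird ha hb hc haτ hbτ hab hka hkb hτ h1
      by_cases h2 : b.vec + c.vec = κ
      · exact .symm _ _ (viaThird hb ha hc hbτ haτ hab.symm hkb hka (by rwa [add_comm]) h2)
      have hcτ : c.vec ≠ τ := fun h => vec_add_ne_vec hab (hτ.trans h.symm)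
      refine tr (single ha hc haτ hcτ hka.symm h1 fun h => ?_)
        (single hc hb hcτ hbτ hkb (by rwa [add_comm]) fun h => ?_)
      · exact hkb (congrArg Prod.fst (vec_add_left_inj.1 (h.trans hτ.symm)))
      · rw [add_comm] at h hτ
        exact hka (congrArg Prod.fst (vec_add_left_inj.1 (h.trans hτ.symm)))
    exact single ha hb haτ hbτ hab hk hτ
  -- Directions on the same axis are joined through a direction on one of the two other axes; `τ`
  -- deletes at most one such direction.
  by_cases hab : α.1 = β.1
  · obtain ⟨c, hc, hcα, hcτ⟩ : ∃ c ∈ A, c.1 ≠ α.1 ∧ c.vec ≠ τ := by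
      obtain ⟨j, hj, -⟩ := exists_third α.1 α.1
      obtain ⟨k, hk, hkj⟩ := exists_third α.1 j
      obtain ⟨b, hb, rfl⟩ := hA j
      obtain ⟨c, hc, rfl⟩ := hA k
      by_cases h : b.vec = τ
      · refine ⟨c, hc, hk, fun h' => hkj ?_⟩
        rw [vec_injective (h'.trans h.symm)]
      · exact ⟨b, hb, hj, h⟩
    exact tr (diff hα hc hατ hcτ hcα.symm) (diff hc hβ hcτ hβτ (hab ▸ hcα))
  · exact diff hα hβ hατ hβτ hab

end Direction

theorem mem_cuboidPoints {N : Fin 3 → ℕ} {p : Fin 3 → ℤ} :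
    p ∈ cuboidPoints N ↔ ∀ i, 0 ≤ p i ∧ p i ≤ N i :=
  ⟨fun h i => ⟨h.1 i, h.2 i⟩, fun h => ⟨fun i => (h i).1, fun i => (h i).2⟩⟩

theorem add_vec_add_vec_mem {N : Fin 3 → ℕ} {p : Fin 3 → ℤ} {α β : Direction} (hαβ : α.1 ≠ β.1)
    (h : p + α.vec ∈ cuboidPoints N) (h' : p + β.vec ∈ cuboidPoints N) :
    p + α.vec + β.vec ∈ cuboidPoints N := by
  rw [mem_cuboidPoints] at *
  intro i
  by_cases hi : i = α.1
  · have := h i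
    rwa [Pi.add_apply, Direction.vec_of_ne (α := β) (by rw [hi]; exact hαβ), add_zero]
  · have := h' i
    rwa [add_right_comm, Pi.add_apply, Direction.vec_of_ne hi, add_zero]

theorem IsDartWalk.map_comp_append {V A W : Type*} {src tgt : A → V} {l : List A} {u v : V}
    (h : IsDartWalk src tgt l u v) (g : V → W) :
    l.map (fun d => g (src d)) ++ [g v] = g u :: l.map (fun d => g (tgt d)) := by
  simpa [Function.comp_def] using congrArg (List.map g) h.map_src_append

/-! ### Edges and faces of the subdivided cuboid in coordinates -/

namespace Subdivided

open TwoComplex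

variable {N : Fin 3 → ℕ} {D : CuboidSquare N → Option Diagonal}

/-- The coordinates of the first vertex of a dart. -/
def psrc (d : (subdividedCuboid N D).Dart) : Fin 3 → ℤ :=
  (show cuboidPoints N from src d).1

/-- The coordinates of the last vertex of a dart. -/
def ptgt (d : (subdividedCuboid N D).Dart) : Fin 3 → ℤ :=
  (show cuboidPoints N from tgt d).1

theorem psrc_rev (d : (subdividedCuboid N D).Dart) : psrc (rev d) = ptgt d := by
  unfold psrc ptgt; rw [src_rev]

theorem ptgt_rev (d : (subdividedCuboid N D).Dart) : ptgt (rev d) = psrc d := by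
  unfold psrc ptgt; rw [tgt_rev]

theorem src_eq_iff {d : (subdividedCuboid N D).Dart} {v : cuboidPoints N} :
    src d = v ↔ psrc d = v.1 := Subtype.ext_iff

theorem tgt_eq_iff {d : (subdividedCuboid N D).Dart} {v : cuboidPoints N} :
    tgt d = v ↔ ptgt d = v.1 := Subtype.ext_iff

theorem psrc_mem (d : (subdividedCuboid N D).Dart) : psrc d ∈ cuboidPoints N :=
  (show cuboidPoints N from src d).2

theorem ptgt_mem (d : (subdividedCuboid N D).Dart) : ptgt d ∈ cuboidPoints N :=
  (show cuboidPoints N from tgt d).2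

/-- Twice the midpoint of an edge. -/
def mid : (subdividedCuboid N D).E → Fin 3 → ℤ
  | Sum.inl e => e.1.1 + e.1.1 + unitVec e.1.2
  | Sum.inr s => s.1.1.1 + s.1.1.1 + (unitVec s.1.1.2.1 + unitVec s.1.1.2.2)

theorem psrc_add_ptgt (d : (subdividedCuboid N D).Dart) : psrc d + ptgt d = mid d.1 := by
  have key : ∀ e : (subdividedCuboid N D).E, psrc (e, true) + ptgt (e, true) = mid e := by
    rintro (e | ⟨s, hs⟩)
    · exact (add_assoc _ _ _).symm
    · have hst : psrc (D := D) (Sum.inr ⟨s, hs⟩, true) = (((D s).get hs).start s).1 := rfl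
      have hft : ptgt (D := D) (Sum.inr ⟨s, hs⟩, true) = (((D s).get hs).finish s).1 := rfl
      rw [hst, hft]
      cases (D s).get hs
      · change s.1.1 + (s.1.1 + _ + _) = s.1.1 + s.1.1 + _
        abel
      · change (s.1.1 + _) + (s.1.1 + _) = s.1.1 + s.1.1 + _
        abel
  obtain ⟨e, b⟩ := d
  cases b
  · rw [add_comm]; exact key e
  · exact key e

theorem unitVec_self (i : Fin 3) : unitVec i i = 1 := Pi.single_eq_same _ _

theorem unitVec_of_ne {i j : Fin 3} (h : j ≠ i) : unitVec i j = 0 := Pi.single_eq_of_ne h _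

theorem unitVec_cases (i j : Fin 3) : (j = i ∧ unitVec i j = 1) ∨ (j ≠ i ∧ unitVec i j = 0) := by
  by_cases h : j = i
  · exact Or.inl ⟨h, h ▸ unitVec_self _⟩
  · exact Or.inr ⟨h, unitVec_of_ne h⟩

/-- The parities of the coordinates of `mid e` show in which coordinate directions `e` extends, and
then the base point is determined. The two diagonals of a square have the same midpoint, but at most
one of them is an edge. -/
theorem mid_injective : Function.Injective (mid (N := N) (D := D)) := by
  have par : ∀ {p q : Fin 3 → ℤ} {a b : Fin 3 → ℤ}, p + p + a = q + q + b →
      (∀ i, 0 ≤ a i ∧ a i ≤ 1) → (∀ i, 0 ≤ b i ∧ b i ≤ 1) → p = q ∧ a = b := by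
    intro p q a b h ha hb
    have key : ∀ i, p i = q i ∧ a i = b i := by
      intro i
      have := congrFun h i
      simp only [Pi.add_apply] at this
      have := ha i
      have := hb i
      omega
    exact ⟨funext fun i => (key i).1, funext fun i => (key i).2⟩
  have b1 : ∀ i j, 0 ≤ unitVec i j ∧ unitVec i j ≤ 1 := fun i j => by
    rcases unitVec_cases i j with h | h <;> rw [h.2] <;> decide
  have b2 : ∀ {i i' : Fin 3}, i < i' → ∀ j, 0 ≤ (unitVec i + unitVec i') j ∧
      (unitVec i + unitVec i') j ≤ 1 := fun {i i'} hi j => by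
    rw [Pi.add_apply]
    rcases unitVec_cases i j with h | h <;> rcases unitVec_cases i' j with k | k <;>
      rw [h.2, k.2] <;> first | decide | exact (hi.ne (h.1.symm.trans k.1)).elim
  have inj1 : ∀ {i i'}, unitVec i = unitVec i' → i = i' := fun {i i'} h => by
    by_contra hne
    have := congrFun h i
    rw [unitVec_self, unitVec_of_ne hne] at this
    exact one_ne_zero this
  have ne12 : ∀ {i j j' : Fin 3}, j < j' → unitVec i ≠ unitVec j + unitVec j' := by
    intro i j j' hj h
    have h1 := congrFun h j
    have h2 := congrFun h j'
    rw [Pi.add_apply, unitVec_self, unitVec_of_ne hj.ne, add_zero] at h1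
    rw [Pi.add_apply, unitVec_self, unitVec_of_ne hj.ne', zero_add] at h2
    rcases unitVec_cases i j with h | h
    · rcases unitVec_cases i j' with k | k
      · exact hj.ne (h.1.trans k.1.symm)
      · rw [k.2] at h2; exact zero_ne_one h2
    · rw [h.2] at h1; exact zero_ne_one h1
  have inj2 : ∀ {i i' j j' : Fin 3}, i < i' → j < j' →
      unitVec i + unitVec i' = unitVec j + unitVec j' → i = j ∧ i' = j' := by
    intro i i' j j' hi hj h
    have key : ∀ k, k = i ∨ k = i' ↔ k = j ∨ k = j' := by
      intro k
      have hk := congrFun h k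
      rw [Pi.add_apply, Pi.add_apply] at hk
      have h1 := b2 hi k
      have h2 := b2 hj k
      rw [Pi.add_apply] at h1 h2
      rcases unitVec_cases i k with a | a <;> rcases unitVec_cases i' k with b | b <;>
        rcases unitVec_cases j k with c | c <;> rcases unitVec_cases j' k with d | d <;>
        rw [a.2, b.2, c.2, d.2] at hk <;> simp [a.1, b.1, c.1, d.1] <;> omega
    have h1 := (key i).1 (Or.inl rfl)
    have h2 := (key i').1 (Or.inr rfl)
    have h3 := (key j).2 (Or.inl rfl)
    omega
  rintro (⟨⟨p, i⟩, e⟩ | ⟨⟨⟨p, i, i'⟩, s⟩, hs⟩) (⟨⟨q, j⟩, e'⟩ | ⟨⟨⟨q, j, j'⟩, s'⟩, hs'⟩) h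
  · obtain ⟨h1, h2⟩ := par (p := p) (q := q) h (b1 i) (b1 j)
    obtain rfl := h1
    obtain rfl := inj1 h2
    rfl
  · exact (ne12 s'.1 (par (p := p) (q := q) h (b1 i) (b2 s'.1)).2).elim
  · exact (ne12 s.1 (par (p := p) (q := q) h (b2 s.1) (b1 j)).2.symm).elim
  · obtain ⟨h1, h2⟩ := par (p := p) (q := q) h (b2 s.1) (b2 s'.1)
    obtain rfl := h1
    obtain ⟨h3, h4⟩ := inj2 s.1 s'.1 h2
    have h3 : i = j := h3
    have h4 : i' = j' := h4
    subst h3 h4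
    rfl

theorem psrc_ne_ptgt (d : (subdividedCuboid N D).Dart) : psrc d ≠ ptgt d := by
  intro h
  have key := psrc_add_ptgt d
  rw [← h] at key
  obtain ⟨e, b⟩ := d
  rcases e with e | s
  · have := congrFun key e.1.2
    simp only [mid, Pi.add_apply, unitVec_self] at this
    omega
  · have := congrFun key s.1.1.2.1
    simp only [mid, Pi.add_apply, unitVec_self, unitVec_of_ne s.1.2.1.ne] at this
    omega

/-- A dart is determined by its two ends. -/
theorem dart_ext {d d' : (subdividedCuboid N D).Dart} (h : psrc d = psrc d') (h' : ptgt d = ptgt d') :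
    d = d' := by
  have : d.1 = d'.1 := mid_injective (by rw [← psrc_add_ptgt, ← psrc_add_ptgt, h, h'])
  rcases eq_or_eq_rev this with h1 | h1
  · exact h1
  · rw [h1, psrc_rev] at h
    exact (psrc_ne_ptgt d' h.symm).elim

/-! ### Faces -/

/-- Some face without edges in `B` has the given cyclic sequence of vertices. -/
def FaceThrough (B : Set (subdividedCuboid N D).E) (us : List (Fin 3 → ℤ)) : Prop :=
  ∃ w, IsFaceWord B w ∧ w.map psrc = us

theorem FaceThrough.rotate {B : Set (subdividedCuboid N D).E} {us : List (Fin 3 → ℤ)}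
    (h : FaceThrough B us) (n : ℕ) : FaceThrough B (us.rotate n) := by
  obtain ⟨w, hw, rfl⟩ := h
  exact ⟨w.rotate n, hw.rotate ⟨n, rfl⟩, by rw [List.map_rotate]⟩

theorem FaceThrough.reverse {B : Set (subdividedCuboid N D).E} {us : List (Fin 3 → ℤ)}
    (h : FaceThrough B us) : FaceThrough B (us.rotate 1).reverse := by
  obtain ⟨w, hw, rfl⟩ := h
  refine ⟨revWalk w, hw.reverse, ?_⟩
  obtain ⟨v, hv⟩ := hw.exists_isDartWalk
  match w with
  | [] => rfl
  | d :: w =>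
    have h1 := hv.map_comp_append fun u => (show cuboidPoints N from u).1
    have hd : psrc d = (show cuboidPoints N from v).1 := congrArg Subtype.val hv.1
    have h2 : (d :: w).map ptgt = w.map psrc ++ [psrc d] := by
      rw [hd]
      exact (List.cons.inj h1).2.symm
    rw [List.map_cons, List.rotate_cons_succ, List.rotate_zero, ← h2, revWalk, List.map_reverse,
      List.map_map]
    congr 2
    funext d
    exact psrc_rev d

/-- The faces of a square with corners `a`, `b`, `c`, `d`. -/
def SquareFaces (B : Set (subdividedCuboid N D).E) (a b c d : Fin 3 → ℤ) : Prop :=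
  (FaceThrough B [a, b, c, d] ∧
    ∀ e : (subdividedCuboid N D).E, mid e ≠ a + c ∧ mid e ≠ b + d) ∨
  (FaceThrough B [a, b, c] ∧ FaceThrough B [a, c, d] ∧
    ∃ x : (subdividedCuboid N D).Dart, psrc x = a ∧ ptgt x = c) ∨
  (FaceThrough B [b, a, d] ∧ FaceThrough B [b, c, d] ∧
    ∃ x : (subdividedCuboid N D).Dart, psrc x = b ∧ ptgt x = d)

theorem SquareFaces.rotate {B : Set (subdividedCuboid N D).E} {a b c d : Fin 3 → ℤ}
    (h : SquareFaces B a b c d) : SquareFaces B b c d a := by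
  rcases h with ⟨h, h'⟩ | ⟨h, h', x, hx, hx'⟩ | ⟨h, h', h''⟩
  · exact Or.inl ⟨h.rotate 1, fun e => ⟨(h' e).2, by rw [add_comm]; exact (h' e).1⟩⟩
  · exact Or.inr (Or.inr ⟨h.reverse.rotate 1, h'.rotate 1, rev x, by rwa [psrc_rev],
      by rwa [ptgt_rev]⟩)
  · exact Or.inr (Or.inl ⟨h', h.reverse, h''⟩)

theorem SquareFaces.reflect {B : Set (subdividedCuboid N D).E} {a b c d : Fin 3 → ℤ}
    (h : SquareFaces B a b c d) : SquareFaces B a d c b := by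
  rcases h with ⟨h, h'⟩ | ⟨h, h', h''⟩ | ⟨h, h', x, hx, hx'⟩
  · exact Or.inl ⟨h.reverse, fun e => ⟨(h' e).1, by rw [add_comm]; exact (h' e).2⟩⟩
  · exact Or.inr (Or.inl ⟨h'.reverse, h.reverse, h''⟩)
  · exact Or.inr (Or.inr ⟨h.reverse.rotate 1, h'.reverse.rotate 1, rev x, by rwa [psrc_rev],
      by rwa [ptgt_rev]⟩)

/-- The edges in `B` are diagonal edges. -/
def IsDiagonalSet (B : Set (subdividedCuboid N D).E) : Prop := ∀ e ∈ B, ∃ s, e = Sum.inr s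

theorem mem_triangleBdry {E : Type} {a : CuboidEdge N → E} {s : CuboidSquare N} {d : E}
    {δ : Diagonal} {b : Bool} {x : E × Bool} (hx : x ∈ triangleBdry a s d δ b) :
    (∃ e, x.1 = a e) ∨ x.1 = d := by
  cases δ <;> cases b <;>
    simp only [triangleBdry, List.mem_cons, List.not_mem_nil, or_false] at hx <;>
    rcases hx with rfl | rfl | rfl <;> simp

theorem squareFaces_of_square {B : Set (subdividedCuboid N D).E} (hB : IsDiagonalSet B)
    (s : CuboidSquare N) (hs : ∀ h, (Sum.inr ⟨s, h⟩ : (subdividedCuboid N D).E) ∉ B) :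
    SquareFaces B s.c00.1 s.c10.1 s.c11.1 s.c01.1 := by
  have hl : ∀ e : CuboidEdge N, (Sum.inl e : (subdividedCuboid N D).E) ∉ B := fun e he => by
    obtain ⟨s, hs⟩ := hB _ he
    cases hs
  cases h : D s with
  | none =>
    have hmid : ∀ e : (subdividedCuboid N D).E, mid e ≠ s.1.1 + s.c11.1 := by
      intro e he
      have he' : mid e = s.1.1 + s.1.1 + (unitVec s.1.2.1 + unitVec s.1.2.2) := by
        rw [he]
        change s.1.1 + (s.1.1 + unitVec s.1.2.1 + unitVec s.1.2.2) = _
        abel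
      -- Compare with the complex in which every square is subdivided: there this midpoint belongs
      -- to the diagonal of `s`, so an edge of the present complex with this midpoint would be a
      -- diagonal of `s`, which has none.
      have hinj := mid_injective (N := N) (D := fun _ => some .main)
      rcases e with e | s'
      · have := hinj (a₁ := Sum.inl e) (a₂ := Sum.inr ⟨s, rfl⟩) he'
        cases this
      · have h1 := hinj (a₁ := Sum.inr ⟨s'.1, rfl⟩) (a₂ := Sum.inr ⟨s, rfl⟩) he'
        have h2 : s'.1 = s := congrArg Subtype.val (Sum.inr_injective h1)
        have h3 := s'.2
        rw [h2, h] at h3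
        exact Bool.false_ne_true h3
    refine Or.inl ⟨⟨_, ⟨Sum.inl ⟨s, h⟩, ?_, Or.inl (List.IsRotated.refl _)⟩, ?_⟩, fun e =>
      ⟨hmid e, fun h' => hmid e (h'.trans ?_)⟩⟩
    · have : ∀ {E : Type} (a : CuboidEdge N → E) (e₁ e₂ e₃ e₄ : CuboidEdge N),
          ∀ d ∈ [(a e₁, true), (a e₂, true), (a e₃, false), (a e₄, false)], ∃ e, d.1 = a e := by
        intro E a e₁ e₂ e₃ e₄ d hd
        simp only [List.mem_cons, List.not_mem_nil, or_false] at hd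
        rcases hd with rfl | rfl | rfl | rfl <;> exact ⟨_, rfl⟩
      intro d hd hdB
      obtain ⟨e, he⟩ := this (E := (subdividedCuboid N D).E) Sum.inl _ _ _ _ d hd
      exact hl e (he ▸ hdB)
    · change [_, _, _, _] = [_, _, _, _]
      have : s.1.1 + unitVec s.1.2.2 + unitVec s.1.2.1 = s.1.1 + unitVec s.1.2.1 + unitVec s.1.2.2 :=
        add_right_comm _ _ _
      exact congrArg (fun x => [s.1.1, s.1.1 + unitVec s.1.2.1, x, s.1.1 + unitVec s.1.2.2]) this
    · change s.1.1 + unitVec s.1.2.1 + (s.1.1 + unitVec s.1.2.2) =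
        s.1.1 + (s.1.1 + unitVec s.1.2.1 + unitVec s.1.2.2)
      abel
  | some δ =>
    have hsome : (D s).isSome := by rw [h]; rfl
    have hget : (D s).get hsome = δ := by simp [h]
    have hbd : ∀ b, (subdividedCuboid N D).bdry (Sum.inr (⟨s, hsome⟩, b)) =
        triangleBdry Sum.inl s (Sum.inr ⟨s, hsome⟩) δ b := fun b => by rw [← hget]; rfl
    have hst : psrc (D := D) (Sum.inr ⟨s, hsome⟩, true) = (δ.start s).1 := by rw [← hget]; rfl
    have hft : psrc (D := D) (Sum.inr ⟨s, hsome⟩, false) = (δ.finish s).1 := by rw [← hget]; rfl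
    have face : ∀ b, FaceThrough B
        ((triangleBdry Sum.inl s (Sum.inr ⟨s, hsome⟩ : (subdividedCuboid N D).E) δ b).map psrc) := by
      intro b
      refine ⟨_, ⟨Sum.inr (⟨s, hsome⟩, b), ?_, Or.inl (by rw [hbd b]; exact .refl _)⟩, rfl⟩
      intro d hd
      rw [hbd] at hd
      rcases mem_triangleBdry hd with ⟨e, he⟩ | he <;> rw [he]
      exacts [hl e, hs hsome]
    have htop : psrc (N := N) (D := D) (Sum.inl s.top, false) = s.c11.1 := add_right_comm _ _ _
    cases δ with
    | main =>
      have e1 : _ = [s.c00.1, s.c10.1, s.c11.1] := congrArg (fun x => [s.c00.1, s.c10.1, x]) hft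
      have e2 : _ = [s.c00.1, s.c11.1, s.c01.1] :=
        congrArg₂ (fun x y => [x, y, s.c01.1]) hst htop
      exact Or.inr (Or.inl ⟨e1 ▸ face false, e2 ▸ face true, _, hst, hft⟩)
    | anti =>
      have e1 : _ = [s.c00.1, s.c10.1, s.c01.1] := congrArg (fun x => [s.c00.1, x, s.c01.1]) hst
      have e2 : _ = [s.c10.1, s.c11.1, s.c01.1] := congrArg₂ (fun x y => [s.c10.1, x, y]) htop hft
      have f : FaceThrough B [s.c00.1, s.c10.1, s.c01.1] := e1 ▸ face false
      exact Or.inr (Or.inr ⟨f.reverse.rotate 2, e2 ▸ face true, _, hst, hft⟩)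

theorem squareFaces_unitVec {B : Set (subdividedCuboid N D).E} (hB : IsDiagonalSet B)
    {p : Fin 3 → ℤ} {i j : Fin 3} (hij : i < j) (hp : p ∈ cuboidPoints N)
    (hp' : p + unitVec i + unitVec j ∈ cuboidPoints N)
    (hmid : ∀ e ∈ B, mid e ≠ p + (p + unitVec i + unitVec j)) :
    SquareFaces B p (p + unitVec i) (p + unitVec i + unitVec j) (p + unitVec j) := by
  refine squareFaces_of_square hB ⟨(p, i, j), hij, hp, hp'⟩ fun h he => hmid _ he ?_
  change p + p + (unitVec i + unitVec j) = _
  abel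

theorem squareFaces {B : Set (subdividedCuboid N D).E} (hB : IsDiagonalSet B)
    {u : Fin 3 → ℤ} {α β : Direction} (hαβ : α.1 ≠ β.1) (hu : u ∈ cuboidPoints N)
    (hα : u + α.vec ∈ cuboidPoints N) (hβ : u + β.vec ∈ cuboidPoints N)
    (hmid : ∀ e ∈ B, mid e ≠ u + (u + α.vec + β.vec)) :
    SquareFaces B u (u + α.vec) (u + α.vec + β.vec) (u + β.vec) := by
  have hαβ' := add_vec_add_vec_mem hαβ hα hβ
  have main : ∀ {u : Fin 3 → ℤ} {α β : Direction}, α.1 < β.1 → u ∈ cuboidPoints N →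
      u + α.vec ∈ cuboidPoints N → u + β.vec ∈ cuboidPoints N →
      u + α.vec + β.vec ∈ cuboidPoints N → (∀ e ∈ B, mid e ≠ u + (u + α.vec + β.vec)) →
      SquareFaces B u (u + α.vec) (u + α.vec + β.vec) (u + β.vec) := by
    rintro u ⟨i, a⟩ ⟨j, b⟩ hij hu hα hβ hαβ hmid
    have hij : i < j := hij
    -- Take the smallest corner of the square as base point, then rotate or reflect the result back.
    cases a <;> cases b <;> simp only [Direction.vec_true, Direction.vec_false] at *
    · have key := squareFaces_unitVec hB (p := u + -unitVec i + -unitVec j) hij hαβ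
        (by convert! hu using 1; abel) (by intro e he; convert! hmid e he using 1; abel)
      convert! key.rotate.rotate using 1 <;> abel
    · have key := squareFaces_unitVec hB (p := u + -unitVec i) hij hα
        (by convert! hβ using 1; abel) (by intro e he; convert! hmid e he using 1; abel)
      convert! key.reflect.rotate.rotate.rotate using 1 <;> abel
    · have key := squareFaces_unitVec hB (p := u + -unitVec j) hij hβ
        (by convert! hα using 1; abel) (by intro e he; convert! hmid e he using 1; abel)
      convert! key.reflect.rotate using 1 <;> abel
    · exact squareFaces_unitVec hB hij hu hαβ hmid
  rcases lt_or_gt_of_ne hαβ with h | h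
  · exact main h hu hα hβ hαβ' hmid
  · have key := main h hu hβ hα (by rwa [add_right_comm])
      (by intro e he; convert! hmid e he using 1; abel)
    convert! key.reflect using 1
    abel

/-! ### Darts -/

theorem exists_dart {u : Fin 3 → ℤ} {α : Direction} (hu : u ∈ cuboidPoints N)
    (hα : u + α.vec ∈ cuboidPoints N) :
    ∃ d : (subdividedCuboid N D).Dart, psrc d = u ∧ ptgt d = u + α.vec := by
  obtain ⟨i, b⟩ := α
  cases b
  · rw [Direction.vec_false] at *
    refine ⟨(Sum.inl ⟨(u + -unitVec i, i), hα, by simpa using hu⟩, false), ?_, rfl⟩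
    change u + -unitVec i + unitVec i = u
    abel
  · exact ⟨(Sum.inl ⟨(u, i), hu, hα⟩, true), rfl, rfl⟩

theorem dart_inl (e : CuboidEdge N) (b : Bool) : ∃ α : Direction,
    ptgt (D := D) (Sum.inl e, b) = psrc (D := D) (Sum.inl e, b) + α.vec := by
  cases b
  · refine ⟨(e.1.2, false), ?_⟩
    rw [Direction.vec_false]
    change e.1.1 = e.1.1 + unitVec e.1.2 + -unitVec e.1.2
    abel
  · exact ⟨(e.1.2, true), rfl⟩

theorem dart_inr (s : {s : CuboidSquare N // (D s).isSome}) (b : Bool) : ∃ α β : Direction,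
    α.1 ≠ β.1 ∧ ptgt (D := D) (Sum.inr s, b) = psrc (D := D) (Sum.inr s, b) + α.vec + β.vec ∧
    psrc (D := D) (Sum.inr s, b) + α.vec ∈ cuboidPoints N ∧
    psrc (D := D) (Sum.inr s, b) + β.vec ∈ cuboidPoints N := by
  have key : ∃ α β : Direction, α.1 ≠ β.1 ∧
      ptgt (D := D) (Sum.inr s, true) = psrc (D := D) (Sum.inr s, true) + α.vec + β.vec ∧
      psrc (D := D) (Sum.inr s, true) + α.vec ∈ cuboidPoints N ∧
      psrc (D := D) (Sum.inr s, true) + β.vec ∈ cuboidPoints N := by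
    have hst : psrc (D := D) (Sum.inr s, true) = (((D s.1).get s.2).start s.1).1 := rfl
    have hft : ptgt (D := D) (Sum.inr s, true) = (((D s.1).get s.2).finish s.1).1 := rfl
    rw [hst, hft]
    cases (D s.1).get s.2
    · refine ⟨(s.1.1.2.1, true), (s.1.1.2.2, true), s.1.2.1.ne, rfl, s.1.c10.2, s.1.c01.2⟩
    · refine ⟨(s.1.1.2.1, false), (s.1.1.2.2, true), s.1.2.1.ne, ?_, ?_, s.1.c11.2⟩
      · rw [Direction.vec_false, Direction.vec_true]
        change s.1.1.1 + unitVec s.1.1.2.2 = s.1.1.1 + unitVec s.1.1.2.1 + _ + _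
        abel
      · rw [Direction.vec_false]
        change s.1.1.1 + unitVec s.1.1.2.1 + _ ∈ _
        rw [add_neg_cancel_right]
        exact s.1.c00.2
  cases b
  · obtain ⟨α, β, h1, h2, h3, h4⟩ := key
    have e1 : psrc (D := D) (Sum.inr s, false) = ptgt (D := D) (Sum.inr s, true) := rfl
    have e2 : ptgt (D := D) (Sum.inr s, false) = psrc (D := D) (Sum.inr s, true) := rfl
    rw [e1, e2, h2]
    refine ⟨α.neg, β.neg, h1, ?_, ?_, ?_⟩
    · rw [Direction.vec_neg, Direction.vec_neg]; abel
    · convert! h4 using 1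
      rw [Direction.vec_neg]
      abel
    · convert! h3 using 1
      rw [Direction.vec_neg]
      abel
  · exact key

theorem dart_cases (d : (subdividedCuboid N D).Dart) : (∃ α : Direction, ptgt d = psrc d + α.vec) ∨
    ∃ s, d.1 = Sum.inr s ∧ ∃ α β : Direction, α.1 ≠ β.1 ∧ ptgt d = psrc d + α.vec + β.vec ∧
      psrc d + α.vec ∈ cuboidPoints N ∧ psrc d + β.vec ∈ cuboidPoints N := by
  obtain ⟨e | s, b⟩ := d
  · exact Or.inl (dart_inl e b)
  · exact Or.inr ⟨s, rfl, dart_inr s b⟩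

/-- The diagonal of a square, if present, cuts it into two triangles. -/
theorem squareFaces_diagonal {B : Set (subdividedCuboid N D).E} {a b c d : Fin 3 → ℤ}
    (h : SquareFaces B a b c d) {x : (subdividedCuboid N D).Dart} (hx : psrc x = a)
    (hx' : ptgt x = c) (hac : a + c = b + d) (hab : a ≠ b) (hbc : b ≠ c) :
    FaceThrough B [a, b, c] ∧ FaceThrough B [a, c, d] := by
  have hm : mid x.1 = a + c := by rw [← psrc_add_ptgt, hx, hx']
  rcases h with ⟨-, h⟩ | ⟨h, h', -⟩ | ⟨-, -, y, hy, hy'⟩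
  · exact ((h x.1).1 hm).elim
  · exact ⟨h, h'⟩
  · have hm' : mid y.1 = b + d := by rw [← psrc_add_ptgt, hy, hy']
    rcases eq_or_eq_rev (mid_injective (hm'.trans (hac.symm.trans hm.symm))) with rfl | rfl
    · exact (hab (hx.symm.trans hy)).elim
    · rw [psrc_rev] at hy
      exact (hbc (hy.symm.trans hx')).elim

end Subdivided

/-! ### Link graphs of the subdivided cuboid -/

namespace Subdivided

open TwoComplex

variable {N : Fin 3 → ℕ} {D : CuboidSquare N → Option Diagonal}

theorem FaceThrough.exists_triangle {B : Set (subdividedCuboid N D).E} {a b c : Fin 3 → ℤ}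
    (h : FaceThrough B [a, b, c]) : ∃ x y z : (subdividedCuboid N D).Dart, IsFaceWord B [x, y, z] ∧
      psrc x = a ∧ ptgt x = b ∧ psrc y = b ∧ ptgt y = c ∧ psrc z = c ∧ ptgt z = a := by
  obtain ⟨w, hw, hw'⟩ := h
  match w, hw' with
  | [x, y, z], hw' =>
    simp only [List.map_cons, List.map_nil, List.cons.injEq, and_true] at hw'
    obtain ⟨rfl, rfl, rfl⟩ := hw'
    obtain ⟨v, h1, h2, h3, h4⟩ := hw.exists_isDartWalk
    exact ⟨x, y, z, hw, rfl, congrArg Subtype.val h2.symm, rfl, congrArg Subtype.val h3.symm, rfl,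
      congrArg Subtype.val (h4.trans h1.symm)⟩

theorem FaceThrough.exists_square {B : Set (subdividedCuboid N D).E} {a b c d : Fin 3 → ℤ}
    (h : FaceThrough B [a, b, c, d]) : ∃ x y z t : (subdividedCuboid N D).Dart,
      IsFaceWord B [x, y, z, t] ∧ psrc x = a ∧ ptgt x = b ∧ psrc y = b ∧ ptgt y = c ∧ psrc z = c ∧
      ptgt z = d ∧ psrc t = d ∧ ptgt t = a := by
  obtain ⟨w, hw, hw'⟩ := h
  match w, hw' with
  | [x, y, z, t], hw' =>
    simp only [List.map_cons, List.map_nil, List.cons.injEq, and_true] at hw'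
    obtain ⟨rfl, rfl, rfl, rfl⟩ := hw'
    obtain ⟨v, h1, h2, h3, h4, h5⟩ := hw.exists_isDartWalk
    exact ⟨x, y, z, t, hw, rfl, congrArg Subtype.val h2.symm, rfl, congrArg Subtype.val h3.symm,
      rfl, congrArg Subtype.val h4.symm, rfl, congrArg Subtype.val (h5.trans h1.symm)⟩

theorem eq_rev_of_ends {d d' : (subdividedCuboid N D).Dart} (h : psrc d = ptgt d')
    (h' : ptgt d = psrc d') : d = rev d' :=
  dart_ext (by rw [psrc_rev, h]) (by rw [ptgt_rev, h'])

theorem FaceThrough.passAdj_triangle {B : Set (subdividedCuboid N D).E} {a b c : Fin 3 → ℤ}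
    (h : FaceThrough B [a, b, c]) {x y : (subdividedCuboid N D).Dart} (hx : psrc x = a)
    (hx' : ptgt x = b) (hy : psrc y = a) (hy' : ptgt y = c) : PassAdj ∅ B x y := by
  obtain ⟨x', m, z, hw, h1, h2, -, -, h3, h4⟩ := h.exists_triangle
  obtain rfl : x' = x := dart_ext (h1.trans hx.symm) (h2.trans hx'.symm)
  obtain rfl : z = rev y := eq_rev_of_ends (h3.trans hy'.symm) (h4.trans hy.symm)
  exact PassAdj.symm ⟨[x', m, rev y], [m, rev y], [x', m], [], by simpa using hw, by simp, rfl, rfl⟩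

theorem FaceThrough.passAdj_square {B : Set (subdividedCuboid N D).E} {a b c d : Fin 3 → ℤ}
    (h : FaceThrough B [a, b, c, d]) {x y : (subdividedCuboid N D).Dart} (hx : psrc x = a)
    (hx' : ptgt x = b) (hy : psrc y = a) (hy' : ptgt y = d) : PassAdj ∅ B x y := by
  obtain ⟨x', m, m', z, hw, h1, h2, -, -, -, -, h3, h4⟩ := h.exists_square
  obtain rfl : x' = x := dart_ext (h1.trans hx.symm) (h2.trans hx'.symm)
  obtain rfl : z = rev y := eq_rev_of_ends (h3.trans hy'.symm) (h4.trans hy.symm)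
  exact PassAdj.symm
    ⟨[x', m, m', rev y], [m, m', rev y], [x', m, m'], [], by simpa using hw, by simp, rfl, rfl⟩

/-- A diagonal through `u` subdivides the link edge of its square. The other diagonal cuts off a
triangle at `u`, which passes between the same two darts as the whole square would. -/
theorem passAdj_of_directions {B : Set (subdividedCuboid N D).E} (hB : IsDiagonalSet B)
    {u : Fin 3 → ℤ} {α β : Direction} (hαβ : α.1 ≠ β.1)
    (hmid : ∀ e ∈ B, mid e ≠ u + (u + α.vec + β.vec)) {x y : (subdividedCuboid N D).Dart}
    (hx : psrc x = u) (hx' : ptgt x = u + α.vec) (hy : psrc y = u) (hy' : ptgt y = u + β.vec) :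
    PassAdj ∅ B x y ∨ ∃ z : (subdividedCuboid N D).Dart, psrc z = u ∧ ptgt z = u + α.vec + β.vec ∧
      PassAdj ∅ B x z ∧ PassAdj ∅ B z y := by
  rcases squareFaces hB hαβ (hx ▸ psrc_mem x) (hx' ▸ ptgt_mem x) (hy' ▸ ptgt_mem y) hmid with
    ⟨h, -⟩ | ⟨h, h', z, hz, hz'⟩ | ⟨h, -, -⟩
  · exact Or.inl (h.passAdj_square hx hx' hy hy')
  · exact Or.inr ⟨z, hz, hz', h.passAdj_triangle hx hx' hz hz', h'.passAdj_triangle hz hz' hy hy'⟩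
  · have h2 : FaceThrough B [u, u + α.vec, u + β.vec] := h.reverse.rotate 2
    exact Or.inl (h2.passAdj_triangle hx hx' hy hy')

theorem notMem_of_direction {B : Set (subdividedCuboid N D).E} (hB : IsDiagonalSet B)
    {x : (subdividedCuboid N D).Dart} {α : Direction} (hx : ptgt x = psrc x + α.vec) : x.1 ∉ B := by
  intro hxB
  obtain ⟨e, b⟩ := x
  obtain ⟨s, rfl⟩ := hB _ hxB
  obtain ⟨β, γ, h1, h2, -⟩ := dart_inr s b
  rw [hx, add_assoc, add_right_inj] at h2
  exact Direction.vec_add_ne_vec h1 h2.symm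

theorem faceThrough_of_diagonal {B : Set (subdividedCuboid N D).E} (hB : IsDiagonalSet B)
    {x : (subdividedCuboid N D).Dart} {α β : Direction} (hαβ : α.1 ≠ β.1)
    (hx : ptgt x = psrc x + α.vec + β.vec) (hα : psrc x + α.vec ∈ cuboidPoints N)
    (hβ : psrc x + β.vec ∈ cuboidPoints N) (hxB : x.1 ∉ B) :
    FaceThrough B [psrc x, psrc x + α.vec, psrc x + α.vec + β.vec] ∧
      FaceThrough B [psrc x, psrc x + α.vec + β.vec, psrc x + β.vec] := by
  refine squareFaces_diagonal (squareFaces hB hαβ (psrc_mem x) hα hβ fun e he hm => hxB ?_) rfl hx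
    (by abel) (fun h => α.vec_ne_zero (left_eq_add.1 h)) (fun h => β.vec_ne_zero (left_eq_add.1 h))
  rw [← hx, psrc_add_ptgt] at hm
  exact mid_injective hm ▸ he

/-- The link graph of the cuboid complex at a vertex stays connected when one pair of directions is
disconnected and then a vertex is deleted. -/
theorem linkConn_singleton {B : Set (subdividedCuboid N D).E} (hB : IsDiagonalSet B)
    (hN : ∀ i, 0 < N i) (v : cuboidPoints N) (κ : Fin 3 → ℤ)
    (hκ : ∀ α β : Direction, α.1 ≠ β.1 → ∀ e ∈ B, mid e = v.1 + (v.1 + α.vec + β.vec) →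
      α.vec + β.vec = κ)
    (hκ' : ∀ α β : Direction, α.1 ≠ β.1 → α.vec + β.vec = κ → ∀ γ : Direction, γ.1 ≠ α.1 →
      γ.1 ≠ β.1 → v.1 + γ.vec ∈ cuboidPoints N) :
    LinkConn (C := subdividedCuboid N D) ∅ B {v} := by
  classical
  intro g
  obtain ⟨u, hu⟩ := v
  simp only at hκ hκ'
  set E := dartsAt (C := subdividedCuboid N D) ∅ B {⟨u, hu⟩} g with hE
  set R := Relation.EqvGen fun a b => a ∈ E ∧ b ∈ E ∧ PassAdj ∅ B a b with hR
  -- `τ` is the displacement along the deleted dart. If that dart is not at `u`, the value 0 deletes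
  -- nothing, since the ends of a dart are distinct.
  obtain ⟨τ, hτ⟩ : ∃ τ : Fin 3 → ℤ, ∀ x : (subdividedCuboid N D).Dart, psrc x = u →
      (x = g ↔ ptgt x = u + τ) := by
    by_cases hg : psrc g = u
    · refine ⟨ptgt g - u, fun x hx => ?_⟩
      rw [add_sub_cancel]
      exact ⟨fun h => by rw [h], fun h => dart_ext (hx.trans hg.symm) h⟩
    · refine ⟨0, fun x hx => ⟨fun h => (hg (h ▸ hx)).elim, fun h => ?_⟩⟩
      rw [add_zero, ← hx] at h
      exact (psrc_ne_ptgt x h.symm).elim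
  have memE : ∀ {x : (subdividedCuboid N D).Dart}, psrc x = u → x.1 ∉ B → ptgt x ≠ u + τ → x ∈ E :=
    fun h1 h2 h3 => ⟨Subtype.ext h1, fun h => h.elim, h2, fun h => h3 ((hτ _ h1).1 h)⟩
  let A : Set Direction := {α | u + α.vec ∈ cuboidPoints N}
  have hax : ∀ α : Direction, ∃ d : (subdividedCuboid N D).Dart, α ∈ A →
      psrc d = u ∧ ptgt d = u + α.vec := fun α => by
    by_cases h : α ∈ A
    · obtain ⟨d, hd⟩ := exists_dart (D := D) hu h
      exact ⟨d, fun _ => hd⟩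
    · exact ⟨g, fun h' => (h h').elim⟩
  choose ax hax using hax
  have axE : ∀ α ∈ A, α.vec ≠ τ → ax α ∈ E := fun α hα hατ => by
    obtain ⟨h1, h2⟩ := hax α hα
    refine memE h1 (notMem_of_direction hB (h2.trans (by rw [h1]))) ?_
    rw [h2]
    exact fun h => hατ (add_left_cancel h)
  have hA : ∀ i, ∃ α ∈ A, α.1 = i := by
    intro i
    have hu' := mem_cuboidPoints.1 hu
    have key : ∀ b : Bool, 0 ≤ u i + cond b 1 (-1) → u i + cond b 1 (-1) ≤ N i →
        ((i, b) : Direction) ∈ A := by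
      intro b h1 h2
      refine mem_cuboidPoints.2 fun j => ?_
      by_cases hj : j = i
      · subst hj
        simpa [Direction.vec] using ⟨h1, h2⟩
      · rw [Pi.add_apply, Direction.vec_of_ne hj, add_zero]
        exact hu' j
    have := hu' i
    have := hN i
    by_cases h : u i < N i
    · exact ⟨(i, true), key true (by simp; omega) (by simp; omega), rfl⟩
    · exact ⟨(i, false), key false (by simp; omega) (by simp; omega), rfl⟩
  have axR : ∀ {α β}, α ∈ A → β ∈ A → α.vec ≠ τ → β.vec ≠ τ → R (ax α) (ax β) := by
    intro α β hα hβ hατ hβτ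
    refine eqvGen_lift (p := fun α β => R (ax α) (ax β))
      ⟨fun _ => .refl _, .symm _ _, .trans _ _ _⟩ ?_
      (Direction.eqvGen_of_deleted hA τ κ hκ' hα hβ hατ hβτ)
    rintro α β ⟨hα, hβ, hατ, hβτ, hαβ, hk, ht⟩
    obtain ⟨h1, h2⟩ := hax α hα
    obtain ⟨h3, h4⟩ := hax β hβ
    have hmid : ∀ e ∈ B, mid e ≠ u + (u + α.vec + β.vec) := fun e he hm => hk (hκ α β hαβ e he hm)
    rcases passAdj_of_directions hB hαβ hmid h1 h2 h3 h4 with h | ⟨z, hz1, hz2, h, h'⟩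
    · exact .rel _ _ ⟨axE α hα hατ, axE β hβ hβτ, h⟩
    · have hzE : z ∈ E := by
        refine memE hz1 (fun h => hmid _ h ?_) fun h => ht ?_
        · rw [← psrc_add_ptgt, hz1, hz2]
        · rw [hz2, add_assoc] at h
          exact add_left_cancel h
      exact .trans _ _ _ (.rel _ _ ⟨axE α hα hατ, hzE, h⟩) (.rel _ _ ⟨hzE, axE β hβ hβτ, h'⟩)
  -- A diagonal dart outside `B` keeps both its triangles, which lead to two coordinate darts; at
  -- most one of these is deleted.
  have toAxis : ∀ x ∈ E, ∃ α ∈ A, α.vec ≠ τ ∧ R x (ax α) := by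
    rintro x hx
    have hxu : psrc x = u := congrArg Subtype.val hx.1
    have hxτ : ptgt x ≠ u + τ := fun h => hx.2.2.2 ((hτ x hxu).2 h)
    rcases dart_cases x with ⟨α, hα⟩ | ⟨-, -, α, β, hαβ, hxt, hα, hβ⟩
    · have hαA : α ∈ A := by
        have := ptgt_mem x
        rwa [hα, hxu] at this
      refine ⟨α, hαA, fun h => hxτ (by rw [hα, hxu, h]), ?_⟩
      obtain ⟨h1, h2⟩ := hax α hαA
      rw [dart_ext (h1.trans hxu.symm) (h2.trans (by rw [hα, hxu]))]
      exact .refl _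
    · obtain ⟨f1, f2⟩ := faceThrough_of_diagonal hB hαβ hxt hα hβ hx.2.2.1
      rw [hxu] at hα hβ f1 f2 hxt
      by_cases hατ : α.vec = τ
      · have hβτ : β.vec ≠ τ := fun h =>
          hαβ (congrArg Prod.fst (Direction.vec_injective (hατ.trans h.symm)))
        obtain ⟨h1, h2⟩ := hax β hβ
        exact ⟨β, hβ, hβτ, .rel _ _ ⟨hx, axE β hβ hβτ, f2.passAdj_triangle hxu hxt h1 h2⟩⟩
      · obtain ⟨h1, h2⟩ := hax α hα
        exact ⟨α, hα, hατ, .rel _ _ ⟨hx, axE α hα hατ,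
          (f1.passAdj_triangle h1 h2 hxu hxt).symm⟩⟩
  intro x hx y hy
  obtain ⟨α, hα, hατ, hxα⟩ := toAxis x hx
  obtain ⟨β, hβ, hβτ, hyβ⟩ := toAxis y hy
  exact .trans _ _ _ hxα (.trans _ _ _ (axR hα hβ hατ hβτ) (.symm _ _ hyβ))

/-- Three consecutive collinear diagonals with midpoints `v - δ / 2`, `v + δ / 2`, `v + 3 δ / 2`
disconnect at most one pair of directions at a vertex other than `v` and `v + δ`. -/
theorem linkConn_of_triple {B : Set (subdividedCuboid N D).E} (hB : IsDiagonalSet B)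
    (hN : ∀ i, 0 < N i) {v : Fin 3 → ℤ} {δ : Fin 3 → ℤ} (hδ : δ ≠ 0)
    (hδ1 : ∀ i, -1 ≤ δ i ∧ δ i ≤ 1) (hv : ∀ i, 0 < v i ∧ v i < N i)
    (hmid : ∀ e ∈ B, mid e = v + v - δ ∨ mid e = v + v + δ ∨ mid e = v + v + δ + δ + δ)
    (u : cuboidPoints N) (hu : u.1 ≠ v) (hu' : u.1 ≠ v + δ) :
    LinkConn (C := subdividedCuboid N D) ∅ B {u} := by
  obtain ⟨u, hum⟩ := u
  simp only at hu hu'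
  have hk : ∀ {α β : Direction} {e}, e ∈ B → mid e = u + (u + α.vec + β.vec) →
      ∃ k : ℤ, (k = -1 ∨ k = 1 ∨ k = 3) ∧
        ∀ i, 2 * u i + (α.vec + β.vec) i = 2 * v i + k * δ i := by
    intro α β e he hm
    have key : ∀ i, mid e i = 2 * u i + (α.vec + β.vec) i := fun i => by
      rw [hm]; simp only [Pi.add_apply]; ring
    rcases hmid e he with h | h | h
    · exact ⟨-1, by simp, fun i => by rw [← key, h]; simp only [Pi.add_apply, Pi.sub_apply]; ring⟩
    · exact ⟨1, by simp, fun i => by rw [← key, h]; simp only [Pi.add_apply]; ring⟩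
    · exact ⟨3, by simp, fun i => by rw [← key, h]; simp only [Pi.add_apply]; ring⟩
  obtain ⟨t, ht⟩ : ∃ t, δ t ≠ 0 := Function.ne_iff.1 hδ
  -- Two consecutive midpoints of the triple belong to squares at a common vertex only if that
  -- vertex is `v` or `v + δ`; the first and the third midpoint are too far apart.
  have uniq : ∀ {a a' : Fin 3 → ℤ} {k k' : ℤ}, (∀ i, -1 ≤ a i ∧ a i ≤ 1) →
      (∀ i, -1 ≤ a' i ∧ a' i ≤ 1) → (k = -1 ∨ k = 1 ∨ k = 3) → (k' = -1 ∨ k' = 1 ∨ k' = 3) →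
      (∀ i, 2 * u i + a i = 2 * v i + k * δ i) → (∀ i, 2 * u i + a' i = 2 * v i + k' * δ i) →
      a = a' := by
    intro a a' k k' ha ha' hk hk' h h'
    have near : ∀ {a a' : Fin 3 → ℤ} {k k' : ℤ}, (∀ i, -1 ≤ a i ∧ a i ≤ 1) →
        (∀ i, -1 ≤ a' i ∧ a' i ≤ 1) → (k = -1 ∨ k = 1 ∨ k = 3) → (k' = -1 ∨ k' = 1 ∨ k' = 3) →
        (∀ i, 2 * u i + a i = 2 * v i + k * δ i) → (∀ i, 2 * u i + a' i = 2 * v i + k' * δ i) →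
        ¬ k < k' := by
      intro a a' k k' ha ha' hk hk' h h' hkk
      rcases hk with rfl | rfl | rfl <;> rcases hk' with rfl | rfl | rfl <;> try omega
      · exact hu (funext fun i => by
          have := h i; have := h' i; have := ha i; have := ha' i; have := hδ1 i; omega)
      · have := h t; have := h' t; have := ha t; have := ha' t; have := hδ1 t; omega
      · exact hu' (funext fun i => by
          have := h i; have := h' i; have := ha i; have := ha' i; have := hδ1 i
          rw [Pi.add_apply]; omega)
    obtain rfl : k = k' := le_antisymm (not_lt.1 (near ha' ha hk' hk h' h))
      (not_lt.1 (near ha ha' hk hk' h h'))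
    exact funext fun i => by have := h i; have := h' i; omega
  by_cases hex : ∃ α β : Direction, α.1 ≠ β.1 ∧ ∃ e ∈ B, mid e = u + (u + α.vec + β.vec)
  · obtain ⟨α, β, hαβ, e, he, hm⟩ := hex
    obtain ⟨k, hk1, hk2⟩ := hk he hm
    refine linkConn_singleton hB hN ⟨u, hum⟩ (α.vec + β.vec) ?_ ?_
    · intro α' β' hαβ' e' he' hm'
      obtain ⟨k', hk1', hk2'⟩ := hk he' hm'
      exact uniq (Direction.vec_add_bound hαβ') (Direction.vec_add_bound hαβ) hk1' hk1 hk2' hk2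
    · intro α' β' hαβ' hs γ hγα hγβ
      change u + γ.vec ∈ cuboidPoints N
      refine mem_cuboidPoints.2 fun i => ?_
      by_cases hi : i = γ.1
      · subst hi
        -- In the coordinate orthogonal to the square, 2u = 2v + kδ with `k` odd. By parity δ
        -- vanishes there, so `u` agrees with `v` in this coordinate and has neighbours on both
        -- sides, `v` being interior.
        have h0 : (α.vec + β.vec) γ.1 = 0 := by
          rw [← hs, Pi.add_apply, Direction.vec_of_ne hγα, Direction.vec_of_ne hγβ, add_zero]
        have h1 := hk2 γ.1
        have h2 := hδ1 γ.1
        have h3 := hv γ.1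
        have h4 := γ.vec_bound γ.1
        rw [h0] at h1
        rw [Pi.add_apply]
        rcases hk1 with rfl | rfl | rfl <;> omega
      · rw [Pi.add_apply, Direction.vec_of_ne hi, add_zero]
        exact mem_cuboidPoints.1 hum i
  -- No pair is disconnected; 0 is not the sum of directions on two different axes.
  · refine linkConn_singleton hB hN ⟨u, hum⟩ 0 ?_ ?_
    · intro α β hαβ e he hm
      exact (hex ⟨α, β, hαβ, e, he, hm⟩).elim
    · intro α β hαβ h
      exact (Direction.vec_add_ne_zero hαβ h).elim

end Subdivided

/-! ### Recovering a direction from a displacement -/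

namespace Direction

theorem eq_of_vec_apply {γ γ' : Direction} (h : γ.vec γ'.1 = γ'.vec γ'.1) : γ = γ' := by
  by_cases h1 : γ'.1 = γ.1
  · rcases eq_or_eq_neg h1 with rfl | rfl
    · rfl
    · rw [vec_neg, neg_fst, Pi.neg_apply] at h
      rcases γ.vec_self with h2 | h2 <;> rw [h2] at h <;> omega
  · rw [vec_of_ne h1] at h
    exact (γ'.vec_self_ne h.symm).elim

/-- A signed coordinate direction in which a vector points. -/
noncomputable def ofVec (τ : Fin 3 → ℤ) : Direction :=
  Classical.epsilon fun γ : Direction => τ γ.1 = γ.vec γ.1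

theorem ofVec_vec (γ : Direction) : ofVec γ.vec = γ :=
  (eq_of_vec_apply (Classical.epsilon_spec (p := fun γ' : Direction => γ.vec γ'.1 = γ'.vec γ'.1)
    ⟨γ, rfl⟩)).symm

theorem eq_or_eq_of_vec_add_apply {α β γ : Direction} (hαβ : α.1 ≠ β.1)
    (h : (α.vec + β.vec) γ.1 = γ.vec γ.1) : γ = α ∨ γ = β := by
  rw [Pi.add_apply] at h
  by_cases h1 : γ.1 = α.1
  · rw [vec_of_ne (α := β) (by rw [h1]; exact hαβ), add_zero] at h
    exact Or.inl (eq_of_vec_apply h).symm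
  · rw [vec_of_ne h1, zero_add] at h
    exact Or.inr (eq_of_vec_apply h).symm

/-- Either outcome will do: a diagonal node touches the coordinate darts of both directions. -/
theorem ofVec_add {α β : Direction} (hαβ : α.1 ≠ β.1) :
    ofVec (α.vec + β.vec) = α ∨ ofVec (α.vec + β.vec) = β :=
  eq_or_eq_of_vec_add_apply hαβ (Classical.epsilon_spec
    (p := fun γ' : Direction => (α.vec + β.vec) γ'.1 = γ'.vec γ'.1) ⟨α, vec_add_self hαβ⟩)

theorem vec_add_ne {α β γ γ' : Direction} (hαβ : α.1 ≠ β.1) (hγ : γ.1 ≠ γ'.1) (h : γ ≠ α)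
    (h' : γ ≠ β) : γ.vec + γ'.vec ≠ α.vec + β.vec := fun he =>
  (eq_or_eq_of_vec_add_apply hαβ (by rw [← he, vec_add_self hγ])).elim h h'

end Direction

/-! ### Three collinear diagonals with interior joints -/

namespace Subdivided

open TwoComplex

variable {N : Fin 3 → ℕ} {D : CuboidSquare N → Option Diagonal}

theorem add_vec_mem {p : Fin 3 → ℤ} {α β : Direction} (hαβ : α.1 ≠ β.1)
    (h : p ∈ cuboidPoints N) (h' : p + α.vec + β.vec ∈ cuboidPoints N) :
    p + α.vec ∈ cuboidPoints N := by
  rw [mem_cuboidPoints] at *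
  intro i
  by_cases hi : i = α.1
  · have := h' i
    rwa [Pi.add_apply, Direction.vec_of_ne (α := β) (by rw [hi]; exact hαβ), add_zero] at this
  · rw [Pi.add_apply, Direction.vec_of_ne hi, add_zero]
    exact h i

/-- Three consecutive collinear diagonal edges in the direction `α.vec + β.vec`, the second of which
starts at `p`, on the unique cycle in the edge set `S`. -/
structure StraightConfig (N : Fin 3 → ℕ) (D : CuboidSquare N → Option Diagonal)
    (S : Set (subdividedCuboid N D).E) extends TripleConfig (subdividedCuboid N D) S where
  α : Direction
  β : Direction
  α_ne_β : α.1 ≠ β.1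
  k : Fin 3
  k_ne : k ≠ α.1 ∧ k ≠ β.1
  p : Fin 3 → ℤ
  psrc₁ : psrc E₁ = p - (α.vec + β.vec)
  psrc₂ : psrc E₂ = p
  psrc₃ : psrc E₃ = p + (α.vec + β.vec)
  ptgt₃ : ptgt E₃ = p + (α.vec + β.vec) + (α.vec + β.vec)
  diagonal : IsDiagonalSet {E₁.1, E₂.1, E₃.1}
  interior₁ : ∀ γ : Direction, p + γ.vec ∈ cuboidPoints N
  interior₂ : ∀ γ : Direction, p + (α.vec + β.vec) + γ.vec ∈ cuboidPoints N

namespace StraightConfig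

variable {S : Set (subdividedCuboid N D).E} (X : StraightConfig N D S)

/-- The vector from one end of the three diagonals to the next. -/
def δ : Fin 3 → ℤ := X.α.vec + X.β.vec

/-- The two inner vertices of the triple. -/
def pt (b : Bool) : Fin 3 → ℤ := X.p + cond b X.δ 0

variable {X}

theorem pt_false : X.pt false = X.p := add_zero _

theorem pt_true : X.pt true = X.p + X.δ := rfl

theorem ptgt₁ : ptgt X.E₁ = X.p := by
  rw [← X.psrc₂]
  exact congrArg Subtype.val (X.tgt₁.trans X.src₂.symm)

theorem ptgt₂ : ptgt X.E₂ = X.p + X.δ := by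
  rw [δ, ← X.psrc₃]
  exact congrArg Subtype.val (X.tgt₂.trans X.src₃.symm)

theorem δ_ne_zero : X.δ ≠ 0 := Direction.vec_add_ne_zero X.α_ne_β

theorem inner_src_iff {d : (subdividedCuboid N D).Dart} :
    X.Inner (src d) ↔ ∃ b, psrc d = X.pt b := by
  have h1 : src d = X.v₁ ↔ psrc d = X.pt false := by
    rw [pt_false, ← X.psrc₂, ← X.src₂]; exact Subtype.ext_iff
  have h2 : src d = X.v₂ ↔ psrc d = X.pt true := by
    rw [pt_true, δ, ← X.psrc₃, ← X.src₃]; exact Subtype.ext_iff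
  rw [Bool.exists_bool, ← h1, ← h2]
  rfl

theorem inner_tgt_iff {d : (subdividedCuboid N D).Dart} :
    X.Inner (tgt d) ↔ ∃ b, ptgt d = X.pt b := by
  rw [← src_rev, inner_src_iff, psrc_rev]

theorem mem_outer {d : (subdividedCuboid N D).Dart} (hd : d.1 ∈ S) (h : ∀ b, psrc d ≠ X.pt b)
    (h' : ∀ b, ptgt d ≠ X.pt b) : d.1 ∈ X.outer :=
  X.mem_outer_iff.2 ⟨hd, fun hi => (inner_src_iff.1 hi).elim h, fun hi =>
    (inner_tgt_iff.1 hi).elim h'⟩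

theorem pt_add_ne {b : Bool} {τ : Fin 3 → ℤ} (h0 : τ ≠ 0) (h1 : τ ≠ X.δ) (h2 : τ ≠ -X.δ)
    (b' : Bool) : X.pt b + τ ≠ X.pt b' := by
  intro h
  rw [pt, pt, add_assoc, add_right_inj] at h
  cases b <;> cases b' <;> simp only [cond_true, cond_false, zero_add, add_eq_left] at h
  · exact h0 h
  · exact h1 h
  · exact h2 (eq_neg_of_add_eq_zero_right h)
  · exact h0 h

theorem pt_add_vec_ne (b : Bool) (γ : Direction) (b' : Bool) : X.pt b + γ.vec ≠ X.pt b' := by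
  refine pt_add_ne γ.vec_ne_zero (Direction.vec_add_ne_vec X.α_ne_β).symm (fun h => ?_) b'
  refine Direction.vec_add_ne_vec (γ := γ.neg) X.α_ne_β ?_
  rw [Direction.vec_neg, h, neg_neg]
  rfl

theorem pt_add_vec_mem (b : Bool) (γ : Direction) : X.pt b + γ.vec ∈ cuboidPoints N := by
  cases b
  · rw [pt_false]; exact X.interior₁ γ
  · exact X.interior₂ γ

theorem pt_mem (b : Bool) : X.pt b ∈ cuboidPoints N := by
  cases b
  · rw [pt_false, ← X.psrc₂]; exact psrc_mem _
  · rw [pt_true, δ, ← X.psrc₃]; exact psrc_mem _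

variable (X) in
theorem exists_axis (b : Bool) (γ : Direction) : ∃ d : (subdividedCuboid N D).Dart,
    psrc d = X.pt b ∧ ptgt d = X.pt b + γ.vec := exists_dart (pt_mem b) (pt_add_vec_mem b γ)

variable (X) in
/-- The dart along a coordinate direction at an inner vertex. -/
noncomputable def axis (b : Bool) (γ : Direction) : (subdividedCuboid N D).Dart :=
  Classical.choose (X.exists_axis b γ)

theorem psrc_axis (b : Bool) (γ : Direction) : psrc (X.axis b γ) = X.pt b :=
  (Classical.choose_spec (X.exists_axis b γ)).1

theorem ptgt_axis (b : Bool) (γ : Direction) : ptgt (X.axis b γ) = X.pt b + γ.vec :=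
  (Classical.choose_spec (X.exists_axis b γ)).2

theorem isNode_axis (b : Bool) (γ : Direction) : X.IsNode (X.axis b γ) :=
  ⟨inner_src_iff.2 ⟨b, psrc_axis b γ⟩,
    notMem_of_direction X.diagonal (by rw [ptgt_axis, psrc_axis])⟩

theorem some_mem_nodes {d : (subdividedCuboid N D).Dart} (hd : X.IsNode d) :
    some d ∈ X.nodes := by
  rintro d' h
  obtain rfl := Option.some_inj.1 h
  exact hd

theorem none_mem_nodes : none ∈ X.nodes := fun _ h => by cases h

/-! ### Adjacent pieces -/

/-- The side opposite the inner vertex joins the targets of `d` and `d'` and so avoids both inner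
vertices; if it is in `S`, it is in `outer`. -/
theorem touch_triangle {d d' : (subdividedCuboid N D).Dart} {b : Bool} (hd : X.IsNode d)
    (hd' : X.IsNode d') (hs : psrc d = X.pt b) (hs' : psrc d' = X.pt b)
    (ht : ∀ b, ptgt d ≠ X.pt b) (ht' : ∀ b, ptgt d' ≠ X.pt b) (hne : ptgt d ≠ ptgt d')
    (hf : FaceThrough (D := D) ∅ [X.pt b, ptgt d', ptgt d]) : X.Touch (some d) (some d') := by
  obtain ⟨x, y, z, hw, h1, h2, h3, h4, h5, h6⟩ := hf.exists_triangle
  obtain rfl : x = d' := dart_ext (h1.trans hs'.symm) h2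
  obtain rfl : z = rev d := eq_rev_of_ends h5 (h6.trans hs.symm)
  refine X.touch_corner (m := [y]) (s := []) hd hd' (fun h => hne (congrArg ptgt h)) ?_ (by simp)
    (by simpa using hw)
  intro e he heS
  obtain rfl := List.mem_singleton.1 he
  exact mem_outer heS (fun b => h3 ▸ ht' b) (fun b => h4 ▸ ht b)

theorem touch_square {d d' : (subdividedCuboid N D).Dart} {b : Bool} (hd : X.IsNode d)
    (hd' : X.IsNode d') (hs : psrc d = X.pt b) (hs' : psrc d' = X.pt b)
    (ht : ∀ b, ptgt d ≠ X.pt b) (ht' : ∀ b, ptgt d' ≠ X.pt b) (hne : ptgt d ≠ ptgt d')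
    {c : Fin 3 → ℤ} (hc : ∀ b, c ≠ X.pt b)
    (hf : FaceThrough (D := D) ∅ [X.pt b, ptgt d', c, ptgt d]) : X.Touch (some d) (some d') := by
  obtain ⟨x, y, y', z, hw, h1, h2, h3, h4, h3', h4', h5, h6⟩ := hf.exists_square
  obtain rfl : x = d' := dart_ext (h1.trans hs'.symm) h2
  obtain rfl : z = rev d := eq_rev_of_ends h5 (h6.trans hs.symm)
  refine X.touch_corner (m := [y, y']) (s := []) hd hd' (fun h => hne (congrArg ptgt h)) ?_
    (by simp) (by simpa using hw)
  intro e he heS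
  simp only [List.mem_cons, List.not_mem_nil, or_false] at he
  rcases he with rfl | rfl
  · exact mem_outer heS (fun b => h3 ▸ ht' b) (fun b => h4 ▸ hc b)
  · exact mem_outer heS (fun b => h3' ▸ hc b) (fun b => h4' ▸ ht b)

theorem isDiagonalSet_empty : IsDiagonalSet (∅ : Set (subdividedCuboid N D).E) :=
  fun _ h => h.elim

theorem touch_diagonal {d : (subdividedCuboid N D).Dart} {b : Bool} (hd : X.IsNode d)
    (hs : psrc d = X.pt b) {γ γ' : Direction} (hγ : γ.1 ≠ γ'.1)
    (ht : ptgt d = X.pt b + γ.vec + γ'.vec) (hn : ∀ b, ptgt d ≠ X.pt b) :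
    X.Touch (some d) (some (X.axis b γ)) := by
  have hf := (faceThrough_of_diagonal (B := ∅) isDiagonalSet_empty (x := d) hγ (by rw [hs, ht])
    (by rw [hs]; exact pt_add_vec_mem b γ) (by rw [hs]; exact pt_add_vec_mem b γ') fun h => h).1
  refine touch_triangle hd (isNode_axis b γ) hs (psrc_axis b γ) hn ?_ ?_ ?_
  · rw [ptgt_axis]; exact pt_add_vec_ne b γ
  · rw [ht, ptgt_axis]
    exact fun h => γ'.vec_ne_zero (add_eq_left.1 h)
  · rw [ptgt_axis, ht, ← hs]; exact hf

/-- No diagonal at an inner vertex other than those of the triple leads to the other one. -/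
theorem tgt_ne_of_isNode {d : (subdividedCuboid N D).Dart} (hd : X.IsNode d) (b : Bool) :
    ptgt d ≠ X.pt b := by
  intro h
  obtain ⟨b', h'⟩ := inner_src_iff.1 hd.1
  cases b <;> cases b'
  · exact psrc_ne_ptgt d (h'.trans h.symm)
  · rw [pt_false] at h
    rw [pt_true] at h'
    have : d = rev X.E₂ := eq_rev_of_ends (h'.trans ptgt₂.symm) (h.trans X.psrc₂.symm)
    exact hd.2 (this ▸ TripleConfig.mem₂')
  · rw [pt_true] at h
    rw [pt_false] at h'
    have : d = X.E₂ := dart_ext (h'.trans X.psrc₂.symm) (h.trans ptgt₂.symm)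
    exact hd.2 (this ▸ TripleConfig.mem₂')
  · exact psrc_ne_ptgt d (h'.trans h.symm)

theorem isNode_of_ne {d : (subdividedCuboid N D).Dart} {b : Bool} {τ : Fin 3 → ℤ}
    (hs : psrc d = X.pt b) (ht : ptgt d = X.pt b + τ) (h1 : τ ≠ X.δ) (h2 : τ ≠ -X.δ) :
    X.IsNode d := by
  have h0 : τ ≠ 0 := fun h => psrc_ne_ptgt d (by rw [hs, ht, h, add_zero])
  have hn : ∀ b, ptgt d ≠ X.pt b := fun b' => ht ▸ pt_add_ne h0 h1 h2 b'
  refine ⟨inner_src_iff.2 ⟨b, hs⟩, ?_⟩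
  rintro (h | h | h) <;> rcases eq_or_eq_rev h with rfl | rfl
  · exact hn false (by rw [pt_false, ptgt₁])
  · rw [psrc_rev, ptgt₁] at hs
    rw [ptgt_rev, X.psrc₁, ← hs] at ht
    exact h2 (by rw [sub_eq_add_neg, add_right_inj] at ht; exact ht.symm)
  · exact hn true (by rw [pt_true, ptgt₂])
  · exact hn false (by rw [pt_false, ptgt_rev, X.psrc₂])
  · rw [X.psrc₃] at hs
    rw [X.ptgt₃, ← hs] at ht
    exact h1 (add_left_cancel ht).symm
  · exact hn true (by rw [pt_true, ptgt_rev, X.psrc₃]; rfl)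

/-- A diagonal of the square through the inner vertex, if present, is a node between the two darts.
It does not belong to the triple, because the displacements `δ` and `-δ` are excluded. -/
theorem touch_axis {b : Bool} {γ γ' : Direction} (hγ : γ.1 ≠ γ'.1) (h1 : γ.vec + γ'.vec ≠ X.δ)
    (h2 : γ.vec + γ'.vec ≠ -X.δ) : X.Touch (some (X.axis b γ)) (some (X.axis b γ')) ∨
      ∃ d, X.IsNode d ∧ psrc d = X.pt b ∧ ptgt d = X.pt b + (γ.vec + γ'.vec) ∧
        X.Touch (some d) (some (X.axis b γ)) ∧ X.Touch (some d) (some (X.axis b γ')) := by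
  have hne : ptgt (X.axis b γ) ≠ ptgt (X.axis b γ') := by
    rw [ptgt_axis, ptgt_axis]
    exact fun h => hγ (congrArg Prod.fst (Direction.vec_injective (add_left_cancel h)))
  have hn : ∀ γ b', ptgt (X.axis b γ) ≠ X.pt b' := fun γ => tgt_ne_of_isNode (isNode_axis b γ)
  have hF := squareFaces (D := D) isDiagonalSet_empty hγ (X.pt_mem b)
    (pt_add_vec_mem b γ) (pt_add_vec_mem b γ') fun e he => he.elim
  rcases hF with ⟨h, -⟩ | ⟨-, -, d, hd, hd'⟩ | ⟨h, -, -⟩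
  · refine Or.inl (TripleConfig.Touch.symm (touch_square (isNode_axis b γ') (isNode_axis b γ)
      (psrc_axis b γ') (psrc_axis b γ) (hn γ') (hn γ) hne.symm
      (c := X.pt b + (γ.vec + γ'.vec)) (pt_add_ne (Direction.vec_add_ne_zero hγ) h1 h2) ?_))
    rw [ptgt_axis, ptgt_axis, ← add_assoc]
    exact h
  · have hd'' : ptgt d = X.pt b + (γ.vec + γ'.vec) := by rw [hd', add_assoc]
    have hN : X.IsNode d := isNode_of_ne hd hd'' h1 h2
    exact Or.inr ⟨d, hN, hd, hd'', touch_diagonal hN hd hγ hd' (tgt_ne_of_isNode hN),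
      touch_diagonal hN hd hγ.symm (by rw [hd', add_right_comm]) (tgt_ne_of_isNode hN)⟩
  · refine Or.inl (touch_triangle (isNode_axis b γ) (isNode_axis b γ')
      (psrc_axis b γ) (psrc_axis b γ') (hn γ) (hn γ') hne ?_)
    rw [ptgt_axis, ptgt_axis]
    exact h.rotate 1

/-- In the triangle on `E₂` with third corner `p + γ`, the side `E₂` is contracted; the other two
sides are the darts `γ` at the first and `-γ'` at the second inner vertex. -/
theorem touch_cross {γ γ' : Direction} (hγ : γ.1 ≠ γ'.1) (hδ : γ.vec + γ'.vec = X.δ) :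
    X.Touch (some (X.axis true γ'.neg)) (some (X.axis false γ)) := by
  have ht : ptgt X.E₂ = psrc X.E₂ + γ.vec + γ'.vec := by rw [ptgt₂, X.psrc₂, ← hδ, add_assoc]
  have hf := (faceThrough_of_diagonal (B := ∅) isDiagonalSet_empty (x := X.E₂) hγ ht
    (by rw [X.psrc₂, ← pt_false]; exact pt_add_vec_mem _ γ)
    (by rw [X.psrc₂, ← pt_false]; exact pt_add_vec_mem _ γ') fun h => h).1
  obtain ⟨x, y, z, hw, h1, h2, h3, h4, h5, h6⟩ := hf.exists_triangle
  obtain rfl : x = X.axis false γ := dart_ext (by rw [h1, psrc_axis, pt_false, X.psrc₂])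
    (by rw [h2, ptgt_axis, pt_false, X.psrc₂])
  obtain rfl : y = rev (X.axis true γ'.neg) := by
    refine eq_rev_of_ends ?_ (by rw [h4, psrc_axis, pt_true, ← ptgt₂, ht])
    rw [h3, ptgt_axis, pt_true, ← ptgt₂, ht, Direction.vec_neg, add_neg_cancel_right]
  obtain rfl : z = rev X.E₂ := eq_rev_of_ends (h5.trans ht.symm) h6
  refine X.touch_corner (m := []) (s := [rev X.E₂]) (isNode_axis _ _) (isNode_axis _ _) ?_ (by simp)
    (by simpa using X.mem₂) (by simpa using hw)
  intro h
  have := congrArg psrc h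
  rw [psrc_axis, psrc_axis, pt_true, pt_false] at this
  exact δ_ne_zero (add_eq_left.1 this)

/-- Meant for `E₁` and the reverse of `E₃`. Contracting `E` makes the other two sides of the
triangle consecutive: one is the dart in direction `γ`, the other starts in the component of `v₀`.
-/
theorem touch_base_of_face {b : Bool} {γ : Direction} {E : (subdividedCuboid N D).Dart}
    (hES : E.1 ∈ S) (hu : Conn X.outer X.v₀ (src E)) (hE : ptgt E = X.pt b)
    (hn : ∀ b, psrc E ≠ X.pt b)
    (hf : FaceThrough (D := D) ∅ [psrc E, X.pt b + γ.vec, X.pt b]) :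
    X.Touch (some (X.axis b γ)) none := by
  obtain ⟨x, y, z, hw, h1, h2, h3, h4, h5, h6⟩ := hf.exists_triangle
  obtain rfl : y = rev (X.axis b γ) :=
    eq_rev_of_ends (by rw [h3, ptgt_axis]) (by rw [h4, psrc_axis])
  obtain rfl : z = rev E := eq_rev_of_ends (h5.trans hE.symm) h6
  have hxE : src x = src E := Subtype.ext h1
  refine X.touch_base (m := [x]) (s := [rev E]) (u := src E) (v := src (X.axis b γ))
    (isNode_axis _ _) hu ⟨hxE, ?_, ?_⟩ ?_ (by simpa using hES) (by simpa using hw)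
  · exact Subtype.ext (h3.trans h2.symm)
  · exact tgt_rev _
  · intro e he heS
    obtain rfl := List.mem_singleton.1 he
    exact mem_outer heS (fun b => h1 ▸ hn b) (fun b' => h2 ▸ pt_add_vec_ne b γ b')

theorem touch_base_false {γ γ' : Direction} (hγ : γ.1 ≠ γ'.1) (hδ : γ.vec + γ'.vec = X.δ) :
    X.Touch (some (X.axis false γ'.neg)) none := by
  have hδ' : X.α.vec + X.β.vec = γ.vec + γ'.vec := hδ.symm
  have ht : ptgt X.E₁ = psrc X.E₁ + γ.vec + γ'.vec := by rw [ptgt₁, X.psrc₁, hδ']; abel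
  have ht' : X.pt false = psrc X.E₁ + γ.vec + γ'.vec := by rw [← ht, ptgt₁, pt_false]
  have hmem : psrc X.E₁ + γ.vec + γ'.vec ∈ cuboidPoints N := ht' ▸ pt_mem _
  have hf := (faceThrough_of_diagonal (B := ∅) isDiagonalSet_empty (x := X.E₁) hγ ht
    (add_vec_mem hγ (psrc_mem _) hmem)
    (add_vec_mem hγ.symm (psrc_mem _) (by rwa [add_right_comm])) fun h => h).1
  refine touch_base_of_face (E := X.E₁) X.mem₁ (X.src₁ ▸ Conn.refl _) (by rw [ptgt₁, pt_false])
    (fun b h => TripleConfig.v₀_not_inner (X := X.toTripleConfig) ?_) ?_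
  · rw [← X.src₁]
    exact inner_src_iff.2 ⟨b, h⟩
  · rw [ht', Direction.vec_neg, add_neg_cancel_right]
    exact hf

theorem touch_base_true {γ γ' : Direction} (hγ : γ.1 ≠ γ'.1) (hδ : γ.vec + γ'.vec = X.δ) :
    X.Touch (some (X.axis true γ')) none := by
  have hδ' : X.α.vec + X.β.vec = γ.vec + γ'.vec := hδ.symm
  have hE : psrc (rev X.E₃) = X.p + (γ.vec + γ'.vec) + (γ.vec + γ'.vec) := by
    rw [psrc_rev, X.ptgt₃, hδ']
  have ht' : X.pt true = psrc (rev X.E₃) + γ.neg.vec + γ'.neg.vec := by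
    rw [pt_true, hE, ← hδ, Direction.vec_neg, Direction.vec_neg]; abel
  have ht : ptgt (rev X.E₃) = psrc (rev X.E₃) + γ.neg.vec + γ'.neg.vec := by
    rw [← ht', ptgt_rev, X.psrc₃]; rfl
  have hmem : psrc (rev X.E₃) + γ.neg.vec + γ'.neg.vec ∈ cuboidPoints N := ht' ▸ pt_mem _
  have hγ' : γ.neg.1 ≠ γ'.neg.1 := hγ
  have hf := (faceThrough_of_diagonal (B := ∅) isDiagonalSet_empty (x := rev X.E₃) hγ' ht
    (add_vec_mem hγ' (psrc_mem _) hmem)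
    (add_vec_mem hγ'.symm (psrc_mem _) (by rwa [add_right_comm])) fun h => h).1
  refine touch_base_of_face (E := rev X.E₃) X.mem₃ ?_ (ht.trans ht'.symm) (fun b => ?_) ?_
  -- Here the rest of the cycle enters: `v₃` lies in the outer component of `v₀`, so both ends of
  -- the triple lead to the same piece.
  · rw [src_rev, X.tgt₃]; exact X.conn
  · rw [hE, ← hδ', add_assoc]
    cases b
    · rw [pt_false]
      intro h
      have h1 : X.δ + X.δ = 0 := add_eq_left.1 h
      exact δ_ne_zero (self_eq_neg.1 (eq_neg_of_add_eq_zero_left h1))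
    · rw [pt_true, ← add_assoc]
      exact fun h => δ_ne_zero (add_eq_left.1 h)
  · have e : X.pt true + γ'.vec = psrc (rev X.E₃) + γ.neg.vec := by
      rw [ht', Direction.vec_neg γ', neg_add_cancel_right]
    rw [e, ht']
    exact hf

end StraightConfig

end Subdivided

/-! ### The branch sets of `G13` -/

namespace Subdivided

open TwoComplex

variable {N : Fin 3 → ℕ} {D : CuboidSquare N → Option Diagonal}

namespace StraightConfig

variable {S : Set (subdividedCuboid N D).E} (X : StraightConfig N D S)

theorem direction_cases (γ : Direction) : γ = X.α ∨ γ = X.α.neg ∨ γ = X.β ∨ γ = X.β.neg ∨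
    γ = (X.k, true) ∨ γ = (X.k, false) := by
  have hthird : ∀ i j k l : Fin 3, i ≠ j → k ≠ i ∧ k ≠ j → l = i ∨ l = j ∨ l = k := by decide
  rcases hthird _ _ _ γ.1 X.α_ne_β X.k_ne with h | h | h
  · rcases Direction.eq_or_eq_neg h with h | h <;> simp [h]
  · rcases Direction.eq_or_eq_neg h with h | h <;> simp [h]
  · obtain ⟨i, b⟩ := γ
    obtain rfl : i = X.k := h
    cases b <;> simp

open G13Vertex

open Classical in
/-- The vertex of `G13` for the dart in a given direction at an inner vertex. -/
noncomputable def label (b : Bool) (γ : Direction) : G13Vertex :=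
  if γ = X.α then cond b M X2
  else if γ = X.α.neg then cond b G13Vertex.S K
  else if γ = X.β then cond b R X3
  else if γ = X.β.neg then cond b L X1
  else if γ.2 then cond b Q Y1
  else cond b G13Vertex.N Y2

/-- The node at the center of the branch set of a vertex of `G13`. -/
noncomputable def center : G13Vertex → Option (subdividedCuboid N D).Dart
  | X1 => some (X.axis false X.β.neg)
  | X2 => some (X.axis false X.α)
  | X3 => some (X.axis false X.β)
  | Y1 => some (X.axis false (X.k, true))
  | Y2 => some (X.axis false (X.k, false))
  | Y3 => none
  | K => some (X.axis false X.α.neg)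
  | L => some (X.axis true X.β.neg)
  | M => some (X.axis true X.α)
  | .N => some (X.axis true (X.k, false))
  | Q => some (X.axis true (X.k, true))
  | R => some (X.axis true X.β)
  | .S => some (X.axis true X.α.neg)

open Classical in
/-- The vertex of `G13` to whose branch set a node belongs. -/
noncomputable def nodeLabel : Option (subdividedCuboid N D).Dart → G13Vertex
  | none => Y3
  | some d => X.label (decide (psrc d ≠ X.pt false)) (Direction.ofVec (ptgt d - psrc d))

theorem label_α (b : Bool) : X.label b X.α = cond b M X2 := if_pos rfl

theorem label_α_neg (b : Bool) : X.label b X.α.neg = cond b G13Vertex.S K := by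
  rw [label, if_neg X.α.neg_ne, if_pos rfl]

theorem label_β (b : Bool) : X.label b X.β = cond b R X3 := by
  have h : ∀ {γ : Direction}, γ.1 = X.α.1 → X.β ≠ γ :=
    fun h h' => X.α_ne_β (h.symm.trans (congrArg Prod.fst h').symm)
  rw [label, if_neg (h rfl), if_neg (h X.α.neg_fst), if_pos rfl]

theorem label_β_neg (b : Bool) : X.label b X.β.neg = cond b L X1 := by
  have h : ∀ {γ : Direction}, γ.1 = X.α.1 → X.β.neg ≠ γ :=
    fun h h' => X.α_ne_β (h.symm.trans (congrArg Prod.fst h').symm)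
  rw [label, if_neg (h rfl), if_neg (h X.α.neg_fst), if_neg X.β.neg_ne, if_pos rfl]

theorem label_k (b c : Bool) : X.label b (X.k, c) = cond c (cond b Q Y1) (cond b G13Vertex.N Y2) := by
  have h1 : ∀ {γ : Direction}, γ.1 = X.α.1 → (X.k, c) ≠ γ :=
    fun h h' => X.k_ne.1 ((congrArg Prod.fst h').trans h)
  have h2 : ∀ {γ : Direction}, γ.1 = X.β.1 → (X.k, c) ≠ γ :=
    fun h h' => X.k_ne.2 ((congrArg Prod.fst h').trans h)
  rw [label, if_neg (h1 rfl), if_neg (h1 X.α.neg_fst), if_neg (h2 rfl), if_neg (h2 X.β.neg_fst)]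
  cases c <;> rfl

theorem center_label (b : Bool) (γ : Direction) : X.center (X.label b γ) = some (X.axis b γ) := by
  rcases X.direction_cases γ with h | h | h | h | h | h <;> rw [h]
  · rw [label_α]; cases b <;> rfl
  · rw [label_α_neg]; cases b <;> rfl
  · rw [label_β]; cases b <;> rfl
  · rw [label_β_neg]; cases b <;> rfl
  · rw [label_k]; cases b <;> rfl
  · rw [label_k]; cases b <;> rfl

variable {X} in
theorem nodeLabel_some {d : (subdividedCuboid N D).Dart} {b : Bool} {τ : Fin 3 → ℤ}
    (hs : psrc d = X.pt b) (ht : ptgt d = X.pt b + τ) :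
    X.nodeLabel (some d) = X.label b (Direction.ofVec τ) := by
  have h1 : decide (psrc d ≠ X.pt false) = b := by
    rw [hs]
    cases b
    · simp
    · refine decide_eq_true fun h => δ_ne_zero (X := X) ?_
      rw [pt_true, pt_false] at h
      exact add_eq_left.1 h
  rw [nodeLabel, h1, ht, hs, add_sub_cancel_left]

theorem nodeLabel_axis (b : Bool) (γ : Direction) :
    X.nodeLabel (some (X.axis b γ)) = X.label b γ := by
  rw [nodeLabel_some (psrc_axis b γ) (ptgt_axis b γ), Direction.ofVec_vec]

theorem nodeLabel_center (w : G13Vertex) : X.nodeLabel (X.center w) = w := by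
  cases w <;> simp only [center, nodeLabel_axis, label_α, label_α_neg, label_β, label_β_neg,
    label_k, cond_true, cond_false]
  rfl

theorem center_mem (w : G13Vertex) : X.center w ∈ X.nodes := by
  cases w <;> first | exact none_mem_nodes | exact some_mem_nodes (isNode_axis _ _)

/-- A node that is not a coordinate dart, hence not a centre, is a diagonal; it shares a triangle
with each of the two coordinate darts of its square, and one of these labels it. -/
theorem touch_center {h : Option (subdividedCuboid N D).Dart} (hh : h ∈ X.nodes)
    (hne : h ≠ X.center (X.nodeLabel h)) : X.Touch h (X.center (X.nodeLabel h)) := by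
  match h, hh with
  | none, _ => exact (hne rfl).elim
  | some d, hd =>
    have hd : X.IsNode d := hd d rfl
    obtain ⟨b, hs⟩ := inner_src_iff.1 hd.1
    rcases dart_cases d with ⟨γ, ht⟩ | ⟨-, -, γ, γ', hγ, ht, -, -⟩
    · rw [hs] at ht
      refine (hne ?_).elim
      rw [nodeLabel_some hs ht, Direction.ofVec_vec, center_label]
      exact congrArg some (dart_ext (hs.trans (psrc_axis b γ).symm) (ht.trans (ptgt_axis b γ).symm))
    · rw [hs] at ht
      have hn := tgt_ne_of_isNode hd
      rw [nodeLabel_some hs (ht.trans (add_assoc _ _ _))]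
      rcases Direction.ofVec_add hγ with h | h <;> rw [h, center_label]
      · exact touch_diagonal hd hs hγ ht hn
      · exact touch_diagonal hd hs hγ.symm (ht.trans (add_right_comm _ _ _)) hn

/-- There are touching nodes with the labels `w` and `w'`. -/
def LabelAdj (w w' : G13Vertex) : Prop :=
  ∃ h ∈ X.nodes, ∃ h' ∈ X.nodes, X.nodeLabel h = w ∧ X.nodeLabel h' = w' ∧ X.Touch h h'

variable {X}

theorem LabelAdj.symm {w w' : G13Vertex} (h : X.LabelAdj w w') : X.LabelAdj w' w := by
  obtain ⟨h, hh, h', hh', e, e', ht⟩ := h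
  exact ⟨h', hh', h, hh, e', e, TripleConfig.Touch.symm ht⟩

theorem labelAdj_of_touch {b b' : Bool} {γ γ' : Direction}
    (h : X.Touch (some (X.axis b γ)) (some (X.axis b' γ'))) :
    X.LabelAdj (X.label b γ) (X.label b' γ') :=
  ⟨_, some_mem_nodes (isNode_axis _ _), _, some_mem_nodes (isNode_axis _ _), X.nodeLabel_axis _ _,
    X.nodeLabel_axis _ _, h⟩

theorem labelAdj_base {b : Bool} {γ : Direction} (h : X.Touch (some (X.axis b γ)) none) :
    X.LabelAdj (X.label b γ) Y3 :=
  ⟨_, some_mem_nodes (isNode_axis _ _), _, none_mem_nodes, X.nodeLabel_axis _ _, rfl, h⟩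

/-- A diagonal node between the two darts carries the label of one of them and touches the other. -/
theorem labelAdj_axis (b : Bool) {γ γ' : Direction} (hγ : γ.1 ≠ γ'.1)
    (h1 : γ.vec + γ'.vec ≠ X.δ) (h2 : γ.vec + γ'.vec ≠ -X.δ) :
    X.LabelAdj (X.label b γ) (X.label b γ') := by
  rcases touch_axis (X := X) (b := b) hγ h1 h2 with h | ⟨d, hd, hs, ht, h, h'⟩
  · exact labelAdj_of_touch h
  · rcases Direction.ofVec_add hγ with e | e
    · exact ⟨some d, some_mem_nodes hd, _, some_mem_nodes (isNode_axis b γ'),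
        by rw [nodeLabel_some hs ht, e], X.nodeLabel_axis _ _, h'⟩
    · exact LabelAdj.symm ⟨some d, some_mem_nodes hd, _, some_mem_nodes (isNode_axis b γ),
        by rw [nodeLabel_some hs ht, e], X.nodeLabel_axis _ _, h⟩

theorem neg_δ : -X.δ = X.α.neg.vec + X.β.neg.vec := by
  rw [Direction.vec_neg, Direction.vec_neg, δ, neg_add]

theorem labelAdj_k (b c : Bool) {γ : Direction} (hγ : γ.1 ≠ X.k) :
    X.LabelAdj (X.label b (X.k, c)) (X.label b γ) := by
  have h1 : ∀ {γ : Direction}, γ.1 = X.α.1 → (X.k, c) ≠ γ :=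
    fun h h' => X.k_ne.1 ((congrArg Prod.fst h').trans h)
  have h2 : ∀ {γ : Direction}, γ.1 = X.β.1 → (X.k, c) ≠ γ :=
    fun h h' => X.k_ne.2 ((congrArg Prod.fst h').trans h)
  refine labelAdj_axis b hγ.symm (Direction.vec_add_ne X.α_ne_β hγ.symm (h1 rfl) (h2 rfl)) ?_
  rw [neg_δ]
  exact Direction.vec_add_ne X.α_ne_β hγ.symm (h1 rfl) (h2 rfl)

theorem labelAdj_α_neg_β (b : Bool) : X.LabelAdj (X.label b X.α.neg) (X.label b X.β) := by
  have hne : X.α.neg.1 ≠ X.β.1 := X.α_ne_β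
  refine labelAdj_axis b hne (Direction.vec_add_ne X.α_ne_β hne X.α.neg_ne
    fun h => hne (congrArg Prod.fst h)) ?_
  rw [neg_δ, add_comm]
  exact Direction.vec_add_ne X.α_ne_β hne.symm (fun h => hne (congrArg Prod.fst h).symm)
    X.β.neg_ne.symm

theorem labelAdj_β_neg_α (b : Bool) : X.LabelAdj (X.label b X.β.neg) (X.label b X.α) := by
  have hne : X.β.neg.1 ≠ X.α.1 := X.α_ne_β.symm
  refine labelAdj_axis b hne (Direction.vec_add_ne X.α_ne_β hne
    (fun h => hne (congrArg Prod.fst h)) X.β.neg_ne) ?_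
  rw [neg_δ, add_comm]
  exact Direction.vec_add_ne X.α_ne_β hne.symm X.α.neg_ne.symm
    fun h => hne (congrArg Prod.fst h).symm

/-- The 26 edges are ten at each inner vertex (an octahedron without the pairs α, β and -α, -β),
four to Y₃ from the triangles at `E₁` and `E₃`, and two from those at `E₂`. -/
theorem labelAdj_of_adj {w w' : G13Vertex} (h : G13.Adj w w') : X.LabelAdj w w' := by
  have kα : X.α.1 ≠ X.k := X.k_ne.1.symm
  have kβ : X.β.1 ≠ X.k := X.k_ne.2.symm
  have β_α : X.β.vec + X.α.vec = X.δ := add_comm _ _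
  have a : ∀ b c, X.LabelAdj (X.label b (X.k, c)) (X.label b X.α) := fun b c => labelAdj_k b c kα
  have a' : ∀ b c, X.LabelAdj (X.label b (X.k, c)) (X.label b X.α.neg) :=
    fun b c => labelAdj_k b c kα
  have a'' : ∀ b c, X.LabelAdj (X.label b (X.k, c)) (X.label b X.β) := fun b c => labelAdj_k b c kβ
  have a''' : ∀ b c, X.LabelAdj (X.label b (X.k, c)) (X.label b X.β.neg) :=
    fun b c => labelAdj_k b c kβ
  have m : ∀ b, X.LabelAdj (X.label b X.α.neg) (X.label b X.β) := labelAdj_α_neg_β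
  have m' : ∀ b, X.LabelAdj (X.label b X.β.neg) (X.label b X.α) := labelAdj_β_neg_α
  have z := labelAdj_base (touch_base_false X.α_ne_β rfl)
  have z' := labelAdj_base (touch_base_false X.α_ne_β.symm β_α)
  have z'' := labelAdj_base (touch_base_true X.α_ne_β rfl)
  have z''' := labelAdj_base (touch_base_true X.α_ne_β.symm β_α)
  have t := labelAdj_of_touch (touch_cross X.α_ne_β rfl)
  have t' := labelAdj_of_touch (touch_cross X.α_ne_β.symm β_α)
  simp only [label_α, label_α_neg, label_β, label_β_neg, label_k, Bool.forall_bool, cond_true,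
    cond_false] at a a' a'' a''' m m' z z' z'' z''' t t'
  obtain ⟨⟨a1, a2⟩, a3, a4⟩ := a
  obtain ⟨⟨a5, a6⟩, a7, a8⟩ := a'
  obtain ⟨⟨b1, b2⟩, b3, b4⟩ := a''
  obtain ⟨⟨b5, b6⟩, b7, b8⟩ := a'''
  obtain ⟨m1, m2⟩ := m
  obtain ⟨m3, m4⟩ := m'
  have key := (SimpleGraph.fromEdgeSet_adj _).1 h |>.1
  simp only [mem_insert_iff, mem_singleton_iff, Sym2.eq_iff] at key
  rcases key with key | key | key | key | key | key | key | key | key | key | key | key | key |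
    key | key | key | key | key | key | key | key | key | key | key | key | key <;>
  rcases key with ⟨rfl, rfl⟩ | ⟨rfl, rfl⟩ <;>
  first | assumption | exact LabelAdj.symm ‹_›

theorem exists_adj (w : G13Vertex) : ∃ w', G13.Adj w w' := by
  cases w
  · exact ⟨Y1, by simp [G13]⟩
  · exact ⟨Y1, by simp [G13]⟩
  · exact ⟨Y1, by simp [G13]⟩
  · exact ⟨X1, by simp [G13]⟩
  · exact ⟨X1, by simp [G13]⟩
  · exact ⟨X1, by simp [G13]⟩
  · exact ⟨Y3, by simp [G13]⟩
  · exact ⟨M, by simp [G13]⟩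
  · exact ⟨L, by simp [G13]⟩
  · exact ⟨L, by simp [G13]⟩
  · exact ⟨L, by simp [G13]⟩
  · exact ⟨Q, by simp [G13]⟩
  · exact ⟨Q, by simp [G13]⟩

theorem hasLinkMinor : HasLinkMinor S X.v₁ G13 :=
  X.toTripleConfig.hasLinkMinor X.nodeLabel X.center X.center_mem X.nodeLabel_center
    (fun _ => X.touch_center) (fun _ _ => labelAdj_of_adj) exists_adj

end StraightConfig

end Subdivided

/-! ### Contracted cycles and the rest of a cycle -/

namespace TwoComplex

variable {C : TwoComplex}

theorem exists_dart_of_ends {e : C.E} {u v : C.V} (h : C.ends e = s(u, v)) :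
    ∃ d : C.Dart, d.1 = e ∧ src d = u ∧ tgt d = v := by
  rcases Sym2.eq_iff.1 h with ⟨h1, h2⟩ | ⟨h1, h2⟩
  exacts [⟨(e, true), rfl, h1, h2⟩, ⟨(e, false), rfl, h2, h1⟩]

theorem src_mem_ends (d : C.Dart) : src d ∈ C.ends d.1 := by
  obtain ⟨e, b⟩ := d
  cases b
  exacts [Sym2.mem_mk_right _ _, Sym2.mem_mk_left _ _]

theorem exists_src_eq_of_mem_ends {e : C.E} {v : C.V} (h : v ∈ C.ends e) :
    ∃ d : C.Dart, d.1 = e ∧ src d = v := by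
  rcases Sym2.mem_iff.1 h with rfl | rfl
  exacts [⟨(e, true), rfl, rfl⟩, ⟨(e, false), rfl, rfl⟩]

/-- The vertices contracted to the same vertex of `C/o` as those of a cycle `o` are those of `o`. -/
theorem IsCycle.toContract_eq_iff {o : Set C.E} (ho : C.IsCycle o) {d : C.Dart} (hd : d.1 ∈ o)
    {w : C.V} : C.toContract o w = C.toContract o (src d) ↔ ∃ e ∈ o, w ∈ C.ends e := by
  rw [TwoComplex.toContract_eq_iff]
  constructor
  · intro h
    refine (h.lift (r := fun a b => (∃ e ∈ o, a ∈ C.ends e) ↔ ∃ e ∈ o, b ∈ C.ends e)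
      ⟨fun _ => Iff.rfl, Iff.symm, Iff.trans⟩ fun e he => ?_).2 ⟨d.1, hd, src_mem_ends d⟩
    exact iff_of_true ⟨e, he, src_mem_ends (e, true)⟩ ⟨e, he, src_mem_ends (e, false)⟩
  · rintro ⟨e, he, hw⟩
    obtain ⟨d', rfl, rfl⟩ := exists_src_eq_of_mem_ends hw
    exact ho.conn he hd

/-- The ends of a path of three edges of a cycle are connected by the rest of the cycle. -/
theorem IsCycle.conn_outer {o : Set C.E} (ho : C.IsCycle o) {v₀ v₁ v₂ v₃ : C.V} {E₁ E₂ E₃ : C.Dart}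
    (src₁ : src E₁ = v₀) (tgt₁ : tgt E₁ = v₁) (src₂ : src E₂ = v₁) (tgt₂ : tgt E₂ = v₂)
    (src₃ : src E₃ = v₂) (tgt₃ : tgt E₃ = v₃) (h₀₁ : v₀ ≠ v₁) (h₀₂ : v₀ ≠ v₂) (h₁₂ : v₁ ≠ v₂)
    (h₂₃ : v₂ ≠ v₃) (ne₁₂ : E₁.1 ≠ E₂.1) (ne₂₃ : E₂.1 ≠ E₃.1) (mem₁ : E₁.1 ∈ o) (mem₂ : E₂.1 ∈ o)
    (mem₃ : E₃.1 ∈ o) :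
    Conn {e ∈ o | (C.tail e ≠ v₁ ∧ C.head e ≠ v₁) ∧ C.tail e ≠ v₂ ∧ C.head e ≠ v₂} v₀ v₃ := by
  have c0 : Conn (o \ {E₁.1}) v₁ v₀ := by
    rw [← src₁, ← tgt₁]
    have := ho.conn_diff mem₁
    obtain ⟨e, b⟩ := E₁
    cases b
    exacts [this, this.symm]
  -- On the cycle without `E₁`, the only edge left at `v₁` is `E₂`, so `v₁` can be skipped; after
  -- that only `E₃` is left at `v₂`, which can be skipped as well.
  have c1 := c0.of_unique_neighbor (b := v₂) h₀₁.symm h₁₂.symm fun d hd hs => by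
    rcases ho.eq_or_eq_of_src_eq (d₁ := rev E₁) (d₂ := E₂) hd.1 mem₁ mem₂
      (by rw [hs, src_rev, tgt₁]) (by rw [hs, src₂]) ne₁₂ with h | h
    · exact (hd.2 h).elim
    · rcases eq_or_eq_rev h with rfl | rfl
      · exact tgt₂
      · rw [src_rev, tgt₂] at hs
        exact (h₁₂ hs.symm).elim
  have c2 := c1.of_unique_neighbor (b := v₃) h₀₂.symm h₂₃.symm fun d hd hs => by
    rcases ho.eq_or_eq_of_src_eq (d₁ := rev E₂) (d₂ := E₃) hd.1.1 mem₂ mem₃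
      (by rw [hs, src_rev, tgt₂]) (by rw [hs, src₃]) ne₂₃ with h | h
    · have h' : d.1 = E₂.1 := h
      have h'' : v₁ ∈ C.ends d.1 := by
        rw [← src₂, h']
        exact src_mem_ends E₂
      rcases Sym2.mem_iff.1 h'' with h1 | h1
      exacts [(hd.2.1 h1.symm).elim, (hd.2.2 h1.symm).elim]
    · rcases eq_or_eq_rev h with rfl | rfl
      · exact tgt₃
      · rw [src_rev, tgt₃] at hs
        exact (h₂₃ hs.symm).elim
  refine Conn.symm (c2.mono ?_)
  rintro e ⟨⟨⟨h, -⟩, h'⟩, h''⟩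
  exact ⟨h, h', h''⟩

end TwoComplex

/-! ### The minor for a fundamental cycle, and the theorem -/

namespace Subdivided

open TwoComplex

variable {N : Fin 3 → ℕ} {D : CuboidSquare N → Option Diagonal}

/-- Doubled midpoints, relative to the base corner and in the two directions of the square, tell the
edges apart: the sides have (1, 0), (2, 1), (1, 2), (0, 1) and the diagonal has (1, 1). -/
theorem nodup_bdry (f : (subdividedCuboid N D).F) :
    (((subdividedCuboid N D).bdry f).map Prod.fst).Nodup := by
  have aux : ∀ {E : Type} (g : E → ℤ × ℤ) {b r t l : E}, g b = (1, 0) → g r = (2, 1) →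
      g t = (1, 2) → g l = (0, 1) → [b, r, t, l].Nodup ∧ ∀ d, g d = (1, 1) →
      [b, r, d].Nodup ∧ [d, t, l].Nodup ∧ [b, d, l].Nodup ∧ [r, t, d].Nodup := by
    intro E g b r t l hb hr ht hl
    refine ⟨.of_map g ?_, fun d hd => ⟨.of_map g ?_, .of_map g ?_, .of_map g ?_, .of_map g ?_⟩⟩ <;>
      simp [*]
  have coord : ∀ (s : CuboidSquare N) (e : (subdividedCuboid N D).E) (a b : ℤ),
      mid e = s.1.1 + s.1.1 + (a • unitVec s.1.2.1 + b • unitVec s.1.2.2) →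
      (mid e s.1.2.1 - 2 * s.1.1 s.1.2.1, mid e s.1.2.2 - 2 * s.1.1 s.1.2.2) = (a, b) := by
    intro s e a b h
    rw [h]
    simp only [Pi.add_apply, Pi.smul_apply, unitVec_self, unitVec_of_ne s.2.1.ne,
      unitVec_of_ne s.2.1.ne', smul_eq_mul, Prod.mk.injEq]
    constructor <;> ring
  have key := fun s : CuboidSquare N => aux
    (fun e : (subdividedCuboid N D).E =>
      (mid e s.1.2.1 - 2 * s.1.1 s.1.2.1, mid e s.1.2.2 - 2 * s.1.1 s.1.2.2))
    (coord s (Sum.inl s.bottom) 1 0 (by simp [mid, CuboidSquare.bottom]))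
    (coord s (Sum.inl s.right) 2 1 (by
      simp only [mid, CuboidSquare.right, two_smul, one_smul]; abel))
    (coord s (Sum.inl s.top) 1 2 (by
      simp only [mid, CuboidSquare.top, two_smul, one_smul]; abel))
    (coord s (Sum.inl s.left) 0 1 (by simp [mid, CuboidSquare.left]))
  rcases f with s | ⟨s, b⟩
  · exact (key s.1).1
  · have h := (key s.1).2 (Sum.inr s) (coord s.1 _ 1 1 (by simp only [mid, one_smul]))
    change ((triangleBdry Sum.inl s.1 (Sum.inr s) ((D s.1).get s.2) b).map Prod.fst).Nodup
    cases (D s.1).get s.2 <;> cases b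
    exacts [h.1, h.2.1, h.2.2.1, h.2.2.2]

theorem finite_edges : Finite (subdividedCuboid N D).E := by
  have h : ∀ e : (subdividedCuboid N D).E, mid e ∈ Icc (0 : Fin 3 → ℤ) (fun i => N i + N i) := by
    intro e
    rw [← psrc_add_ptgt (e, true)]
    have h1 := mem_cuboidPoints.1 (psrc_mem (N := N) (D := D) (e, true))
    have h2 := mem_cuboidPoints.1 (ptgt_mem (N := N) (D := D) (e, true))
    exact ⟨fun i => add_nonneg (h1 i).1 (h2 i).1, fun i => add_le_add (h1 i).2 (h2 i).2⟩
  have := (finite_Icc (0 : Fin 3 → ℤ) (fun i => N i + N i)).to_subtype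
  exact Finite.of_injective (fun e => (⟨mid e, h e⟩ : Icc (0 : Fin 3 → ℤ) (fun i => N i + N i)))
    fun e e' he => mid_injective (congrArg Subtype.val he)

/-- Letting `S` lie anywhere between `o` and `insert e T` covers both contractions: `S = o` for a
single cycle and `S = insert e T` for the whole tree together with `e`. -/
theorem exists_hasLinkMinor (hN : ∀ i, 0 < N i) {T o S : Set (subdividedCuboid N D).E}
    (hT : IsForest T) (hdiag : ∀ s, Sum.inr s ∈ T) (ho : (subdividedCuboid N D).IsCycle o)
    {e : (subdividedCuboid N D).E} (heT : e ∉ T) (hoT : o ⊆ insert e T) (hoS : o ⊆ S)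
    (hST : S ⊆ insert e T) (h : HasStraightTriple o) :
    ∃ d : (subdividedCuboid N D).Dart, d.1 ∈ o ∧ HasLinkMinor S (src d) G13 := by
  obtain ⟨v₀, v₁, v₂, v₃, s₁, s₂, s₃, m₁, m₂, m₃, e₁, e₂, e₃, h₁, h₂, i₁, i₂⟩ := h
  obtain ⟨E₁, hE₁, a₁, b₁⟩ := exists_dart_of_ends e₁
  obtain ⟨E₂, hE₂, a₂, b₂⟩ := exists_dart_of_ends e₂
  obtain ⟨E₃, hE₃, a₃, b₃⟩ := exists_dart_of_ends e₃
  obtain ⟨α, β, hαβ, hδ⟩ : ∃ α β : Direction, α.1 ≠ β.1 ∧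
      ptgt E₂ = psrc E₂ + (α.vec + β.vec) := by
    obtain ⟨_, b⟩ := E₂
    obtain rfl := hE₂
    obtain ⟨α, β, h, h', -⟩ := dart_inr s₂ b
    exact ⟨α, β, h, by rw [h', add_assoc]⟩
  have pa₁ := src_eq_iff.1 a₁
  have pa₂ := src_eq_iff.1 a₂
  have pa₃ := src_eq_iff.1 a₃
  have pb₁ := tgt_eq_iff.1 b₁
  have pb₂ := tgt_eq_iff.1 b₂
  have pb₃ := tgt_eq_iff.1 b₃
  set δ := α.vec + β.vec with hδdef
  have hδ0 : δ ≠ 0 := Direction.vec_add_ne_zero hαβ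
  have c₂ : v₂.1 = v₁.1 + δ := by rw [← pb₂, ← pa₂, hδ]
  have c₀ : v₀.1 = v₁.1 - δ := by
    rw [c₂, add_sub_cancel_left] at h₁
    rw [← h₁]; abel
  have c₃ : v₃.1 = v₁.1 + δ + δ := by
    rw [c₂, add_sub_cancel_left] at h₂
    rw [sub_eq_iff_eq_add.1 h₂.symm]; abel
  have n₀₁ : v₀ ≠ v₁ := fun h => hδ0 (by rw [h] at c₀; exact (sub_eq_self.1 c₀.symm))
  have n₁₂ : v₁ ≠ v₂ := fun h => hδ0 (by rw [← h] at c₂; exact (add_eq_left.1 c₂.symm))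
  have n₂₃ : v₂ ≠ v₃ := fun h => hδ0 (by rw [← h, c₂] at c₃; exact (add_eq_left.1 c₃.symm))
  have n₀₂ : v₀ ≠ v₂ := fun h => hδ0 (by
    rw [h, c₂, sub_eq_add_neg, add_right_inj] at c₀
    exact self_eq_neg.1 c₀)
  have mid₁ : mid E₁.1 = v₁.1 + v₁.1 - δ := by rw [← psrc_add_ptgt, pa₁, pb₁, c₀]; abel
  have mid₂ : mid E₂.1 = v₁.1 + v₁.1 + δ := by rw [← psrc_add_ptgt, pa₂, pb₂, c₂]; abel
  have mid₃ : mid E₃.1 = v₁.1 + v₁.1 + δ + δ + δ := by rw [← psrc_add_ptgt, pa₃, pb₃, c₂, c₃]; abel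
  have ne₁₂ : E₁.1 ≠ E₂.1 := fun h => hδ0 (by
    rw [← h, mid₁, sub_eq_add_neg, add_right_inj] at mid₂
    exact self_eq_neg.1 mid₂.symm)
  have ne₂₃ : E₂.1 ≠ E₃.1 := fun h => hδ0 (by
    rw [← h, mid₂, add_assoc _ δ δ, left_eq_add] at mid₃
    exact self_eq_neg.1 (eq_neg_of_add_eq_zero_left mid₃))
  -- A diagonal edge of `o` lies in `T`, so it differs from `e` and can be exchanged for it.
  have forest : ∀ e' ∈ o, (∃ s, e' = Sum.inr s) → IsForest (S \ {e'}) := by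
    rintro e' he' ⟨s, rfl⟩
    exact (hT.exchange ho heT hoT he' fun h => heT (h ▸ hdiag s)).mono
      (sdiff_subset_sdiff_left hST)
  have hB : IsDiagonalSet {E₁.1, E₂.1, E₃.1} := by
    rintro e' (rfl | rfl | rfl)
    exacts [⟨_, hE₁⟩, ⟨_, hE₂⟩, ⟨_, hE₃⟩]
  have int : ∀ {p : cuboidPoints N}, IsInteriorPoint p → ∀ γ : Direction,
      p.1 + γ.vec ∈ cuboidPoints N := fun {p} hp γ => mem_cuboidPoints.2 fun i => by
    have h1 := hp i
    have h2 := γ.vec_bound i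
    rw [Pi.add_apply]
    omega
  obtain ⟨k, hk⟩ := Direction.exists_third α.1 β.1
  have M₁ : E₁.1 ∈ o := hE₁ ▸ m₁
  have M₂ : E₂.1 ∈ o := hE₂ ▸ m₂
  have M₃ : E₃.1 ∈ o := hE₃ ▸ m₃
  have := finite_edges (N := N) (D := D)
  let X : StraightConfig N D S :=
    { v₀ := v₀
      v₁ := v₁
      v₂ := v₂
      v₃ := v₃
      E₁ := E₁
      E₂ := E₂
      E₃ := E₃
      src₁ := a₁
      tgt₁ := b₁
      src₂ := a₂
      tgt₂ := b₂
      src₃ := a₃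
      tgt₃ := b₃
      v₀_ne_v₁ := n₀₁
      v₀_ne_v₂ := n₀₂
      ne₁₂ := ne₁₂
      ne₂₃ := ne₂₃
      mem₁ := hoS M₁
      mem₂ := hoS M₂
      mem₃ := hoS M₃
      finite := Set.toFinite S
      nodup := nodup_bdry
      forest₁ := forest _ M₁ ⟨_, hE₁⟩
      forest₂ := forest _ M₂ ⟨_, hE₂⟩
      conn := (ho.conn_outer a₁ b₁ a₂ b₂ a₃ b₃ n₀₁ n₀₂ n₁₂ n₂₃ ne₁₂ ne₂₃ M₁ M₂ M₃).mono
        fun _ he => ⟨hoS he.1, he.2⟩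
      link := fun u hu hu' => linkConn_of_triple hB hN hδ0 (Direction.vec_add_bound hαβ) i₁
        (by rintro e' (rfl | rfl | rfl) <;> simp only [mid₁, mid₂, mid₃, true_or, or_true]) u
        (fun h => hu (Subtype.ext h)) fun h => hu' (Subtype.ext (h.trans c₂.symm))
      α := α
      β := β
      α_ne_β := hαβ
      k := k
      k_ne := hk
      p := v₁.1
      psrc₁ := pa₁.trans c₀
      psrc₂ := pa₂
      psrc₃ := pa₃.trans c₂
      ptgt₃ := pb₃.trans c₃
      diagonal := hB
      interior₁ := int i₁
      interior₂ := fun γ => by rw [← c₂]; exact int i₂ γ }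
  exact ⟨E₂, M₂, a₂ ▸ X.hasLinkMinor⟩

end Subdivided

theorem mainTheorem5 (n : ℕ) (hn : 20 ≤ n)
    (D : CuboidSquare ![2 * n + 1, n, n] → Option Diagonal)
    (T : Set (subdividedCuboid ![2 * n + 1, n, n] D).E)
    (hT : (subdividedCuboid ![2 * n + 1, n, n] D).IsSpanningTree T)
    (hdiag : ∀ s, Sum.inr s ∈ T)
    (htriple : ∀ o, (subdividedCuboid ![2 * n + 1, n, n] D).IsFundamentalCycle T o →
      HasStraightTriple o) :
    (∀ o, (subdividedCuboid ![2 * n + 1, n, n] D).IsFundamentalCycle T o →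
      ∃ v : ((subdividedCuboid ![2 * n + 1, n, n] D).contract o).V,
        (∀ w, (subdividedCuboid ![2 * n + 1, n, n] D).toContract o w = v ↔
          ∃ e ∈ o, w ∈ (subdividedCuboid ![2 * n + 1, n, n] D).ends e) ∧
        (((subdividedCuboid ![2 * n + 1, n, n] D).contract o).link v).HasMinor G13 ∧
        ¬ (((subdividedCuboid ![2 * n + 1, n, n] D).contract o).link v).IsPlanar) ∧
    (∀ e : ((subdividedCuboid ![2 * n + 1, n, n] D).contract T).E,
      ∃ v : (((subdividedCuboid ![2 * n + 1, n, n] D).contract T).contract {e}).V,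
        (∀ w, w = v) ∧
        ¬ ((((subdividedCuboid ![2 * n + 1, n, n] D).contract T).contract {e}).link v).IsPlanar) :=
  by
  have hN : ∀ i, 0 < (![2 * n + 1, n, n] : Fin 3 → ℕ) i := by
    intro i
    fin_cases i <;> simp <;> omega
  constructor
  · intro o ho
    obtain ⟨e, heT, heo, hoT⟩ := ho.2
    obtain ⟨d, hd, hm⟩ := Subdivided.exists_hasLinkMinor hN hT.isForest hdiag ho.1 heT hoT
      subset_rfl hoT (htriple o ho)
    exact ⟨_, fun w => ho.1.toContract_eq_iff hd, hm.contract, hm.contract.not_isPlanar_of_G13⟩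
  · intro e
    -- In the contraction of `T` the edge `e` is a loop. Its fundamental cycle supplies the triple,
    -- while all of `insert e T` is contracted.
    obtain ⟨o, ho, heo, hoT⟩ := hT.exists_isFundamentalCycle e.2
    obtain ⟨d, hd, hm⟩ := Subdivided.exists_hasLinkMinor hN hT.isForest hdiag ho.1 e.2 hoT hoT
      subset_rfl (htriple o ho)
    refine ⟨_, fun w => ?_, hm.contract_contract.not_isPlanar_of_G13⟩
    obtain ⟨w, rfl⟩ := Quotient.exists_rep w
    obtain ⟨w, rfl⟩ := Quotient.exists_rep w
    exact congrArg (((subdividedCuboid ![2 * n + 1, n, n] D).contract T).toContract {e})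
      (TwoComplex.toContract_eq_iff.2 (hT.conn w (TwoComplex.src d)))
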